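/- **Theorem (ODQL is probably approximately correct on all MDPs).** *MDPs and values.* Let $\mathsf M=(S,\bar s,A,E,\Delta)$ be a Markov decision process: a finite state set $S$, an initial state $\bar s\in S$, a finite non-empty set $E(s)\subseteq A$ of enabled actions for each $s\in S$, and a probability distribution $\Delta(s,a)$ on $S$ for each $s\in S$, $a\in E(s)$. No assumption is made on its end components. Let $F\subseteq S$ be a set of target states. Let $V(s)=\sup_\sigma \Pr^\sigma_s(\lozenge F)$, the supremum over all history-dependent randomised strategies of the probability to reach $F$ from $s$, and $V(s,a)=\sum_{s'}\Delta(s,a)(s')V(s')$. *Limited information.* The algorithm knows only $\bar s$, the function $E$, which states are targets, a (possibly empty) set $Z$ of non-target states $s$ with $\Delta(s,a)(s)=1$ for all $a\in E(s)$, and numbers $K\ge |S|$, $E_m\ge \max_s|E(s)|$ and $p_{\min}>0$ with $p_{\min}\le \Delta(s,a)(s')$ whenever $a\in E(s)$ and $\Delta(s,a)(s')>0$. It can otherwise only simulate executions of $\mathsf M$ that start in $\bar s$, choosing an enabled action in each step. *Parameters.* Let $\varepsilon,\delta>0$, let $n_A\ge\sum_{s}|E(s)|$ (for example $n_A=K E_m$;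 or $n_A=|A|$ if every action is enabled in at most one state), and put $$\bar\varepsilon=\frac{\varepsilon\,(p_{\min}/E_m)^{K}}{12K},\qquad m=\left\lceil\frac{\ln\!\big(24\,K n_A\,(1+K n_A/\bar\varepsilon)/\delta\big)}{2\bar\varepsilon^2}\right\rceil$$ (the parameters of delayed Q-learning with error tolerance $\delta/4$). Let $\kappa=KE_m+1$ and $c=\exp\!\big(-(p_{\min}/E_m)^\kappa/\kappa\big)$, and let $\ell_1,\ell_2,\dots$ be any natural numbers with $\ell_i\ge\kappa$ and $2c^{\ell_i}\ell_i^3\,(p_{\min}/E_m)^{-\kappa}\le\frac{\delta/2}{2^i}$ for all $i\ge1$. *The algorithm.* ODQL$(\varepsilon,\delta)$ maintains a collapsed MDP whose states are two terminal states $1$ and $0$ and disjoint sets of states of $\mathsf M$. Initially all targets are identified with $1$, the states in $Z$ with $0$, and every other state $s$ is the state $\{s\}$. The actions of a state $R\subseteq S$ are the pairs $(s,a)$ with $s\in R$, $a\in E(s)$ that have not been removed. There are bounds $U(s,a)$, $L(s,a)$, initially $1$ and $0$; $U(R)$, $L(R)$ are their maxima over the actions of $R$, and $U(1)=L(1)=1$,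 $U(0)=L(0)=0$. For $U$ and, separately, for $L$ there are for each pair an accumulator, a sample counter and the time of the last update attempt (all initially $0$) and a learning flag (initially true), and one number $t_*^U$ resp. $t_*^L$ (initially $0$), the time of the last successful update. For $i=1,2,\dots$ iteration $i$ is as follows. 1. If the difference of $U$ and $L$ at the current state containing $\bar s$ is less than $\varepsilon$, terminate. 2. EXPLORE: from $\bar s$ simulate a path of the collapsed MDP, in each state $R$ choosing uniformly an action $(s,a)$ maximising $U$ over the actions of $R$. If the simulated execution is in another state of $R$ than $s$, removed pairs enabled in the current state are played uniformly at random until $s$ is reached (these steps are not counted as part of the path; if none is enabled, the EXPLORE phase is begun again); then $a$ is played. The phase ends once the path has $3\ell_i^3$ states (go to 4) or, before that, once $1$ or $0$ is reached (go to 3). 3. UPDATE: the transitions of the path are processed, the last one first, the time $t$ being increased by one for each. Consider a transition with pair $(s,a)$ and successor $s'$. If the flag for $U$ is true, $U(s')$ is added to the accumulator and the counter is increased. When the counter reaches $m$, an update is attempted with the average $x$ of the $m$ samples: if $U(s,a)-x\ge2\bar\varepsilon$, then $U(s,a):=x+\bar\varepsilon$ and $t^U_*:=t$; otherwise, if the previous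 attempt for $(s,a)$ was at a time $\ge t^U_*$, its flag becomes false. In both cases $t$ is recorded as the time of the attempt, and accumulator and counter are reset. If the flag for $U$ is false and the last attempt was before $t^U_*$, the flag becomes true. Then $L$ is treated in the same way, with $L(s')$, the test $x-L(s,a)\ge2\bar\varepsilon$, the assignments $L(s,a):=x-\bar\varepsilon$ and $t_*^L:=t$, and with $\max(t^L_*,t^U_*)$ in place of $t_*^L$ in the rule that makes a flag true again. Continue with iteration $i+1$. 4. COLLAPSE: let $B$ be the set of pairs that occur more than $\ell_i$ times in the path, and $R$ the union of the states of the collapsed MDP in which they are enabled. Remove the pairs in $B$, and merge $R$ into one state; it is merged with $1$ if it contains a target, and otherwise merged with $0$ if it has no action left. The bounds of the remaining pairs are kept, while the time, accumulators, counters, flags, and times of attempts and of successful updates are initialised again. Continue with iteration $i+1$. *Claim.* With probability at least $1-\delta$ the algorithm terminates and its final bounds satisfy $$L(\bar s)\le V(\bar s)\le U(\bar s),\qquad U(\bar s)-L(\bar s)<\varepsilon,$$ where $U(\bar s)$, $L(\bar s)$ are the bounds at the state of the collapsed MDP that contains $\bar s$, and moreover $L(s,a)\le V(s,a)\le U(s,a)$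 for every action $(s,a)$ of that state (these are all the actions of $\bar s$ if $\bar s$ has not been collapsed). -/

import Mathlib

open scoped ENNReal

namespace ODQL

universe u v w

/-! ### Markov decision processes, strategies and reachability values -/

/-- A Markov decision process with state type `S` and action type `A`.  Only the transition
distributions `Δ s a` with `a ∈ E s` are meaningful.  Everything below is indexed by pairs `(s, a)`,
so an action name may be enabled in several states. -/
structure MDP (S : Type u) (A : Type v) where
  init : S
  E : S → Finset A
  E_nonempty : ∀ s, (E s).Nonempty
  Δ : S → A → PMF S

/-- A state is terminal if all its enabled actions loop on it with probability one. -/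
def MDP.IsTerminal {S : Type u} {A : Type v} (M : MDP S A) (s : S) : Prop :=
  ∀ a ∈ M.E s, M.Δ s a s = 1

/-- A (history dependent, randomised) strategy: given the state-action pairs seen so far and the
current state, a distribution on the actions enabled in the current state. -/
structure Strategy {S : Type u} {A : Type v} (M : MDP S A) where
  choose : List (S × A) → S → PMF A
  enabled : ∀ h s, ∀ a ∈ (choose h s).support, a ∈ M.E s

/-- The law of the path prefix with `n` steps from `s` under `σ`: the state-action pairs in
chronological order, and the last state. -/
noncomputable def pathLaw {S : Type u} {A : Type v} (M : MDP S A) (σ : Strategy M) (s : S) :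
    ℕ → PMF (List (S × A) × S)
  | 0 => PMF.pure ([], s)
  | n + 1 => (pathLaw M σ s n).bind fun p =>
      (σ.choose p.1 p.2).bind fun a =>
        (M.Δ p.2 a).map fun s' => (p.1 ++ [(p.2, a)], s')

/-- The probability of bounded reachability: visiting `F` within `k` steps. -/
noncomputable def reachWithin {S : Type u} {A : Type v} (M : MDP S A) (F : Finset S)
    (σ : Strategy M) (s : S) (k : ℕ) : ℝ≥0∞ :=
  (pathLaw M σ s k).toOuterMeasure {p | p.2 ∈ F ∨ ∃ q ∈ p.1, q.1 ∈ F}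

/-- The probability of reachability.  The event "visit `F`" is the increasing union of the events
"visit `F` within `k` steps", so its probability is the supremum of theirs. -/
noncomputable def reachProb {S : Type u} {A : Type v} (M : MDP S A) (F : Finset S)
    (σ : Strategy M) (s : S) : ℝ≥0∞ :=
  ⨆ k, reachWithin M F σ s k

/-- The value `V(s)`: the supremum over all strategies of the probability to reach `F`. -/
noncomputable def value {S : Type u} {A : Type v} (M : MDP S A) (F : Finset S) (s : S) : ℝ :=
  (⨆ σ : Strategy M, reachProb M F σ s).toReal

/-- The value `V(s, a)` of a state-action pair. -/
noncomputable def valueAct {S : Type u} {A : Type v} [Fintype S] (M : MDP S A) (F : Finset S)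
    (q : S × A) : ℝ :=
  ∑ s', (M.Δ q.1 q.2 s').toReal * value M F s'

/-! ### Algorithms that interact with an MDP only by simulating it -/

/-- A command of a simulating algorithm: halt; abandon the current simulation and start a new one in
the initial state; or play an action `a` in the current simulated state, and continue with the memory
`k s'` where `s'` is the sampled successor. -/
inductive Command (S : Type u) (A : Type v) (Mem : Type w) : Type (max u v w)
  | halt : Command S A Mem
  | restart (μ : Mem) : Command S A Mem
  | play (a : A) (k : S → Mem) : Command S A Mem

/-- A randomised algorithm that sees the current simulated state and its own memory. -/
structure SimAlgorithm (S : Type u) (A : Type v) (Mem : Type w) where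
  start : Mem
  decide : Mem → S → PMF (Command S A Mem)

/-- A snapshot of a computation. -/
inductive Snapshot (S : Type u) (Mem : Type w) : Type (max u w)
  | running (μ : Mem) (s : S) : Snapshot S Mem
  | stopped (μ : Mem) : Snapshot S Mem

/-- One step of the computation on `M`.  This is the only place where `Δ` is used, by drawing one
successor of the current simulated state. -/
noncomputable def SimAlgorithm.step {S : Type u} {A : Type v} {Mem : Type w}
    (alg : SimAlgorithm S A Mem) (M : MDP S A) : Snapshot S Mem → PMF (Snapshot S Mem)
  | .stopped μ => PMF.pure (.stopped μ)
  | .running μ s => (alg.decide μ s).bind fun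
      | .halt => PMF.pure (.stopped μ)
      | .restart μ' => PMF.pure (.running μ' M.init)
      | .play a k => (M.Δ s a).map fun s' => .running (k s') s'

/-- The law of the snapshot after `n` steps. -/
noncomputable def SimAlgorithm.law {S : Type u} {A : Type v} {Mem : Type w}
    (alg : SimAlgorithm S A Mem) (M : MDP S A) : ℕ → PMF (Snapshot S Mem)
  | 0 => PMF.pure (.running alg.start M.init)
  | n + 1 => (alg.law M n).bind (alg.step M)

/-- The probability that the computation on `M` terminates, with a final memory satisfying `Q`.
Stopped snapshots do not change any more, so the events "stopped within `n` steps with a memory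
satisfying `Q`" increase with `n`, and the probability of their union is the supremum. -/
noncomputable def SimAlgorithm.probStopsWith {S : Type u} {A : Type v} {Mem : Type w}
    (alg : SimAlgorithm S A Mem) (M : MDP S A) (Q : Mem → Prop) : ℝ≥0∞ :=
  ⨆ n, (alg.law M n).toOuterMeasure {c | ∃ μ, c = .stopped μ ∧ Q μ}

/-! ### Limited information -/

/-- What the algorithm knows: the initial state, the enabled actions, which states are targets, which
states (possibly none) are known sinks, and the numbers `K`, `Em`, `pmin`. -/
structure LimitedInfo (S : Type u) (A : Type v) where
  init : S
  E : S → Finset A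
  target : Finset S
  sink : Finset S
  K : ℕ
  Em : ℕ
  pmin : ℝ

/-- The information is correct for the MDP `M` with target set `F`. -/
structure LimitedInfo.IsAbout {S : Type u} {A : Type v} [Fintype S] (I : LimitedInfo S A)
    (M : MDP S A) (F : Finset S) : Prop where
  init_eq : I.init = M.init
  E_eq : I.E = M.E
  target_eq : I.target = F
  sink_terminal : ∀ s ∈ I.sink, M.IsTerminal s ∧ s ∉ F
  card_le : Fintype.card S ≤ I.K
  enabled_le : ∀ s, (M.E s).card ≤ I.Em
  pmin_pos : 0 < I.pmin
  pmin_le : ∀ s, ∀ a ∈ M.E s, ∀ s' ∈ (M.Δ s a).support, I.pmin ≤ (M.Δ s a s').toReal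

/-! ### The memory of the algorithm -/

/-- States of the current collapsed MDP: the terminal states `one` and `zero`, and sets of original
states (a set with one element is a state that has not been collapsed). -/
inductive Node (S : Type u) : Type u
  | one : Node S
  | zero : Node S
  | block (R : Finset S) : Node S

/-- The original states in a non-terminal node. -/
def Node.states {S : Type u} : Node S → Finset S
  | .one => ∅
  | .zero => ∅
  | .block R => R

/-- Whether the node is `one` or `zero`. -/
def Node.IsEnd {S : Type u} : Node S → Prop
  | .one => True
  | .zero => True
  | .block _ => False

/-- The learning data for one of the two bounds: the current estimates, and for each pair the
accumulator, the number of accumulated samples, the time of the last update attempt and the learning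
flag; `star` is the time of the last successful update of any pair. -/
structure Estimate (S : Type u) (A : Type v) where
  val : S × A → ℝ
  acc : S × A → ℝ
  cnt : S × A → ℕ
  last : S × A → ℕ
  learn : S × A → Bool
  star : ℕ

/-- Fresh learning data with given estimates. -/
def Estimate.fresh {S : Type u} {A : Type v} (val : S × A → ℝ) : Estimate S A where
  val := val
  acc := fun _ => 0
  cnt := fun _ => 0
  last := fun _ => 0
  learn := fun _ => true
  star := 0

/-- The memory.  `cls` sends an original state to its node in the current collapsed MDP, and `inner`
is the set of pairs removed by collapsing.  `time` counts the calls of the update procedure since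
the learning data were last initialised, and `iter` is the number of the current EXPLORE phase.
`path` is the explored path of the collapsed MDP, latest transition first, each transition being a
pair and the sampled successor; `goal` is a pair that has been selected but not yet played. -/
structure Memory (S : Type u) (A : Type v) where
  cls : S → Node S
  inner : Finset (S × A)
  U : Estimate S A
  L : Estimate S A
  time : ℕ
  iter : ℕ
  path : List ((S × A) × S)
  goal : Option (S × A)

section Algorithm

variable {S : Type u} {A : Type v} [DecidableEq S] [DecidableEq A]

/-- The actions `(s, a)` available in a set `R` of original states once `inner` is removed. -/
def available (E : S → Finset A) (inner : Finset (S × A)) (R : Finset S) : Finset (S × A) :=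
  (R.biUnion fun s => (E s).image fun a => (s, a)) \ inner

/-- The actions of a node of the current collapsed MDP. -/
def Memory.enabledAt (I : LimitedInfo S A) (μ : Memory S A) (ξ : Node S) : Finset (S × A) :=
  available I.E μ.inner ξ.states

/-- Maximum of `f` over a finite set (`0` on the empty set). -/
noncomputable def maxOver (T : Finset (S × A)) (f : S × A → ℝ) : ℝ :=
  if h : T.Nonempty then T.sup' h f else 0

/-- The estimate `U(ξ)` or `L(ξ)` of a node: `1` in `one`, `0` in `zero`, and otherwise the maximum
over the actions of the node. -/
noncomputable def Memory.nodeVal (I : LimitedInfo S A) (μ : Memory S A) (f : S × A → ℝ) :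
    Node S → ℝ
  | .one => 1
  | .zero => 0
  | .block R => maxOver (μ.enabledAt I (.block R)) f

/-- The current upper bound in the original state `s`. -/
noncomputable def Memory.upper (I : LimitedInfo S A) (μ : Memory S A) (s : S) : ℝ :=
  μ.nodeVal I μ.U.val (μ.cls s)

/-- The current lower bound in the original state `s`. -/
noncomputable def Memory.lower (I : LimitedInfo S A) (μ : Memory S A) (s : S) : ℝ :=
  μ.nodeVal I μ.L.val (μ.cls s)

open Classical in
/-- The actions of a node with maximal upper bound. -/
noncomputable def Memory.greedy (I : LimitedInfo S A) (μ : Memory S A) (ξ : Node S) :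
    Finset (S × A) :=
  (μ.enabledAt I ξ).filter fun q => ∀ q' ∈ μ.enabledAt I ξ, μ.U.val q' ≤ μ.U.val q

/-- The initial memory: target states are the state `one`, known sinks are the state `zero`, and the
bounds of all other states are `0` and `1`. -/
def startMemory (I : LimitedInfo S A) : Memory S A where
  cls := fun s => if s ∈ I.target then .one else if s ∈ I.sink then .zero else .block {s}
  inner := ∅
  U := Estimate.fresh fun _ => 1
  L := Estimate.fresh fun _ => 0
  time := 0
  iter := 1
  path := []
  goal := none

/-! ### The delayed Q-learning update -/

open Classical in
/-- Processing one sample `x` for the pair `q` at time `t`.  Here `sgn` is `1` for the upper and `-1`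
for the lower bound, and a pair that has stopped learning resumes if its last update attempt is
older than `wake`. -/
noncomputable def Estimate.update (m : ℕ) (ebar sgn : ℝ) (wake t : ℕ) (q : S × A) (x : ℝ)
    (e : Estimate S A) : Estimate S A :=
  if e.learn q = true then
    if e.cnt q + 1 = m then
      -- an update attempt with the `m` samples collected
      let avg : ℝ := (e.acc q + x) / m
      let e' : Estimate S A :=
        { e with
          acc := Function.update e.acc q 0
          cnt := Function.update e.cnt q 0
          last := Function.update e.last q t }
      if 2 * ebar ≤ sgn * (e.val q - avg) then
        { e' with val := Function.update e.val q (avg + sgn * ebar), star := t }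
      else if e.star ≤ e.last q then
        { e' with learn := Function.update e.learn q false }
      else e'
    else
      { e with
        acc := Function.update e.acc q (e.acc q + x)
        cnt := Function.update e.cnt q (e.cnt q + 1) }
  else if e.last q < wake then
    { e with learn := Function.update e.learn q true }
  else e

/-- The procedure UPDATE for a transition (pair and sampled successor). -/
noncomputable def Memory.update (I : LimitedInfo S A) (m : ℕ) (ebar : ℝ) (μ : Memory S A)
    (r : (S × A) × S) : Memory S A :=
  let t := μ.time + 1
  let U' := μ.U.update m ebar 1 μ.U.star t r.1 (μ.upper I r.2)
  let L' := μ.L.update m ebar (-1) (max μ.L.star U'.star) t r.1 (μ.lower I r.2)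
  { μ with U := U', L := L', time := t }

/-- The UPDATE phase: the transitions of the explored path are processed, the latest one first. -/
noncomputable def Memory.updatePhase (I : LimitedInfo S A) (m : ℕ) (ebar : ℝ) (μ : Memory S A) :
    Memory S A :=
  { μ.path.foldl (Memory.update I m ebar) μ with iter := μ.iter + 1, path := [], goal := none }

/-! ### Identification and collapsing of end components -/

/-- The pairs that occur more than `i` times in the explored path. -/
def Memory.appear (μ : Memory S A) (i : ℕ) : Finset (S × A) :=
  (μ.path.map Prod.fst).toFinset.filter fun q => i < (μ.path.map Prod.fst).count q

/-- The candidate end component formed by the pairs that occur more than `i` times is collapsed to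
one state; this state becomes `one` if it contains a target, and otherwise `zero` if no action is
left in it.  The bounds of the remaining pairs are kept and learning starts afresh from them. -/
def Memory.onTheFlyEC (I : LimitedInfo S A) (i : ℕ) (μ : Memory S A) : Memory S A :=
  let B := μ.appear i
  let R := B.biUnion fun q => (μ.cls q.1).states
  let ξ : Node S :=
    if (R ∩ I.target).Nonempty then .one
    else if available I.E (μ.inner ∪ B) R = ∅ then .zero
    else .block R
  { cls := fun s => if s ∈ R then ξ else μ.cls s
    inner := μ.inner ∪ B
    U := Estimate.fresh μ.U.val
    L := Estimate.fresh μ.L.val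
    time := 0
    iter := μ.iter + 1
    path := []
    goal := none }

/-! ### The algorithm -/

/-- Draw uniformly from `T` and continue with `f`; if `T` is empty, return `d`. -/
noncomputable def drawFrom {α : Type*} {β : Type*} (T : Finset α) (d : β) (f : α → PMF β) : PMF β :=
  if h : T.Nonempty then (PMF.uniformOfFinset T h).bind f else PMF.pure d

/-- The action `q = (s', a)` has been selected in the node of the current state `s`.  If `s = s'` then
`a` is played and the transition is appended to the path.  Otherwise one of the collapsed actions
enabled in `s` is played uniformly at random, and this step is not part of the path.  (If there is
none, which can happen only if a set that is not an end component has been collapsed, the EXPLORE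
phase is begun again.) -/
noncomputable def Memory.pursue (I : LimitedInfo S A) (μ : Memory S A) (s : S) (q : S × A) :
    PMF (Command S A (Memory S A)) :=
  if s = q.1 then
    PMF.pure (.play q.2 fun s' => { μ with path := (q, s') :: μ.path, goal := none })
  else
    drawFrom ((I.E s).filter fun b => (s, b) ∈ μ.inner)
      (.restart { μ with path := [], goal := none })
      fun b => PMF.pure (.play b fun _ => { μ with goal := some q })

open Classical in
/-- The on-the-fly delayed Q-learning algorithm with precision `ε`, parameters `m` and `ebar`, and
`ℓ i` the bound used in the `i`-th EXPLORE phase, whose paths have at most `3 (ℓ i)³` states. -/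
noncomputable def algorithm (I : LimitedInfo S A) (ε : ℝ) (m : ℕ) (ebar : ℝ) (ℓ : ℕ → ℕ) :
    SimAlgorithm S A (Memory S A) where
  start := startMemory I
  decide := fun μ s =>
    match μ.goal with
    | some q => μ.pursue I s q
    | none =>
      if μ.path = [] ∧ μ.upper I I.init - μ.lower I I.init < ε then
        PMF.pure .halt
      else if μ.path.length + 1 = 3 * ℓ μ.iter ^ 3 then
        PMF.pure (.restart (μ.onTheFlyEC I (ℓ μ.iter)))
      else if (μ.cls s).IsEnd then
        PMF.pure (.restart (μ.updatePhase I m ebar))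
      else
        drawFrom (μ.greedy I (μ.cls s)) (.restart { μ with path := [], goal := none }) (μ.pursue I s)

end Algorithm

/-! ### The parameters -/

/-- The parameter `ε̄` of delayed Q-learning for precision `ε`. -/
noncomputable def epsBar {S : Type u} {A : Type v} (I : LimitedInfo S A) (ε : ℝ) : ℝ :=
  ε * (I.pmin / I.Em) ^ I.K / (12 * I.K)

/-- The parameter `m` of delayed Q-learning for precision `ε` and error tolerance `τ`, where `nA` is a
bound for the number of actions. -/
noncomputable def dqlSamples {S : Type u} {A : Type v} (I : LimitedInfo S A) (nA : ℕ) (ε τ : ℝ) :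
    ℕ :=
  ⌈Real.log (6 * (I.K * nA) * (1 + I.K * nA / epsBar I ε) / τ) / (2 * epsBar I ε ^ 2)⌉₊

/-- `κ = K Em + 1`. -/
def kappa {S : Type u} {A : Type v} (I : LimitedInfo S A) : ℕ := I.K * I.Em + 1

/-- `c = exp (- (pmin / Em) ^ κ / κ)`. -/
noncomputable def cConst {S : Type u} {A : Type v} (I : LimitedInfo S A) : ℝ :=
  Real.exp (-((I.pmin / I.Em) ^ kappa I / kappa I))

/-- The condition on the numbers `ℓ i`, `i = 1, 2, …`, for error tolerance `δ`. -/
def Admissible {S : Type u} {A : Type v} (I : LimitedInfo S A) (δ : ℝ) (ℓ : ℕ → ℕ) : Prop :=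
  ∀ i, 1 ≤ i → kappa I ≤ ℓ i ∧
    2 * cConst I ^ ℓ i * (ℓ i : ℝ) ^ 3 * ((I.pmin / I.Em) ^ kappa I)⁻¹ ≤ δ / 2 / 2 ^ i

/-- ODQL with precision `ε` and error tolerance `δ`: the parameters `m` and `ε̄` are those of delayed
Q-learning with error tolerance `δ / 4`. -/
noncomputable def odql {S : Type u} {A : Type v} [DecidableEq S] [DecidableEq A]
    (I : LimitedInfo S A) (nA : ℕ) (ε δ : ℝ) (ℓ : ℕ → ℕ) : SimAlgorithm S A (Memory S A) :=
  algorithm I ε (dqlSamples I nA ε (δ / 4)) (epsBar I ε) ℓ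

/-- The final bounds are correct and `ε`-close at the initial state.  The first part is about the
maximal bounds of the initial state, the last part about the bounds of each of its actions.  If the
initial state has been collapsed, its actions are those of the collapsed state, and if it has been
merged with a terminal state there are none. -/
def CorrectOutput {S : Type u} {A : Type v} [Fintype S] [DecidableEq S] [DecidableEq A]
    (M : MDP S A) (F : Finset S) (I : LimitedInfo S A) (ε : ℝ) (μ : Memory S A) : Prop :=
  μ.lower I M.init ≤ value M F M.init ∧ value M F M.init ≤ μ.upper I M.init ∧
    μ.upper I M.init - μ.lower I M.init < ε ∧
    ∀ q ∈ μ.enabledAt I (μ.cls M.init),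
      μ.L.val q ≤ valueAct M F q ∧ valueAct M F q ≤ μ.U.val q

end ODQL

namespace ODQL

universe u v w

/-! ### Reachability values -/

section Values

variable {S : Type u} {A : Type v}

/-! The value is the least function that is 1 on targets and dominates its one-step averages. Hence
it is constant on an end component without targets, and there it equals the best V(s,a) among the
pairs that have not been removed. The invariant `Coherent` says that every block of the collapsed
MDP is such an end component, so bounds that are correct at pairs are correct at nodes
(`Memory.bound_correct`). The samples used by an update then err only in the harmless direction. It
remains to control three things.

Collapsing. A path that is cut off has, with high probability, soon entered a recurrent class of the
exploration chain and then played every pair of that class in each of ℓ+1 consecutive pieces of ℓ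
steps. So the pairs that occur more than ℓ times are exactly those of the class (`findsClass_of`,
`expect_not_findsClass_le`), and collapsing a recurrent class preserves the invariant
(`onTheFlyEC_coherent`). The errors δ/2/2^i sum to δ/2.

Learning. An update attempt fails only if the average of m samples is off by ε̄. By Hoeffding's
lemma this is controlled by an exponential supermartingale, with the factor exp(-2mε̄²). A path is
processed backwards, however, so a sample is seen together with what happened after it, and the
usual martingale argument does not apply. What survives is the product of the tilts along a whole
path: it does not depend on the order and has expectation at most 1. A window begun in the middle of
a path is bounded crudely by w per further sample, w being the largest tilt. Put η = (pmin/Em)^K.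
Either an end is reached after a pair without repeating it with probability at least η, or no path
through the pair ever ends and is processed. Since ε̄ is small compared with η, the crude bound
costs only a factor 2 (`expect_excess_le`, `expect_window_le`). The number of windows is limited by
a budget, as every successful update moves a bound by at least ε̄. Altogether, windows plus budgets
form a potential that does not increase in expectation, failures included (`expect_update_le`), and
its initial value contributes at most δ/2.

Termination. The quantity `Memory.work` falls whenever a processed sample changes the learning data
and whenever a class is collapsed. A processed path changes nothing only if all its pairs are
settled. At settled greedy pairs each bound is within 3ε̄ of its one-step mean, so U - L loses at
most 6ε̄ per transition, and it vanishes at ends. If only such pairs could be met, the gap would be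
at most 6ε̄K/η, which is less than ε. Thus as long as the gap is at least ε, the probability of a
phase without progress is at most 1 - η (`expect_settled_le`). `failProb_le` combines the three
parts by induction on the work. -/

/-- The strategy that `σ` plays after the first state-action pair `q`. -/
def Strategy.shift {M : MDP S A} (σ : Strategy M) (q : S × A) : Strategy M where
  choose h s := σ.choose (q :: h) s
  enabled h s a ha := σ.enabled (q :: h) s a ha

/-- `pathLaw` adds steps at the end, while all inductions below peel off the first step, after which
the shifted strategy governs the rest. -/
theorem pathLaw_succ_front (M : MDP S A) (σ : Strategy M) (s : S) (n : ℕ) :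
    pathLaw M σ s (n + 1) = (σ.choose [] s).bind fun a => (M.Δ s a).bind fun s' =>
      (pathLaw M (σ.shift (s, a)) s' n).map fun p => ((s, a) :: p.1, p.2) := by
  induction n with
  | zero =>
    simp [pathLaw, PMF.map, Function.comp_def, PMF.pure_bind]
  | succ n ih =>
    rw [pathLaw, ih]
    simp only [PMF.bind_bind]
    congr 1; funext a
    congr 1; funext s'
    conv_rhs => rw [pathLaw]
    simp [PMF.map, PMF.bind_bind, PMF.pure_bind, Strategy.shift, Function.comp_def]

theorem reachWithin_zero (M : MDP S A) (F : Finset S) (σ : Strategy M) (s : S) [Decidable (s ∈ F)] :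
    reachWithin M F σ s 0 = if s ∈ F then 1 else 0 := by
  simp [reachWithin, pathLaw, PMF.toOuterMeasure_pure_apply]

theorem reachWithin_le_one (M : MDP S A) (F : Finset S) (σ : Strategy M) (s : S) (k : ℕ) :
    reachWithin M F σ s k ≤ 1 := by
  unfold reachWithin
  rw [PMF.toOuterMeasure_apply]
  calc _ ≤ ∑' x, pathLaw M σ s k x := ENNReal.tsum_le_tsum fun x => Set.indicator_le_self _ _ x
    _ = 1 := PMF.tsum_coe _

theorem reachWithin_succ (M : MDP S A) (F : Finset S) (σ : Strategy M) (s : S) (hs : s ∉ F) (k : ℕ) :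
    reachWithin M F σ s (k + 1) =
      ∑' a, σ.choose [] s a * ∑' s', M.Δ s a s' * reachWithin M F (σ.shift (s, a)) s' k := by
  unfold reachWithin
  rw [pathLaw_succ_front]
  simp only [PMF.toOuterMeasure_bind_apply, PMF.toOuterMeasure_map_apply]
  congr 1; funext a; congr 2; funext s'; congr 3
  ext p; simp only [Set.mem_preimage, Set.mem_ofPred_eq, List.exists_mem_cons_iff, hs, false_or]

theorem reachWithin_of_mem (M : MDP S A) (F : Finset S) (σ : Strategy M) (s : S) (hs : s ∈ F)
    (k : ℕ) : reachWithin M F σ s k = 1 := by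
  classical
  cases k with
  | zero => rw [reachWithin_zero, if_pos hs]
  | succ k =>
    unfold reachWithin
    rw [pathLaw_succ_front]
    simp only [PMF.toOuterMeasure_bind_apply, PMF.toOuterMeasure_map_apply]
    have h1 : ∀ a s', (pathLaw M (σ.shift (s, a)) s' k).toOuterMeasure
        ((fun p => ((s, a) :: p.1, p.2)) ⁻¹' {p | p.2 ∈ F ∨ ∃ q ∈ p.1, q.1 ∈ F}) = 1 := by
      intro a s'
      rw [PMF.toOuterMeasure_apply_eq_one_iff]
      intro p _
      exact Or.inr ⟨(s, a), List.mem_cons_self, hs⟩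
    simp only [h1, mul_one, PMF.tsum_coe]

/-- Induction on the horizon for all strategies at once, because the first step replaces `σ` by a
shifted strategy. The upper bounds for the value at sinks and in end components rest on this. -/
theorem reachWithin_le_of_prefixed (M : MDP S A) (F : Finset S) (v : S → ℝ≥0∞)
    (h1 : ∀ s ∈ F, 1 ≤ v s)
    (h2 : ∀ s ∉ F, ∀ a ∈ M.E s, ∑' s', M.Δ s a s' * v s' ≤ v s)
    (k : ℕ) (σ : Strategy M) (s : S) : reachWithin M F σ s k ≤ v s := by
  classical
  induction k generalizing σ s with
  | zero => rw [reachWithin_zero]; split_ifs with h; exacts [h1 s h, zero_le]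
  | succ k ih =>
    by_cases hs : s ∈ F
    · exact (reachWithin_le_one ..).trans (h1 s hs)
    rw [reachWithin_succ M F σ s hs]
    calc _ ≤ ∑' a, σ.choose [] s a * v s := by
          refine ENNReal.tsum_le_tsum fun a => ?_
          by_cases ha : σ.choose [] s a = 0
          · simp [ha]
          refine mul_le_mul_right ?_ _
          refine le_trans (ENNReal.tsum_le_tsum fun s' => ?_)
            (h2 s hs a (σ.enabled _ _ _ ((PMF.mem_support_iff _ _).2 ha)))
          exact mul_le_mul_right (ih _ _) _
      _ = v s := by rw [ENNReal.tsum_mul_right, PMF.tsum_coe, one_mul]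

theorem reachWithin_mono (M : MDP S A) (F : Finset S) (s : S) (k : ℕ) :
    ∀ (σ : Strategy M), reachWithin M F σ s k ≤ reachWithin M F σ s (k + 1) := by
  classical
  induction k generalizing s with
  | zero =>
    intro σ
    rw [reachWithin_zero]
    split_ifs with h
    · rw [reachWithin_of_mem _ _ _ _ h]
    · exact zero_le
  | succ k ih =>
    intro σ
    by_cases hs : s ∈ F
    · simp [reachWithin_of_mem _ _ _ _ hs]
    rw [reachWithin_succ M F σ s hs, reachWithin_succ M F σ s hs]
    exact ENNReal.tsum_le_tsum fun a => mul_le_mul_right (ENNReal.tsum_le_tsum fun s' =>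
      mul_le_mul_right (ih _ _) _) _

/-- The value as an extended nonnegative real. -/
noncomputable def evalue (M : MDP S A) (F : Finset S) (s : S) : ℝ≥0∞ :=
  ⨆ σ : Strategy M, reachProb M F σ s

theorem evalue_le_of_prefixed (M : MDP S A) (F : Finset S) (v : S → ℝ≥0∞)
    (h1 : ∀ s ∈ F, 1 ≤ v s)
    (h2 : ∀ s ∉ F, ∀ a ∈ M.E s, ∑' s', M.Δ s a s' * v s' ≤ v s) (s : S) :
    evalue M F s ≤ v s :=
  iSup_le fun σ => iSup_le fun k => reachWithin_le_of_prefixed M F v h1 h2 k σ s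

/-- An arbitrary strategy. -/
noncomputable def Strategy.default (M : MDP S A) : Strategy M where
  choose _ s := PMF.pure (M.E_nonempty s).choose
  enabled _ s a ha := by
    rw [PMF.support_pure, Set.mem_singleton_iff] at ha
    exact ha ▸ (M.E_nonempty s).choose_spec

theorem evalue_le_one (M : MDP S A) (F : Finset S) (s : S) : evalue M F s ≤ 1 :=
  iSup_le fun _ => iSup_le fun _ => reachWithin_le_one ..

theorem evalue_of_mem (M : MDP S A) (F : Finset S) (s : S) (hs : s ∈ F) : evalue M F s = 1 := by
  refine le_antisymm (evalue_le_one ..) ?_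
  rw [← reachWithin_of_mem M F (Strategy.default M) s hs 0]
  exact le_iSup_of_le (Strategy.default M) (le_iSup (fun k => reachWithin M F _ s k) 0)

open Classical in
/-- Play `a` first in `s`, and then continue with the strategy that `η` assigns to the second
state. -/
noncomputable def Strategy.prepend (M : MDP S A) (s : S) (a : A) (ha : a ∈ M.E s)
    (η : S → Strategy M) : Strategy M where
  choose h t := match h with
    | [] => if t = s then PMF.pure a else (Strategy.default M).choose [] t
    | [_] => (η t).choose [] t
    -- The second entry of the history records the second state, hence which continuation has been
    -- chosen.
    | _ :: q :: h => (η q.1).choose (q :: h) t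
  enabled h t b hb := by
    match h with
    | [] =>
      dsimp only at hb
      split_ifs at hb with hts
      · rw [PMF.support_pure, Set.mem_singleton_iff] at hb
        subst hts; exact hb ▸ ha
      · exact (Strategy.default M).enabled [] t b hb
    | [_] => exact (η t).enabled _ t b hb
    | _ :: q :: h => exact (η q.1).enabled _ t b hb

theorem reachWithin_prepend (M : MDP S A) (F : Finset S) (s : S) (hs : s ∉ F) (a : A)
    (ha : a ∈ M.E s) (η : S → Strategy M) (k : ℕ) :
    reachWithin M F (Strategy.prepend M s a ha η) s (k + 1) =
      ∑' s', M.Δ s a s' * reachWithin M F (η s') s' k := by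
  classical
  -- The history of the shifted strategy starts with a pair of `s'`, so it always consults `η s'`.
  have key : ∀ s', pathLaw M ((Strategy.prepend M s a ha η).shift (s, a)) s' k =
      pathLaw M (η s') s' k := by
    intro s'
    cases k with
    | zero => rfl
    | succ k =>
      rw [pathLaw_succ_front, pathLaw_succ_front]
      rfl
  rw [reachWithin_succ M F _ s hs, tsum_eq_single a]
  · have : (Strategy.prepend M s a ha η).choose [] s a = 1 := by
      simp [Strategy.prepend]
    rw [this, one_mul]
    simp only [reachWithin, key]
  · intro b hb
    have : (Strategy.prepend M s a ha η).choose [] s b = 0 := by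
      simp [Strategy.prepend, hb]
    rw [this, zero_mul]

theorem value_nonneg (M : MDP S A) (F : Finset S) (s : S) : 0 ≤ value M F s := ENNReal.toReal_nonneg

theorem evalue_ne_top (M : MDP S A) (F : Finset S) (s : S) : evalue M F s ≠ ⊤ :=
  ne_top_of_le_ne_top ENNReal.one_ne_top (evalue_le_one M F s)

theorem value_le_one (M : MDP S A) (F : Finset S) (s : S) : value M F s ≤ 1 := by
  have := ENNReal.toReal_mono ENNReal.one_ne_top (evalue_le_one M F s)
  rwa [ENNReal.toReal_one] at this

theorem value_of_mem (M : MDP S A) (F : Finset S) (s : S) (hs : s ∈ F) : value M F s = 1 := by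
  have := evalue_of_mem M F s hs
  unfold evalue at this
  simp [value, this]

variable [Fintype S]

/-- Good continuations have to be chosen in all successors simultaneously. Once the values are
suprema over the common index of a family of strategies and a horizon, the indices are directed, so
sum and supremum commute and `reachWithin_prepend` applies to each index. -/
theorem sum_mul_evalue_le (M : MDP S A) (F : Finset S) (s : S) (a : A) (ha : a ∈ M.E s) :
    ∑ s', M.Δ s a s' * evalue M F s' ≤ evalue M F s := by
  classical
  by_cases hs : s ∈ F
  · rw [evalue_of_mem M F s hs]
    calc _ ≤ ∑ s', M.Δ s a s' * 1 := Finset.sum_le_sum fun s' _ => mul_le_mul_right (evalue_le_one ..) _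
      _ = 1 := by simp only [mul_one]; rw [← tsum_fintype (L := .unconditional _)]; exact PMF.tsum_coe _
  have hmono : ∀ (σ : Strategy M) t, Monotone (reachWithin M F σ t) := fun σ t =>
    monotone_nat_of_le_succ fun k => reachWithin_mono M F t k σ
  have e1 : ∀ s', evalue M F s' =
      ⨆ i : (S → Strategy M) × ℕ, reachWithin M F (i.1 s') s' i.2 := by
    intro s'
    apply le_antisymm
    · exact iSup_le fun σ => iSup_le fun k =>
        le_iSup (fun i : (S → Strategy M) × ℕ => reachWithin M F (i.1 s') s' i.2) (fun _ => σ, k)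
    · exact iSup_le fun i => le_iSup_of_le (i.1 s') (le_iSup (fun k => reachWithin M F _ s' k) i.2)
  simp only [e1, ENNReal.mul_iSup]
  rw [ENNReal.finsetSum_iSup]
  · rw [← e1]
    refine iSup_le fun i => ?_
    have h := reachWithin_prepend M F s hs a ha i.1 i.2
    rw [tsum_fintype] at h
    rw [← h]
    exact le_iSup_of_le (Strategy.prepend M s a ha i.1)
      (le_iSup (fun k => reachWithin M F _ s k) (i.2 + 1))
  · intro i j
    -- An upper bound of two indices: the larger horizon and, in each state, the strategy that is
    -- better at this horizon.
    refine ⟨(fun t => if reachWithin M F (i.1 t) t (max i.2 j.2) ≤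
      reachWithin M F (j.1 t) t (max i.2 j.2) then j.1 t else i.1 t, max i.2 j.2), fun t => ?_⟩
    have hi := hmono (i.1 t) t (le_max_left i.2 j.2)
    have hj := hmono (j.1 t) t (le_max_right i.2 j.2)
    constructor <;> refine mul_le_mul_right ?_ _ <;> dsimp only <;> split_ifs with h
    · exact hi.trans h
    · exact hi
    · exact hj
    · exact hj.trans (le_of_not_ge h)

theorem sum_toReal_pmf (p : PMF S) : ∑ s, (p s).toReal = 1 := by
  have h := PMF.tsum_coe p
  rw [tsum_fintype] at h
  rw [← ENNReal.toReal_sum (fun s _ => PMF.apply_ne_top p s), h, ENNReal.toReal_one]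

theorem valueAct_nonneg (M : MDP S A) (F : Finset S) (q : S × A) : 0 ≤ valueAct M F q :=
  Finset.sum_nonneg fun _ _ => mul_nonneg ENNReal.toReal_nonneg (value_nonneg ..)

theorem valueAct_le_one (M : MDP S A) (F : Finset S) (q : S × A) : valueAct M F q ≤ 1 :=
  calc valueAct M F q ≤ ∑ s', (M.Δ q.1 q.2 s').toReal * 1 :=
        Finset.sum_le_sum fun _ _ => mul_le_mul_of_nonneg_left (value_le_one ..) ENNReal.toReal_nonneg
    _ = 1 := by simp only [mul_one]; exact sum_toReal_pmf _

theorem valueAct_le_value (M : MDP S A) (F : Finset S) (s : S) (a : A) (ha : a ∈ M.E s) :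
    valueAct M F (s, a) ≤ value M F s := by
  have h := ENNReal.toReal_mono (evalue_ne_top M F s) (sum_mul_evalue_le M F s a ha)
  rw [ENNReal.toReal_sum (fun s' _ =>
    ENNReal.mul_ne_top (PMF.apply_ne_top _ _) (evalue_ne_top M F s'))] at h
  simp only [ENNReal.toReal_mul] at h
  exact h

theorem value_le_of_prefixed (M : MDP S A) (F : Finset S) (v : S → ℝ) (h0 : ∀ s, 0 ≤ v s)
    (h1 : ∀ s ∈ F, 1 ≤ v s)
    (h2 : ∀ s ∉ F, ∀ a ∈ M.E s, ∑ s', (M.Δ s a s').toReal * v s' ≤ v s) (s : S) :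
    value M F s ≤ v s := by
  have h := evalue_le_of_prefixed M F (fun s => ENNReal.ofReal (v s))
    (fun s hs => by simpa using ENNReal.ofReal_le_ofReal (h1 s hs)) (fun s hs a ha => by
      refine le_trans (le_of_eq ?_) (ENNReal.ofReal_le_ofReal (h2 s hs a ha))
      rw [tsum_fintype, ENNReal.ofReal_sum_of_nonneg fun s' _ => mul_nonneg ENNReal.toReal_nonneg (h0 s')]
      refine Finset.sum_congr rfl fun s' _ => ?_
      rw [ENNReal.ofReal_mul ENNReal.toReal_nonneg, ENNReal.ofReal_toReal (PMF.apply_ne_top _ _)]) s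
  have := ENNReal.toReal_mono ENNReal.ofReal_ne_top h
  rwa [ENNReal.toReal_ofReal (h0 s)] at this

/-- One step with a pair of `J`. -/
def JStep (M : MDP S A) (J : Set (S × A)) (s t : S) : Prop :=
  ∃ a, (s, a) ∈ J ∧ t ∈ (M.Δ s a).support

/-- A function that dominates its averages over the pairs of `J` is constant along them if these
lead from everywhere to everywhere. -/
theorem le_of_superharmonic (M : MDP S A) (J : Set (S × A)) (R : Finset S) (f : S → ℝ)
    (hf : ∀ s ∈ R, ∀ a, (s, a) ∈ J → ∑ s', (M.Δ s a s').toReal * f s' ≤ f s)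
    (hcl : ∀ s ∈ R, ∀ t, JStep M J s t → t ∈ R)
    (hconn : ∀ s ∈ R, ∀ t ∈ R, Relation.ReflTransGen (JStep M J) s t)
    {s t : S} (hs : s ∈ R) (ht : t ∈ R) : f s ≤ f t := by
  -- Minimum principle: where the minimum is attained, every successor has to attain it as well.
  obtain ⟨m, hm, hmin⟩ := R.exists_min_image f ⟨t, ht⟩
  suffices h : ∀ u, Relation.ReflTransGen (JStep M J) m u → u ∈ R ∧ f u = f m by
    rw [(h s (hconn m hm s hs)).2]; exact hmin t ht
  intro u hu
  induction hu with
  | refl => exact ⟨hm, rfl⟩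
  | @tail u w _ hstep ih =>
    obtain ⟨hu, hfu⟩ := ih
    obtain ⟨a, ha, hw⟩ := hstep
    refine ⟨hcl u hu w ⟨a, ha, hw⟩, ?_⟩
    by_contra hne
    have hlt : f m < f w := lt_of_le_of_ne (hmin w (hcl u hu w ⟨a, ha, hw⟩)) (Ne.symm hne)
    have h1 := hf u hu a ha
    have h2 : ∑ s', (M.Δ u a s').toReal * f m < ∑ s', (M.Δ u a s').toReal * f s' := by
      refine Finset.sum_lt_sum (fun s' _ => ?_) ⟨w, Finset.mem_univ _, ?_⟩
      · by_cases h0 : M.Δ u a s' = 0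
        · simp [h0]
        · exact mul_le_mul_of_nonneg_left (hmin s' (hcl u hu s' ⟨a, ha, (PMF.mem_support_iff _ _).2 h0⟩))
            ENNReal.toReal_nonneg
      · refine mul_lt_mul_of_pos_left hlt (ENNReal.toReal_pos ?_ (PMF.apply_ne_top _ _))
        exact (PMF.mem_support_iff _ _).1 hw
    rw [← Finset.sum_mul, sum_toReal_pmf, one_mul] at h2
    linarith

/-- In an end component without targets, the value is at most any `w` that dominates the values of
the pairs that leave it. -/
theorem value_le_of_endComponent (M : MDP S A) (F : Finset S) (J : Set (S × A)) (R : Finset S)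
    (hRF : ∀ s ∈ R, s ∉ F) (hJ : ∀ q ∈ J, q.2 ∈ M.E q.1)
    (hcl : ∀ s ∈ R, ∀ t, JStep M J s t → t ∈ R)
    (hconn : ∀ s ∈ R, ∀ t ∈ R, Relation.ReflTransGen (JStep M J) s t)
    (w : ℝ) (hw0 : 0 ≤ w)
    (hw : ∀ s ∈ R, ∀ a ∈ M.E s, (s, a) ∉ J → valueAct M F (s, a) ≤ w) :
    ∀ s ∈ R, value M F s ≤ w := by
  classical
  intro s hs
  by_contra! hlt
  have hconst : ∀ t ∈ R, value M F t = value M F s := by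
    have hsup : ∀ s ∈ R, ∀ a, (s, a) ∈ J → ∑ s', (M.Δ s a s').toReal * value M F s' ≤ value M F s :=
      fun s _ a ha => valueAct_le_value M F s a (hJ _ ha)
    exact fun t ht => le_antisymm (le_of_superharmonic M J R _ hsup hcl hconn ht hs)
      (le_of_superharmonic M J R _ hsup hcl hconn hs ht)
  have hle : ∀ t, (if t ∈ R then w else value M F t) ≤ value M F t := by
    intro t
    split_ifs with h
    · rw [hconst t h]; exact hlt.le
    · exact le_rfl
  -- Lowering the value to `w` on `R` leaves it pre-fixed: pairs of `J` stay in `R`, where the new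
  -- function is constant, and the other pairs of `R` are bounded by `w`. This contradicts that the
  -- value is the least pre-fixed function.
  have h := value_le_of_prefixed M F (fun t => if t ∈ R then w else value M F t)
    (fun t => by split_ifs; exacts [hw0, value_nonneg ..])
    (fun t ht => by
      rw [if_neg fun h => hRF t h ht, value_of_mem M F t ht])
    (fun t ht a ha => by
      have hav : ∑ s', (M.Δ t a s').toReal * (if s' ∈ R then w else value M F s') ≤
          valueAct M F (t, a) :=
        Finset.sum_le_sum fun s' _ => mul_le_mul_of_nonneg_left (hle s') ENNReal.toReal_nonneg
      split_ifs with htR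
      · by_cases hta : (t, a) ∈ J
        · have : ∀ s', (M.Δ t a s').toReal * (if s' ∈ R then w else value M F s') =
              (M.Δ t a s').toReal * w := by
            intro s'
            by_cases h0 : M.Δ t a s' = 0
            · simp [h0]
            · rw [if_pos (hcl t htR s' ⟨a, hta, (PMF.mem_support_iff _ _).2 h0⟩)]
          simp only [this, ← Finset.sum_mul, sum_toReal_pmf, one_mul, le_refl]
        · exact hav.trans (hw t htR a ha hta)
      · exact hav.trans (valueAct_le_value M F t a ha)) s
  rw [if_pos hs] at h
  linarith

end Values

/-! ### Finite Markov chains with observed transitions -/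

/-- A finite Markov chain: in a state `s` that is not an end, a pair `q` is drawn with probability
`pol s q`, and the next state `s'` with probability `D q s'`. -/
structure Chain (Q : Type u) (S : Type v) [Fintype S] where
  acts : Finset Q
  pol : S → Q → ℝ
  D : Q → S → ℝ
  End : S → Prop
  pol_nonneg : ∀ s q, 0 ≤ pol s q
  D_nonneg : ∀ q s, 0 ≤ D q s
  pol_sum : ∀ s, ¬ End s → ∑ q ∈ acts, pol s q = 1
  D_sum : ∀ q ∈ acts, ∑ s, D q s = 1

namespace Chain

variable {Q : Type u} {S : Type v} [Fintype S] (c : Chain Q S)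

/-- A transition has positive probability. -/
def Pos (s : S) (r : Q × S) : Prop :=
  ¬ c.End s ∧ r.1 ∈ c.acts ∧ 0 < c.pol s r.1 ∧ 0 < c.D r.1 r.2

/-- The expectation of `h` at the next transition. -/
noncomputable def avg (s : S) (h : Q × S → ℝ) : ℝ :=
  ∑ q ∈ c.acts, c.pol s q * ∑ s', c.D q s' * h (q, s')

theorem avg_mono {s : S} (hs : ¬ c.End s) {h h' : Q × S → ℝ} (hh : ∀ r, c.Pos s r → h r ≤ h' r) :
    c.avg s h ≤ c.avg s h' := by
  refine Finset.sum_le_sum fun q hq => ?_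
  rcases (c.pol_nonneg s q).eq_or_lt with h0 | h0
  · simp [← h0]
  refine mul_le_mul_of_nonneg_left (Finset.sum_le_sum fun s' _ => ?_) h0.le
  rcases (c.D_nonneg q s').eq_or_lt with h1 | h1
  · simp [← h1]
  exact mul_le_mul_of_nonneg_left (hh _ ⟨hs, hq, h0, h1⟩) h1.le

theorem avg_congr {s : S} (hs : ¬ c.End s) {h h' : Q × S → ℝ} (hh : ∀ r, c.Pos s r → h r = h' r) :
    c.avg s h = c.avg s h' :=
  le_antisymm (c.avg_mono hs fun r hr => (hh r hr).le) (c.avg_mono hs fun r hr => (hh r hr).ge)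

theorem avg_nonneg {s : S} {h : Q × S → ℝ} (hh : ∀ r, 0 ≤ h r) : 0 ≤ c.avg s h :=
  Finset.sum_nonneg fun q _ => mul_nonneg (c.pol_nonneg s q)
    (Finset.sum_nonneg fun s' _ => mul_nonneg (c.D_nonneg q s') (hh _))

theorem avg_add (s : S) (h h' : Q × S → ℝ) :
    c.avg s (fun r => h r + h' r) = c.avg s h + c.avg s h' := by
  simp only [avg, mul_add, Finset.sum_add_distrib]

theorem avg_mul (s : S) (a : ℝ) (h : Q × S → ℝ) :
    c.avg s (fun r => a * h r) = a * c.avg s h := by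
  simp only [avg, Finset.mul_sum]
  refine Finset.sum_congr rfl fun q _ => Finset.sum_congr rfl fun s' _ => ?_
  ring

theorem avg_const {s : S} (hs : ¬ c.End s) (a : ℝ) : c.avg s (fun _ => a) = a := by
  simp only [avg, ← Finset.sum_mul]
  have : ∀ q ∈ c.acts, c.pol s q * ((∑ i, c.D q i) * a) = c.pol s q * a := fun q hq => by
    rw [c.D_sum q hq, one_mul]
  rw [Finset.sum_congr rfl this, ← Finset.sum_mul, c.pol_sum s hs, one_mul]

theorem single_le_avg {s : S} {r : Q × S} (hr : r.1 ∈ c.acts) {h : Q × S → ℝ} (hh : ∀ r, 0 ≤ h r) :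
    c.pol s r.1 * c.D r.1 r.2 * h r ≤ c.avg s h := by
  have h1 : c.D r.1 r.2 * h r ≤ ∑ s', c.D r.1 s' * h (r.1, s') :=
    Finset.single_le_sum (f := fun s' => c.D r.1 s' * h (r.1, s'))
      (fun s' _ => mul_nonneg (c.D_nonneg _ _) (hh _)) (Finset.mem_univ r.2)
  refine le_trans ?_ (Finset.single_le_sum
    (f := fun q => c.pol s q * ∑ s', c.D q s' * h (q, s')) (fun q _ => mul_nonneg (c.pol_nonneg s q)
    (Finset.sum_nonneg fun s' _ => mul_nonneg (c.D_nonneg q s') (hh _))) hr)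
  rw [mul_assoc]
  exact mul_le_mul_of_nonneg_left h1 (c.pol_nonneg _ _)

open Classical in
/-- The expectation of `gT` at the path from `s` if it reaches an end before step `n`, and of `gC` if
it has made `n` steps without this. -/
noncomputable def expect : ℕ → S → (List (Q × S) → ℝ) → (List (Q × S) → ℝ) → ℝ
  -- Ends are not tested here: a path that has made all its steps counts as cut off even if it has
  -- just reached an end. The algorithm likewise tests the length first.
  | 0, _, _, gC => gC []
  | n + 1, s, gT, gC => if c.End s then gT [] else
      c.avg s fun r => expect n r.2 (fun l => gT (r :: l)) (fun l => gC (r :: l))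

/-- The last state of a path from `s`. -/
def lastState : S → List (Q × S) → S
  | s, [] => s
  | _, r :: l => lastState r.2 l

/-- The list is a path of positive probability from `s`. -/
def IsPath : S → List (Q × S) → Prop
  | _, [] => True
  | s, r :: l => c.Pos s r ∧ IsPath r.2 l

theorem expect_mono (n : ℕ) : ∀ (s : S) {gT gT' gC gC' : List (Q × S) → ℝ},
    (∀ l, c.IsPath s l → l.length < n → c.End (lastState s l) → gT l ≤ gT' l) →
    (∀ l, c.IsPath s l → l.length = n → gC l ≤ gC' l) →
    c.expect n s gT gC ≤ c.expect n s gT' gC' := by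
  induction n with
  | zero => intro s _ _ _ _ _ hC; exact hC [] trivial rfl
  | succ n ih =>
    intro s _ _ _ _ hT hC
    simp only [expect]
    split_ifs with hs
    · exact hT [] trivial (Nat.succ_pos n) hs
    · refine c.avg_mono hs fun r hr => ih r.2 (fun l hl hn he => hT _ ⟨hr, hl⟩ ?_ he)
        (fun l hl hn => hC _ ⟨hr, hl⟩ ?_)
      · simpa using hn
      · simpa using hn

theorem expect_congr (n : ℕ) (s : S) {gT gT' gC gC' : List (Q × S) → ℝ}
    (hT : ∀ l, c.IsPath s l → l.length < n → c.End (lastState s l) → gT l = gT' l)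
    (hC : ∀ l, c.IsPath s l → l.length = n → gC l = gC' l) :
    c.expect n s gT gC = c.expect n s gT' gC' :=
  le_antisymm (c.expect_mono n s (fun l h1 h2 h3 => (hT l h1 h2 h3).le) fun l h1 h2 => (hC l h1 h2).le)
    (c.expect_mono n s (fun l h1 h2 h3 => (hT l h1 h2 h3).ge) fun l h1 h2 => (hC l h1 h2).ge)

theorem expect_const (n : ℕ) (s : S) (a : ℝ) : c.expect n s (fun _ => a) (fun _ => a) = a := by
  induction n generalizing s with
  | zero => rfl
  | succ n ih =>
    simp only [expect, ih]
    split_ifs with hs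
    · rfl
    · exact c.avg_const hs a

theorem expect_nonneg (n : ℕ) (s : S) {gT gC : List (Q × S) → ℝ} (hT : ∀ l, 0 ≤ gT l)
    (hC : ∀ l, 0 ≤ gC l) : 0 ≤ c.expect n s gT gC := by
  have h := c.expect_mono n s (gT := fun _ => 0) (gC := fun _ => 0)
    (fun l _ _ _ => hT l) (fun l _ _ => hC l)
  rwa [c.expect_const] at h

theorem expect_le_const (n : ℕ) (s : S) {gT gC : List (Q × S) → ℝ} {a : ℝ}
    (hT : ∀ l, gT l ≤ a) (hC : ∀ l, gC l ≤ a) : c.expect n s gT gC ≤ a :=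
  (c.expect_mono n s (fun l _ _ _ => hT l) (fun l _ _ => hC l)).trans (c.expect_const n s a).le

theorem expect_add (n : ℕ) : ∀ (s : S) (gT gT' gC gC' : List (Q × S) → ℝ),
    c.expect n s (fun l => gT l + gT' l) (fun l => gC l + gC' l) =
      c.expect n s gT gC + c.expect n s gT' gC' := by
  induction n with
  | zero => intros; rfl
  | succ n ih =>
    intro s _ _ _ _
    simp only [expect]
    split_ifs
    · rfl
    · simp only [ih, avg_add]

theorem expect_mul (n : ℕ) : ∀ (s : S) (a : ℝ) (gT gC : List (Q × S) → ℝ),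
    c.expect n s (fun l => a * gT l) (fun l => a * gC l) = a * c.expect n s gT gC := by
  induction n with
  | zero => intros; rfl
  | succ n ih =>
    intro s _ _ _
    simp only [expect]
    split_ifs
    · rfl
    · simp only [ih, avg_mul]

theorem expect_sum {ι : Type*} (I : Finset ι) (n : ℕ) (s : S) (gT gC : ι → List (Q × S) → ℝ) :
    c.expect n s (fun l => ∑ i ∈ I, gT i l) (fun l => ∑ i ∈ I, gC i l) =
      ∑ i ∈ I, c.expect n s (gT i) (gC i) := by
  classical
  induction I using Finset.induction_on with
  | empty => simpa using c.expect_const n s 0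
  | insert a I ha ih =>
    simp only [Finset.sum_insert ha]
    rw [expect_add, ih]

theorem expect_succ_mono (n : ℕ) : ∀ (s : S) {g : List (Q × S) → ℝ}, (∀ l, 0 ≤ g l) →
    c.expect n s g (fun _ => 0) ≤ c.expect (n + 1) s g (fun _ => 0) := by
  induction n with
  | zero => intro s g hg; exact c.expect_nonneg 1 s hg fun _ => le_rfl
  | succ n ih =>
    intro s g hg
    rw [expect, expect]
    split_ifs with hs
    · exact le_rfl
    · exact c.avg_mono hs fun r _ => ih r.2 fun l => hg _

/-! #### Reaching a set of transitions -/

open Classical in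
/-- The probability that one of the first `n` transitions is in `T`, and only pairs satisfying `ok`
are played until then. -/
noncomputable def hit (ok : Q → Prop) (T : Q × S → Prop) : ℕ → S → ℝ
  | 0, _ => 0
  | n + 1, s => if c.End s then 0 else
      c.avg s fun r => if ok r.1 then (if T r then 1 else hit ok T n r.2) else 0

theorem hit_nonneg (ok : Q → Prop) (T : Q × S → Prop) (n : ℕ) (s : S) : 0 ≤ c.hit ok T n s := by
  induction n generalizing s with
  | zero => exact le_rfl
  | succ n ih =>
    rw [hit]
    split_ifs
    · exact le_rfl
    · refine c.avg_nonneg fun r => ?_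
      split_ifs
      exacts [zero_le_one, ih _, le_rfl]

theorem hit_le_one (ok : Q → Prop) (T : Q × S → Prop) (n : ℕ) (s : S) : c.hit ok T n s ≤ 1 := by
  induction n generalizing s with
  | zero => exact zero_le_one
  | succ n ih =>
    rw [hit]
    split_ifs with hs
    · exact zero_le_one
    · refine le_trans (c.avg_mono hs (h' := fun _ => 1) fun r _ => ?_) (c.avg_const hs 1).le
      split_ifs
      exacts [le_rfl, ih _, zero_le_one]

theorem hit_succ_mono (ok : Q → Prop) (T : Q × S → Prop) (n : ℕ) (s : S) :
    c.hit ok T n s ≤ c.hit ok T (n + 1) s := by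
  induction n generalizing s with
  | zero => exact c.hit_nonneg ok T 1 s
  | succ n ih =>
    rw [hit, hit]
    split_ifs with hs
    · exact le_rfl
    · refine c.avg_mono hs fun r _ => ?_
      split_ifs
      exacts [le_rfl, ih _, le_rfl]

theorem hit_mono (ok : Q → Prop) (T : Q × S → Prop) {n k : ℕ} (h : n ≤ k) (s : S) :
    c.hit ok T n s ≤ c.hit ok T k s :=
  monotone_nat_of_le_succ (f := fun n => c.hit ok T n s) (fun n => c.hit_succ_mono ok T n s) h

/-- A transition in `T` can be reached by playing only pairs that satisfy `ok`. -/
inductive CanHit (ok : Q → Prop) (T : Q × S → Prop) : S → Prop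
  | now {s : S} (r : Q × S) (hr : c.Pos s r) (hok : ok r.1) (hT : T r) : CanHit ok T s
  | later {s : S} (r : Q × S) (hr : c.Pos s r) (hok : ok r.1) (h : CanHit ok T r.2) :
      CanHit ok T s

/-- The policy is the same in all states of a block, and the transitions from a block with `b` states
have probability at least `x ^ b`. -/
structure Bounded (x : ℝ) (blk : S → Finset S) : Prop where
  pos : 0 < x
  le_one : x ≤ 1
  not_end : ∀ s, ¬ c.End s → ∀ t ∈ blk s, ¬ c.End t
  pol_eq : ∀ s, ¬ c.End s → ∀ t ∈ blk s, c.pol t = c.pol s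
  le : ∀ s r, c.Pos s r → x ^ (blk s).card ≤ c.pol s r.1 * c.D r.1 r.2

open Classical in
/-- The states that can reach `T` within `n` transitions. -/
noncomputable def attr (ok : Q → Prop) (T : Q × S → Prop) : ℕ → Finset S
  | 0 => ∅
  | n + 1 => Finset.univ.filter fun s =>
      ∃ r, c.Pos s r ∧ ok r.1 ∧ (T r ∨ r.2 ∈ attr ok T n)

theorem mem_attr_succ {ok : Q → Prop} {T : Q × S → Prop} {n : ℕ} {s : S} :
    s ∈ c.attr ok T (n + 1) ↔ ∃ r, c.Pos s r ∧ ok r.1 ∧ (T r ∨ r.2 ∈ c.attr ok T n) := by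
  classical
  rw [attr, Finset.mem_filter]
  simp only [Finset.mem_univ, true_and]

theorem attr_succ_mono (ok : Q → Prop) (T : Q × S → Prop) (n : ℕ) :
    c.attr ok T n ⊆ c.attr ok T (n + 1) := by
  induction n with
  | zero => exact Finset.empty_subset _
  | succ n ih =>
    intro s hs
    rw [mem_attr_succ] at hs ⊢
    obtain ⟨r, h1, h2, h3⟩ := hs
    exact ⟨r, h1, h2, h3.imp_right fun h => ih h⟩

theorem attr_mono (ok : Q → Prop) (T : Q × S → Prop) : Monotone (c.attr ok T) :=
  monotone_nat_of_le_succ (c.attr_succ_mono ok T)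

theorem attr_stable (ok : Q → Prop) (T : Q × S → Prop) {n : ℕ}
    (h : c.attr ok T (n + 1) = c.attr ok T n) : ∀ k, c.attr ok T (n + k) = c.attr ok T n := by
  intro k
  induction k with
  | zero => rfl
  | succ k ih =>
    ext s
    rw [← h, ← add_assoc, mem_attr_succ, mem_attr_succ, ih]

/-- Each strict increase adds a state, and two equal consecutive sets make the sequence constant. -/
theorem attr_subset_card (ok : Q → Prop) (T : Q × S → Prop) (n : ℕ) :
    c.attr ok T n ⊆ c.attr ok T (Fintype.card S) := by
  have key : ∀ n, n ≤ (c.attr ok T n).card ∨ c.attr ok T (n + 1) = c.attr ok T n := by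
    intro n
    induction n with
    | zero => exact Or.inl (Nat.zero_le _)
    | succ n ih =>
      by_cases h : c.attr ok T (n + 1) = c.attr ok T n
      · exact Or.inr ((c.attr_stable ok T h 2).trans h.symm)
      · have h1 := ih.resolve_right h
        have h2 := Finset.card_lt_card ((c.attr_succ_mono ok T n).ssubset_of_ne (Ne.symm h))
        exact Or.inl (by omega)
  have hst : c.attr ok T (Fintype.card S + 1) = c.attr ok T (Fintype.card S) := by
    rcases key (Fintype.card S) with h | h
    · have h1 : c.attr ok T (Fintype.card S) = Finset.univ :=
        Finset.eq_univ_of_card _ (le_antisymm (Finset.card_le_univ _) h)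
      exact le_antisymm (h1 ▸ Finset.subset_univ _) (c.attr_succ_mono ok T _)
    · exact h
  rcases le_total n (Fintype.card S) with h | h
  · exact c.attr_mono ok T h
  · obtain ⟨k, rfl⟩ := Nat.exists_eq_add_of_le h
    exact (c.attr_stable ok T hst k).le

theorem CanHit.mem_attr {ok : Q → Prop} {T : Q × S → Prop} {s : S} (h : c.CanHit ok T s) :
    s ∈ c.attr ok T (Fintype.card S) := by
  suffices h : ∃ n, s ∈ c.attr ok T n from h.elim fun n hn => c.attr_subset_card ok T n hn
  induction h with
  | now r hr hok hT =>
    exact ⟨1, by rw [mem_attr_succ]; exact ⟨r, hr, hok, Or.inl hT⟩⟩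
  | later r hr hok _ ih =>
    obtain ⟨n, hn⟩ := ih
    exact ⟨n + 1, by
      rw [mem_attr_succ]; exact ⟨r, hr, hok, Or.inr hn⟩⟩

theorem attr_not_end {ok : Q → Prop} {T : Q × S → Prop} {n : ℕ} {s : S} (h : s ∈ c.attr ok T n) :
    ¬ c.End s := by
  cases n with
  | zero => exact absurd h (Finset.notMem_empty s)
  | succ n =>
    rw [mem_attr_succ] at h
    obtain ⟨r, hr, _⟩ := h
    exact hr.1

-- The exponent counts states and not steps. Since the policy is the same throughout a block, a
-- whole block enters the attractor at the same stage, and the price `x ^ b` for leaving a block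
-- with `b` states is covered by these `b` new states.
variable {c} in
theorem Bounded.le_hit_of_mem_attr {x : ℝ} {blk : S → Finset S} (hc : c.Bounded x blk)
    (ok : Q → Prop) (T : Q × S → Prop) (n : ℕ) (s : S) (h : s ∈ c.attr ok T n) :
    x ^ (c.attr ok T n).card ≤ c.hit ok T n s := by
  classical
  induction n generalizing s with
  | zero => exact absurd h (Finset.notMem_empty s)
  | succ n ih =>
    by_cases hn : s ∈ c.attr ok T n
    · exact (pow_le_pow_of_le_one hc.pos.le hc.le_one (Finset.card_le_card (c.attr_succ_mono ok T n))).trans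
        ((ih s hn).trans (c.hit_succ_mono ok T n s))
    have hs := c.attr_not_end h
    have hmem : ∀ t ∈ blk s, t ∈ c.attr ok T (n + 1) \ c.attr ok T n := by
      have hiff : ∀ t ∈ blk s, ∀ r, c.Pos t r ↔ c.Pos s r := fun t ht r => by
        simp only [Pos, hc.pol_eq s hs t ht, hs, hc.not_end s hs t ht]
      intro t ht
      rw [Finset.mem_sdiff]
      constructor
      · rw [mem_attr_succ] at h ⊢
        simpa only [hiff t ht] using h
      · intro htn
        apply hn
        cases n with
        | zero => exact absurd htn (Finset.notMem_empty t)
        | succ n =>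
          rw [mem_attr_succ] at htn ⊢
          simpa only [hiff t ht] using htn
    have hcard : (blk s).card + (c.attr ok T n).card ≤ (c.attr ok T (n + 1)).card := by
      have h1 := Finset.card_le_card hmem
      rw [Finset.card_sdiff_of_subset (c.attr_succ_mono ok T n)] at h1
      have h2 := Finset.card_le_card (c.attr_succ_mono ok T n)
      omega
    have h' := h
    rw [mem_attr_succ] at h'
    obtain ⟨r, hr, hok, hT⟩ := h'
    rw [hit, if_neg hs]
    refine le_trans ?_ (c.single_le_avg (r := r) hr.2.1 fun r => ?_)
    · rw [if_pos hok]
      calc x ^ (c.attr ok T (n + 1)).card ≤ x ^ ((blk s).card + (c.attr ok T n).card) :=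
            pow_le_pow_of_le_one hc.pos.le hc.le_one hcard
        _ = x ^ (blk s).card * x ^ (c.attr ok T n).card := pow_add _ _ _
        _ ≤ _ := by
          refine mul_le_mul (hc.le s r hr) ?_ (pow_nonneg hc.pos.le _)
            (mul_nonneg (c.pol_nonneg _ _) (c.D_nonneg _ _))
          split_ifs with hTr
          · exact pow_le_one₀ hc.pos.le hc.le_one
          · exact ih _ (hT.resolve_left hTr)
    · split_ifs
      exacts [zero_le_one, c.hit_nonneg _ _ _ _, le_rfl]

variable {c} in
/-- A set of transitions that can be reached is reached within `card S` steps with probability at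
least `x ^ k`, where `k` is any bound for the number of states that are not ends. -/
theorem Bounded.le_hit {x : ℝ} {blk : S → Finset S} (hc : c.Bounded x blk)
    {ok : Q → Prop} {T : Q × S → Prop} {s : S} (h : c.CanHit ok T s) {k : ℕ}
    (hk : ∀ X : Finset S, (∀ t ∈ X, ¬ c.End t) → X.card ≤ k) {n : ℕ} (hn : Fintype.card S ≤ n) :
    x ^ k ≤ c.hit ok T n s :=
  (pow_le_pow_of_le_one hc.pos.le hc.le_one (hk _ fun _ ht => c.attr_not_end ht)).trans
    ((hc.le_hit_of_mem_attr ok T _ s h.mem_attr).trans (c.hit_mono ok T hn s))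

end Chain

namespace Chain

variable {Q : Type u} {S : Type v} [Fintype S] (c : Chain Q S)

/-! #### Weighted occurrences of a pair on paths that end

A path is processed backwards, so what happens at an occurrence of `q₀` depends on the rest of the
path.  The lemma `expect_excess_le` says that the number of occurrences of `q₀` before such an event
has a small exponential moment. -/

theorem avg_mono_act {s : S} {h h' : Q × S → ℝ}
    (hh : ∀ q ∈ c.acts, 0 < c.pol s q → ∑ s', c.D q s' * h (q, s') ≤ ∑ s', c.D q s' * h' (q, s')) :
    c.avg s h ≤ c.avg s h' := by
  refine Finset.sum_le_sum fun q hq => ?_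
  rcases (c.pol_nonneg s q).eq_or_lt with h0 | h0
  · simp [← h0]
  · exact mul_le_mul_of_nonneg_left (hh q hq h0) h0.le

open Classical in
/-- The product of the weights `φ` of the successors of `q₀` on a path. -/
noncomputable def weight (q₀ : Q) (φ : S → ℝ) : List (Q × S) → ℝ
  | [] => 1
  | r :: l => (if r.1 = q₀ then φ r.2 else 1) * weight q₀ φ l

open Classical in
/-- The sum of `g` over the suffixes of a path that start with `q₀`, with a factor `w` for each
earlier occurrence of `q₀`. -/
noncomputable def excess (q₀ : Q) (w : ℝ) (g : List (Q × S) → ℝ) : List (Q × S) → ℝ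
  | [] => 0
  | r :: l => if r.1 = q₀ then w * excess q₀ w g l + g (r :: l) else excess q₀ w g l

open Classical in
/-- The expected weighted number of occurrences of `q₀`. -/
noncomputable def visits (q₀ : Q) (φ : S → ℝ) : ℕ → S → ℝ
  | 0, _ => 0
  | n + 1, s => if c.End s then 0 else c.avg s fun r =>
      if r.1 = q₀ then φ r.2 * visits q₀ φ n r.2 + 1 else visits q₀ φ n r.2

theorem weight_nonneg (q₀ : Q) {φ : S → ℝ} (hφ : ∀ s, 0 ≤ φ s) (l : List (Q × S)) :
    0 ≤ weight q₀ φ l := by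
  induction l with
  | nil => exact zero_le_one
  | cons r l ih =>
    rw [weight]
    split_ifs
    · exact mul_nonneg (hφ _) ih
    · exact mul_nonneg zero_le_one ih

theorem excess_nonneg (q₀ : Q) {w : ℝ} (hw : 0 ≤ w) {g : List (Q × S) → ℝ} (hg : ∀ l, 0 ≤ g l)
    (l : List (Q × S)) : 0 ≤ excess q₀ w g l := by
  induction l with
  | nil => exact le_rfl
  | cons r l ih =>
    rw [excess]
    split_ifs
    · exact add_nonneg (mul_nonneg hw ih) (hg _)
    · exact ih

theorem visits_nonneg (q₀ : Q) {φ : S → ℝ} (hφ : ∀ s, 0 ≤ φ s) (n : ℕ) (s : S) :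
    0 ≤ c.visits q₀ φ n s := by
  induction n generalizing s with
  | zero => exact le_rfl
  | succ n ih =>
    rw [visits]
    split_ifs
    · exact le_rfl
    · refine c.avg_nonneg fun r => ?_
      split_ifs
      · have := mul_nonneg (hφ r.2) (ih r.2); linarith
      · exact ih _

open Classical in
/-- The probability that an end is reached within `n` steps without playing `q₀`. -/
noncomputable def endProb (q₀ : Q) (n : ℕ) (s : S) : ℝ :=
  if c.End s then 1 else c.hit (· ≠ q₀) (fun r => c.End r.2) n s

theorem endProb_nonneg (q₀ : Q) (n : ℕ) (s : S) : 0 ≤ c.endProb q₀ n s := by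
  unfold endProb
  split_ifs
  exacts [zero_le_one, c.hit_nonneg ..]

theorem endProb_le_one (q₀ : Q) (n : ℕ) (s : S) : c.endProb q₀ n s ≤ 1 := by
  unfold endProb
  split_ifs
  exacts [le_rfl, c.hit_le_one ..]

open Classical in
theorem endProb_le_avg (q₀ : Q) (n : ℕ) {s : S} (hs : ¬ c.End s) :
    c.endProb q₀ n s ≤ c.avg s fun r => if r.1 = q₀ then 0 else c.endProb q₀ n r.2 := by
  rw [endProb, if_neg hs]
  refine (c.hit_succ_mono _ _ n s).trans ?_
  rw [hit, if_neg hs]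
  refine c.avg_mono hs fun r _ => ?_
  unfold endProb
  by_cases h : r.1 = q₀ <;> simp [h]

/-- The right side solves the recursion of `visits` as an inequality. Away from `q₀` it is at least
its average, by `endProb_le_avg`. At `q₀` the occurrence counts 1, which is covered by the
subtracted term: its average there is at least 1 by `h`, the factor `w` making up for weights as
small as `w⁻¹`. -/
theorem visits_le (q₀ : Q) (φ : S → ℝ) (w η : ℝ) (hw : 0 < w) (hη : 0 < η) (n₀ : ℕ)
    (hφ : ∀ s, w⁻¹ ≤ φ s) (hφ1 : ∑ s', c.D q₀ s' * φ s' ≤ 1)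
    (h : η ≤ ∑ s', c.D q₀ s' * c.endProb q₀ n₀ s') (n : ℕ) (s : S) :
    c.visits q₀ φ n s ≤ w / η * (1 - c.endProb q₀ n₀ s) := by
  classical
  have hC : 0 ≤ w / η := (div_pos hw hη).le
  have hφ0 : ∀ s, 0 ≤ φ s := fun s => (inv_pos.2 hw).le.trans (hφ s)
  induction n generalizing s with
  | zero => exact mul_nonneg hC (sub_nonneg.2 (c.endProb_le_one ..))
  | succ n ih =>
    rw [visits]
    split_ifs with hs
    · exact mul_nonneg hC (sub_nonneg.2 (c.endProb_le_one ..))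
    have h1 : c.avg s (fun r => if r.1 = q₀ then φ r.2 * c.visits q₀ φ n r.2 + 1
        else c.visits q₀ φ n r.2) ≤
        c.avg s (fun r => w / η + (-(w / η)) * (if r.1 = q₀ then 0 else c.endProb q₀ n₀ r.2)) := by
      refine c.avg_mono_act fun q hq _ => ?_
      by_cases hqq : q = q₀
      · subst hqq
        simp only [if_true, mul_zero, add_zero]
        rw [← Finset.sum_mul, c.D_sum q hq, one_mul]
        have h2 : ∀ s', c.D q s' * (φ s' * c.visits q φ n s' + 1) ≤
            c.D q s' + (w / η * (c.D q s' * φ s') - w / η * w⁻¹ * (c.D q s' * c.endProb q n₀ s')) := by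
          intro s'
          have h3 : φ s' * c.visits q φ n s' ≤
              w / η * φ s' - w / η * w⁻¹ * c.endProb q n₀ s' := by
            have h4 := mul_le_mul_of_nonneg_left (ih s') (hφ0 s')
            have h5 := mul_le_mul_of_nonneg_left (hφ s')
              (mul_nonneg hC (c.endProb_nonneg q n₀ s'))
            nlinarith
          have := mul_le_mul_of_nonneg_left h3 (c.D_nonneg q s')
          nlinarith
        refine (Finset.sum_le_sum fun s' _ => h2 s').trans ?_
        rw [Finset.sum_add_distrib, Finset.sum_sub_distrib, ← Finset.mul_sum, ← Finset.mul_sum,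
          c.D_sum q hq]
        have h6 := mul_le_mul_of_nonneg_left hφ1 hC
        have h7 : 1 ≤ w / η * w⁻¹ * ∑ s', c.D q s' * c.endProb q n₀ s' := by
          have : w / η * w⁻¹ = η⁻¹ := by field_simp
          rw [this]
          calc (1 : ℝ) = η⁻¹ * η := (inv_mul_cancel₀ hη.ne').symm
            _ ≤ _ := mul_le_mul_of_nonneg_left h (inv_pos.2 hη).le
        linarith
      · simp only [if_neg hqq]
        refine Finset.sum_le_sum fun s' _ => mul_le_mul_of_nonneg_left ?_ (c.D_nonneg q s')
        have := ih s'
        linarith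
    refine h1.trans ?_
    rw [avg_add, avg_mul, c.avg_const hs]
    have := mul_le_mul_of_nonneg_left (c.endProb_le_avg q₀ n₀ hs) hC
    linarith

/-- Either an end can be reached from `q₀` without playing `q₀` again, with probability at least
`η`, or no end can be reached after `q₀`. -/
def EndAlternative (q₀ : Q) (η : ℝ) : Prop :=
  (∃ n, η ≤ ∑ s', c.D q₀ s' * c.endProb q₀ n s') ∨
    ∀ n s', 0 < c.D q₀ s' → ∀ g, c.expect n s' g (fun _ => 0) = 0

-- If some successor of `q₀` can end without playing `q₀` again, one factor `x` pays for this
-- successor and at most `K - 1` factors for the way to the end, as an end is one of the states.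
-- Otherwise an end could only be approached through `q₀` again, where the situation repeats, so it
-- is never reached.
variable {c} in
theorem Bounded.endAlternative {x : ℝ} {blk : S → Finset S} (hc : c.Bounded x blk) (q₀ : Q)
    (hD : ∀ s', 0 < c.D q₀ s' → x ≤ c.D q₀ s') {K : ℕ} (hK : Fintype.card S ≤ K) :
    c.EndAlternative q₀ (x ^ K) := by
  classical
  by_cases h : ∃ s', 0 < c.D q₀ s' ∧
      (c.End s' ∨ c.CanHit (· ≠ q₀) (fun r => c.End r.2) s')
  · refine Or.inl ⟨Fintype.card S, ?_⟩
    obtain ⟨s', hs', h⟩ := h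
    have hle := Finset.single_le_sum
      (f := fun s' => c.D q₀ s' * c.endProb q₀ (Fintype.card S) s')
      (fun t _ => mul_nonneg (c.D_nonneg q₀ t) (c.endProb_nonneg ..)) (Finset.mem_univ s')
    refine le_trans ?_ hle
    have hcard : 0 < Fintype.card S := Fintype.card_pos_iff.2 ⟨s'⟩
    obtain ⟨k, rfl⟩ : ∃ k, K = k + 1 := ⟨K - 1, by omega⟩
    rw [pow_succ']
    refine mul_le_mul (hD s' hs') ?_ (pow_nonneg hc.pos.le _) (c.D_nonneg _ _)
    by_cases he : c.End s'
    · rw [endProb, if_pos he]; exact pow_le_one₀ hc.pos.le hc.le_one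
    · rw [endProb, if_neg he]
      have hh := h.resolve_left he
      have hend : ∃ e, c.End e := by
        clear hle he h
        induction hh with
        | now r _ _ hT => exact ⟨r.2, hT⟩
        | later r hr hok h ih =>
          by_cases hd : 0 < c.D q₀ r.2
          · exact ih hd
          · exact (h.rec (motive := fun _ _ => ∃ e, c.End e) (fun r _ _ hT => ⟨r.2, hT⟩)
              (fun _ _ _ _ ih => ih))
      obtain ⟨e, he'⟩ := hend
      refine hc.le_hit hh (fun X hX => ?_) le_rfl
      have h1 : X ⊆ Finset.univ.erase e := fun t ht =>
        Finset.mem_erase.2 ⟨fun h => hX t ht (h ▸ he'), Finset.mem_univ t⟩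
      have h2 := Finset.card_le_card h1
      rw [Finset.card_erase_of_mem (Finset.mem_univ e), Finset.card_univ] at h2
      omega
  · push Not at h
    refine Or.inr fun n s' hs' g => ?_
    have hrec : ∀ n t, (¬ c.End t ∧ ¬ c.CanHit (· ≠ q₀) (fun r => c.End r.2) t) →
        ∀ g, c.expect n t g (fun _ => 0) = 0 := by
      intro n
      induction n with
      | zero => intros; rfl
      | succ n ih =>
        intro t ht g
        rw [expect, if_neg ht.1]
        refine (c.avg_congr ht.1 (h' := fun _ => 0) fun r hr => ih _ ?_ _).trans (c.avg_const ht.1 0)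
        by_cases hq : r.1 = q₀
        · exact h r.2 (hq ▸ hr.2.2.2)
        · exact ⟨fun he => ht.2 (.now r hr hq he), fun hh => ht.2 (.later r hr hq hh)⟩
    exact hrec n s' (h s' hs') g

theorem expect_cons_excess (q₀ : Q) (φ : S → ℝ) (w : ℝ) (g : List (Q × S) → ℝ) (n : ℕ) (s' : S) :
    c.expect n s' (fun l => weight q₀ φ ((q₀, s') :: l) * excess q₀ w g ((q₀, s') :: l)) (fun _ => 0) =
      φ s' * (w * c.expect n s' (fun l => weight q₀ φ l * excess q₀ w g l) (fun _ => 0) +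
        c.expect n s' (fun l => weight q₀ φ l * g ((q₀, s') :: l)) (fun _ => 0)) := by
  have h0 := c.expect_mul n s' w (fun l => weight q₀ φ l * excess q₀ w g l) (fun _ => 0)
  simp only [mul_zero] at h0
  rw [← h0]
  have h1 := c.expect_add n s' (fun l => w * (weight q₀ φ l * excess q₀ w g l))
    (fun l => weight q₀ φ l * g ((q₀, s') :: l)) (fun _ => 0) (fun _ => 0)
  simp only [add_zero] at h1
  rw [← h1]
  have h2 := c.expect_mul n s' (φ s') (fun l => w * (weight q₀ φ l * excess q₀ w g l) +
    weight q₀ φ l * g ((q₀, s') :: l)) (fun _ => 0)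
  simp only [mul_zero] at h2
  rw [← h2]
  congr 1
  funext l
  simp only [weight, excess, if_true]
  ring

/-- The expectation of `g` after `q₀` has been played. -/
noncomputable def afterAct (q₀ : Q) (φ : S → ℝ) (g : List (Q × S) → ℝ) (n : ℕ) : ℝ :=
  ∑ s', c.D q₀ s' * (φ s' *
    c.expect n s' (fun l => weight q₀ φ l * g ((q₀, s') :: l)) (fun _ => 0))

theorem afterAct_succ_mono (q₀ : Q) {φ : S → ℝ} (hφ : ∀ s, 0 ≤ φ s) {g : List (Q × S) → ℝ}
    (hg : ∀ l, 0 ≤ g l) (n : ℕ) : c.afterAct q₀ φ g n ≤ c.afterAct q₀ φ g (n + 1) :=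
  Finset.sum_le_sum fun s' _ => mul_le_mul_of_nonneg_left (mul_le_mul_of_nonneg_left
    (c.expect_succ_mono n s' fun l => mul_nonneg (weight_nonneg q₀ hφ l) (hg _)) (hφ s'))
    (c.D_nonneg q₀ s')

theorem afterAct_nonneg (q₀ : Q) {φ : S → ℝ} (hφ : ∀ s, 0 ≤ φ s) {g : List (Q × S) → ℝ}
    (hg : ∀ l, 0 ≤ g l) (n : ℕ) : 0 ≤ c.afterAct q₀ φ g n :=
  Finset.sum_nonneg fun s' _ => mul_nonneg (c.D_nonneg q₀ s') (mul_nonneg (hφ s')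
    (c.expect_nonneg n s' (fun l => mul_nonneg (weight_nonneg q₀ hφ l) (hg _)) fun _ => le_rfl))

/-- Markov property: whatever happened before an occurrence of `q₀`, the contribution of what
follows is at most `afterAct`. The remaining horizon is shorter than `n`, hence the use of
monotonicity in `n`. -/
theorem expect_excess_one_le (q₀ : Q) {φ : S → ℝ} (hφ : ∀ s, 0 ≤ φ s)
    {g : List (Q × S) → ℝ} (hg : ∀ l, 0 ≤ g l) (n : ℕ) (s : S) :
    c.expect n s (fun l => weight q₀ φ l * excess q₀ 1 g l) (fun _ => 0) ≤
      c.visits q₀ φ n s * c.afterAct q₀ φ g n := by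
  classical
  induction n generalizing s with
  | zero => simp [expect, visits]
  | succ n ih =>
    rw [expect, visits]
    split_ifs with hs
    · simp [excess]
    refine le_trans ?_ (mul_le_mul_of_nonneg_left (c.afterAct_succ_mono q₀ hφ hg n) ?_)
    · rw [mul_comm, ← avg_mul]
      refine c.avg_mono_act fun q hq _ => ?_
      by_cases hqq : q = q₀
      · subst hqq
        simp only [if_true, expect_cons_excess, one_mul]
        have h1 : ∀ s', c.D q s' * (φ s' *
            (c.expect n s' (fun l => weight q φ l * excess q 1 g l) (fun _ => 0) +
              c.expect n s' (fun l => weight q φ l * g ((q, s') :: l)) (fun _ => 0))) ≤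
            c.D q s' * (c.afterAct q φ g n * (φ s' * c.visits q φ n s')) + c.D q s' * (φ s' *
              c.expect n s' (fun l => weight q φ l * g ((q, s') :: l)) (fun _ => 0)) := by
          intro s'
          have := mul_le_mul_of_nonneg_left (ih s') (mul_nonneg (c.D_nonneg q s') (hφ s'))
          linarith
        refine (Finset.sum_le_sum fun s' _ => h1 s').trans (le_of_eq ?_)
        rw [Finset.sum_add_distrib]
        simp only [mul_add, Finset.sum_add_distrib, mul_one]
        congr 1
        rw [← Finset.sum_mul, c.D_sum q hq, one_mul]
        rfl
      · simp only [if_neg hqq, weight, excess, one_mul]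
        refine Finset.sum_le_sum fun s' _ => mul_le_mul_of_nonneg_left ?_ (c.D_nonneg q s')
        rw [mul_comm]
        exact ih s'
    · refine c.avg_nonneg fun r => ?_
      split_ifs
      · have := mul_nonneg (hφ r.2) (c.visits_nonneg q₀ hφ n r.2); linarith
      · exact c.visits_nonneg q₀ hφ n _

/-- By `visits_le` the weighted number of further occurrences of `q₀` is at most `w / η`, so a
factor `w` for each is cheap when `(w - 1) * w / η ≤ 1 / 2`. As `g` may depend on everything after
the occurrence, this is what makes the backward processing of paths harmless. -/
theorem expect_excess_le (q₀ : Q) {φ : S → ℝ} {w η : ℝ} (hw : 1 ≤ w) (hη : 0 < η)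
    (hwη : 2 * (w - 1) * w ≤ η) (hφ : ∀ s, w⁻¹ ≤ φ s) (hφ1 : ∑ s', c.D q₀ s' * φ s' ≤ 1)
    (halt : c.EndAlternative q₀ η) {g : List (Q × S) → ℝ} (hg : ∀ l, 0 ≤ g l) (n : ℕ) (s : S) :
    c.expect n s (fun l => weight q₀ φ l * excess q₀ w g l) (fun _ => 0) ≤
      2 * c.expect n s (fun l => weight q₀ φ l * excess q₀ 1 g l) (fun _ => 0) := by
  classical
  have hw0 : 0 < w := lt_of_lt_of_le one_pos hw
  have hφ0 : ∀ s, 0 ≤ φ s := fun s => (inv_pos.2 hw0).le.trans (hφ s)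
  -- When `q₀` is played, the induction gives `2 * w` times the later terms where only twice is
  -- allowed, but `afterAct` only once where twice is allowed. This inequality balances the two.
  have key : ∀ n, 2 * (w - 1) * ∑ s', c.D q₀ s' * (φ s' *
      c.expect n s' (fun l => weight q₀ φ l * excess q₀ 1 g l) (fun _ => 0)) ≤
      c.afterAct q₀ φ g n := by
    intro n
    rcases halt with ⟨n₀, h⟩ | h
    · have hθ := c.afterAct_nonneg q₀ hφ0 hg n
      have h1 : ∀ s', c.D q₀ s' * (φ s' *
          c.expect n s' (fun l => weight q₀ φ l * excess q₀ 1 g l) (fun _ => 0)) ≤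
          (w / η * c.afterAct q₀ φ g n) * (c.D q₀ s' * φ s') := by
        intro s'
        have h2 := c.visits_le q₀ φ w η hw0 hη n₀ hφ hφ1 h n s'
        have h3 : c.visits q₀ φ n s' ≤ w / η := by
          have := mul_nonneg (div_pos hw0 hη).le (c.endProb_nonneg q₀ n₀ s')
          linarith
        have h4 := (c.expect_excess_one_le q₀ hφ0 hg n s').trans (mul_le_mul_of_nonneg_right h3 hθ)
        have := mul_le_mul_of_nonneg_left h4 (mul_nonneg (c.D_nonneg q₀ s') (hφ0 s'))
        linarith
      have h5 := Finset.sum_le_sum fun s' (_ : s' ∈ Finset.univ) => h1 s'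
      rw [← Finset.mul_sum] at h5
      have h6 : 0 ≤ w / η * c.afterAct q₀ φ g n := mul_nonneg (div_pos hw0 hη).le hθ
      have h7 := h5.trans (mul_le_mul_of_nonneg_left hφ1 h6)
      calc _ ≤ 2 * (w - 1) * (w / η * c.afterAct q₀ φ g n * 1) :=
            mul_le_mul_of_nonneg_left h7 (by linarith)
        _ = (2 * (w - 1) * w / η) * c.afterAct q₀ φ g n := by ring
        _ ≤ 1 * c.afterAct q₀ φ g n :=
            mul_le_mul_of_nonneg_right ((div_le_one hη).2 hwη) hθ
        _ = _ := one_mul _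
    · have h0 : ∀ s' G, c.D q₀ s' * (φ s' * c.expect n s' G (fun _ => 0)) = 0 := by
        intro s' G
        rcases (c.D_nonneg q₀ s').eq_or_lt with h1 | h1
        · rw [← h1, zero_mul]
        · rw [h n s' h1, mul_zero, mul_zero]
      simp only [afterAct, h0, Finset.sum_const_zero, mul_zero, le_refl]
  induction n generalizing s with
  | zero => simp [expect]
  | succ n ih =>
    rw [expect, expect]
    split_ifs with hs
    · simp [excess]
    rw [← avg_mul]
    refine c.avg_mono_act fun q hq _ => ?_
    by_cases hqq : q = q₀
    · subst hqq
      simp only [expect_cons_excess, one_mul]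
      have h1 : ∀ s', c.D q s' * (φ s' *
          (w * c.expect n s' (fun l => weight q φ l * excess q w g l) (fun _ => 0) +
            c.expect n s' (fun l => weight q φ l * g ((q, s') :: l)) (fun _ => 0))) ≤
          2 * w * (c.D q s' * (φ s' *
            c.expect n s' (fun l => weight q φ l * excess q 1 g l) (fun _ => 0))) +
          c.D q s' * (φ s' *
            c.expect n s' (fun l => weight q φ l * g ((q, s') :: l)) (fun _ => 0)) := by
        intro s'
        have := mul_le_mul_of_nonneg_left (ih s')
          (mul_nonneg (mul_nonneg (c.D_nonneg q s') (hφ0 s')) hw0.le)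
        linarith
      refine (Finset.sum_le_sum fun s' _ => h1 s').trans ?_
      have h2 := key n
      simp only [afterAct] at h2
      simp only [mul_add, Finset.sum_add_distrib, ← Finset.mul_sum]
      have h3 : ∀ f : S → ℝ, ∑ s', c.D q s' * (2 * f s') = 2 * ∑ s', c.D q s' * f s' := by
        intro f
        rw [Finset.mul_sum]
        exact Finset.sum_congr rfl fun s' _ => by ring
      simp only [h3]
      linarith
    · simp only [if_neg hqq, weight, excess, one_mul]
      exact Finset.sum_le_sum fun s' _ => mul_le_mul_of_nonneg_left (ih s') (c.D_nonneg q s')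

end Chain

namespace Chain

variable {Q : Type u} {S : Type v} [Fintype S] (c : Chain Q S)

/-! #### Missing a set of transitions -/

open Classical in
/-- The probability to make `n` steps without a transition in `T`. -/
noncomputable def miss (T : Q × S → Prop) : ℕ → S → ℝ
  | 0, _ => 1
  | n + 1, s => if c.End s then 0 else c.avg s fun r => if T r then 0 else miss T n r.2

theorem miss_add_hit_le (T : Q × S → Prop) (n : ℕ) (s : S) :
    c.miss T n s + c.hit (fun _ => True) T n s ≤ 1 := by
  induction n generalizing s with
  | zero => simp [miss, hit]
  | succ n ih =>
    rw [miss, hit]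
    split_ifs with hs
    · simp
    rw [← avg_add]
    refine (c.avg_mono hs fun r _ => ?_).trans (c.avg_const hs 1).le
    have := ih r.2
    split_ifs
    · simp
    · exact this

/-- The invariant `I` is needed because `T` is known to be accessible only from states that can
occur while `T` has been missed. -/
theorem miss_add_le (T : Q × S → Prop) (I : S → Prop)
    (hI : ∀ s, I s → ∀ r, c.Pos s r → ¬ T r → I r.2) (b : ℕ) (B : ℝ)
    (hB : ∀ s, I s → c.miss T b s ≤ B) (a : ℕ) (s : S) (hs : I s) :
    c.miss T (a + b) s ≤ B * c.miss T a s := by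
  induction a generalizing s with
  | zero => simpa [miss] using hB s hs
  | succ a ih =>
    rw [Nat.succ_add, miss, miss]
    split_ifs with he
    · simp
    rw [← avg_mul]
    refine c.avg_mono he fun r hr => ?_
    split_ifs with hT
    · simp
    · exact ih r.2 (hI s hs r hr hT)

theorem miss_le_pow (T : Q × S → Prop) (I : S → Prop)
    (hI : ∀ s, I s → ∀ r, c.Pos s r → ¬ T r → I r.2) (k : ℕ) (ρ : ℝ) (hρ : 0 ≤ ρ)
    (h : ∀ s, I s → c.miss T k s ≤ ρ) (j i : ℕ) (s : S) (hs : I s) :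
    c.miss T (k * j + i) s ≤ ρ ^ j := by
  induction j generalizing s with
  | zero =>
    have := c.miss_add_hit_le T (k * 0 + i) s
    have := c.hit_nonneg (fun _ => True) T (k * 0 + i) s
    simp only [pow_zero]; linarith
  | succ j ih =>
    have h1 := c.miss_add_le T I hI (k * j + i) (ρ ^ j) (fun s hs => ih s hs) k s hs
    rw [Nat.mul_succ, add_right_comm, add_comm (k * j + i)]
    refine h1.trans ?_
    rw [pow_succ]
    exact mul_le_mul_of_nonneg_left (h s hs) (pow_nonneg hρ j)

open Classical in
theorem expect_forall_take_le_miss (T : Q × S → Prop) (m : ℕ) : ∀ (n : ℕ) (_ : m ≤ n) (s : S),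
    c.expect n s (fun _ => 0) (fun l => if ∀ r ∈ l.take m, ¬ T r then 1 else 0) ≤ c.miss T m s := by
  induction m with
  | zero =>
    intro n _ s
    refine c.expect_le_const n s (fun _ => zero_le_one) fun l => ?_
    split_ifs
    exacts [le_rfl, zero_le_one]
  | succ m ih =>
    intro n hn s
    obtain ⟨n, rfl⟩ : ∃ k, n = k + 1 := ⟨n - 1, by omega⟩
    rw [expect, miss]
    split_ifs with hs
    · exact le_rfl
    refine c.avg_mono hs fun r _ => ?_
    split_ifs with hT
    · simp only [List.take_succ_cons, List.forall_mem_cons, hT, not_true_eq_false, false_and, if_false]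
      exact (c.expect_const n r.2 0).le
    · simp only [List.take_succ_cons, List.forall_mem_cons, hT, not_false_eq_true, true_and]
      exact ih n (by omega) r.2

/-- Markov property at time `a`; paths that have ended by then contribute nothing. -/
theorem expect_drop_le (f : S → List (Q × S) → ℝ) (n : ℕ) (B : ℝ) (hB0 : 0 ≤ B)
    (hB : ∀ t, c.expect n t (fun _ => 0) (f t) ≤ B) (a : ℕ) (s : S) :
    c.expect (a + n) s (fun _ => 0) (fun l => f (lastState s (l.take a)) (l.drop a)) ≤ B := by
  induction a generalizing s with
  | zero => simpa [lastState] using hB s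
  | succ a ih =>
    rw [Nat.succ_add, expect]
    split_ifs with hs
    · exact hB0
    · exact (c.avg_mono hs fun r _ => ih r.2).trans (c.avg_const hs B).le

/-! #### Recurrent classes -/

/-- The state `t` can be reached from `s`. -/
def Reach : S → S → Prop := Relation.ReflTransGen fun s t => ∃ q, c.Pos s (q, t)

open Classical in
/-- The pairs that can be played after `s` has been visited. -/
noncomputable def future (s : S) : Finset Q :=
  c.acts.filter fun q => ∃ t, c.Reach s t ∧ ¬ c.End t ∧ 0 < c.pol t q

/-- A state is recurrent if everything that can happen after it can always happen again. -/
def Recur (s : S) : Prop := ∀ t, c.Reach s t → c.future t = c.future s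

theorem mem_future {s : S} {q : Q} :
    q ∈ c.future s ↔ q ∈ c.acts ∧ ∃ t, c.Reach s t ∧ ¬ c.End t ∧ 0 < c.pol t q := by
  classical
  rw [future, Finset.mem_filter]

theorem future_subset {s t : S} (h : c.Reach s t) : c.future t ⊆ c.future s := by
  intro q hq
  rw [mem_future] at hq ⊢
  obtain ⟨hq, u, hu, h'⟩ := hq
  exact ⟨hq, u, h.trans hu, h'⟩

theorem exists_recur (s : S) : ∃ t, c.Reach s t ∧ c.Recur t := by
  classical
  obtain ⟨t, ht, hmin⟩ := (Finset.univ.filter fun t => c.Reach s t).exists_min_image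
    (fun t => (c.future t).card) ⟨s, Finset.mem_filter.2 ⟨Finset.mem_univ s, .refl⟩⟩
  rw [Finset.mem_filter] at ht
  refine ⟨t, ht.2, fun u hu => ?_⟩
  exact Finset.eq_of_subset_of_card_le (c.future_subset hu)
    (hmin u (Finset.mem_filter.2 ⟨Finset.mem_univ u, ht.2.trans hu⟩))

variable {c} in
theorem Recur.reach {s t : S} (h : c.Recur s) (hst : c.Reach s t) : c.Recur t :=
  fun u hu => (h u (hst.trans hu)).trans (h t hst).symm

theorem canHit_recur {s : S} (h : ¬ c.Recur s) :
    c.CanHit (fun _ => True) (fun r => c.Recur r.2) s := by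
  obtain ⟨t, hst, ht⟩ := c.exists_recur s
  suffices h' : c.Recur s ∨ c.CanHit (fun _ => True) (fun r => c.Recur r.2) s from h'.resolve_left h
  clear h
  induction hst using Relation.ReflTransGen.head_induction_on with
  | refl => exact Or.inl ht
  | head h1 _ ih =>
    obtain ⟨q, hq⟩ := h1
    rcases ih with ih | ih
    · exact Or.inr (.now _ hq trivial ih)
    · exact Or.inr (.later _ hq trivial ih)

theorem exists_D_pos {q : Q} (hq : q ∈ c.acts) : ∃ s', 0 < c.D q s' := by
  by_contra! h
  have := Finset.sum_nonpos fun s' (_ : s' ∈ Finset.univ) => h s'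
  rw [c.D_sum q hq] at this
  linarith

theorem exists_pol_pos {s : S} (hs : ¬ c.End s) : ∃ q ∈ c.acts, 0 < c.pol s q := by
  by_contra! h
  have := Finset.sum_nonpos h
  rw [c.pol_sum s hs] at this
  linarith

theorem canHit_of_reach {s t : S} (hst : c.Reach s t) {T : Q × S → Prop}
    (h : c.CanHit (fun _ => True) T t) : c.CanHit (fun _ => True) T s := by
  induction hst using Relation.ReflTransGen.head_induction_on with
  | refl => exact h
  | head h1 _ ih =>
    obtain ⟨q, hq⟩ := h1
    exact .later _ hq trivial ih

theorem canHit_act {s : S} {q : Q} (h : q ∈ c.future s) :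
    c.CanHit (fun _ => True) (fun r => r.1 = q) s := by
  rw [mem_future] at h
  obtain ⟨hq, t, hst, ht, hpos⟩ := h
  obtain ⟨s', hs'⟩ := c.exists_D_pos hq
  exact c.canHit_of_reach hst (.now (q, s') ⟨ht, hq, hpos, hs'⟩ trivial rfl)

theorem reach_lastState {s : S} {l : List (Q × S)} (h : c.IsPath s l) :
    c.Reach s (lastState s l) := by
  induction l generalizing s with
  | nil => exact .refl
  | cons r l ih => exact .head ⟨r.1, h.1⟩ (ih h.2)

theorem lastState_append (s : S) (l l' : List (Q × S)) :
    lastState s (l ++ l') = lastState (lastState s l) l' := by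
  induction l generalizing s with
  | nil => rfl
  | cons r l ih => exact ih r.2

theorem isPath_append {s : S} {l l' : List (Q × S)} :
    c.IsPath s (l ++ l') ↔ c.IsPath s l ∧ c.IsPath (lastState s l) l' := by
  induction l generalizing s with
  | nil => simp [IsPath, lastState]
  | cons r l ih => simp [IsPath, lastState, ih, and_assoc]

theorem mem_future_of_mem {s : S} {l : List (Q × S)} (h : c.IsPath s l) {r : Q × S} (hr : r ∈ l) :
    r.1 ∈ c.future s := by
  induction l generalizing s with
  | nil => exact absurd hr List.not_mem_nil
  | cons r' l ih =>
    rcases List.mem_cons.1 hr with rfl | hr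
    · exact c.mem_future.2 ⟨h.1.2.1, s, .refl, h.1.1, h.1.2.2.1⟩
    · exact c.future_subset (.single ⟨r'.1, h.1⟩) (ih h.2 hr)

/-! ### Finding a recurrent class on a long path -/

/-- The pairs that occur more than `m` times on the path are those of a recurrent class. -/
def FindsClass [DecidableEq Q] (m : ℕ) (l : List (Q × S)) (s : S) : Prop :=
  ∃ t, c.Reach s t ∧ c.Recur t ∧ ¬ c.End t ∧ ∀ q, m < (l.map Prod.fst).count q ↔ q ∈ c.future t

/-- The path is cut into pieces of length `m`. A pair outside the class can occur only in the first
piece, so at most `m` times; a pair of the class occurs in each of the next `m + 1` pieces. Together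
these pieces have length `(m + 2) * m`. -/
theorem findsClass_of [DecidableEq Q] (m : ℕ) {s : S} {l : List (Q × S)} (hl : c.IsPath s l)
    (hlen : (m + 2) * m ≤ l.length) (hm : 0 < m) (h1 : c.Recur (lastState s (l.take m)))
    (h2 : ∀ w, w < m + 1 → ∀ q ∈ c.acts, c.Recur (lastState s (l.take ((w + 1) * m))) →
      q ∈ c.future (lastState s (l.take ((w + 1) * m))) →
      ∃ r ∈ (l.drop ((w + 1) * m)).take m, r.1 = q) : c.FindsClass m l s := by
  have hsplit : ∀ k, c.IsPath s (l.take k) ∧ c.IsPath (lastState s (l.take k)) (l.drop k) := fun k => by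
    rw [← c.isPath_append, List.take_append_drop]; exact hl
  have hreach : ∀ k, m ≤ k → c.Reach (lastState s (l.take m)) (lastState s (l.take k)) := by
    intro k hk
    obtain ⟨j, rfl⟩ := Nat.exists_eq_add_of_le hk
    rw [List.take_add, lastState_append]
    have := (hsplit (m + j)).1
    rw [List.take_add, c.isPath_append] at this
    exact c.reach_lastState this.2
  refine ⟨_, c.reach_lastState (hsplit m).1, h1, ?_, fun q => ⟨fun hq => ?_, fun hq => ?_⟩⟩
  -- The path goes on after its first `m` transitions, so it has not reached an end.
  · have h3 := (hsplit m).2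
    have h4 : 0 < (l.drop m).length := by
      rw [List.length_drop]
      have : m < (m + 2) * m := by nlinarith
      omega
    match hd : l.drop m, h3, h4 with
    | r :: l', h3, _ => exact h3.1.1
  · have h3 : (l.map Prod.fst).count q =
        ((l.take m).map Prod.fst).count q + ((l.drop m).map Prod.fst).count q := by
      rw [← List.count_append, ← List.map_append, List.take_append_drop]
    have h4 : ((l.take m).map Prod.fst).count q ≤ m := by
      refine List.count_le_length.trans ?_
      rw [List.length_map]
      exact (List.length_take_le _ _)
    have h5 : 0 < ((l.drop m).map Prod.fst).count q := by omega
    obtain ⟨r, hr, rfl⟩ := List.mem_map.1 (List.count_pos_iff.1 h5)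
    exact c.mem_future_of_mem (hsplit m).2 hr
  · have hcount : ∀ k, k ≤ m + 1 → k ≤ ((l.take ((k + 1) * m)).map Prod.fst).count q := by
      intro k
      induction k with
      | zero => intro _; exact Nat.zero_le _
      | succ k ih =>
        intro hk
        have hr := hreach ((k + 1) * m) (Nat.le_mul_of_pos_left m (Nat.succ_pos k))
        obtain ⟨r, hr1, hr2⟩ := h2 k (by omega) q (c.mem_future.1 hq).1 (h1.reach hr)
          (by rw [h1 _ hr]; exact hq)
        have h6 : 0 < (((l.drop ((k + 1) * m)).take m).map Prod.fst).count q :=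
          List.count_pos_iff.2 (List.mem_map.2 ⟨r, hr1, hr2⟩)
        rw [show (k + 1 + 1) * m = (k + 1) * m + m by ring, List.take_add, List.map_append,
          List.count_append]
        have := ih (by omega)
        omega
    have h7 := hcount (m + 1) le_rfl
    have h8 : ((l.take ((m + 1 + 1) * m)).map Prod.fst).count q ≤ (l.map Prod.fst).count q :=
      ((List.take_sublist _ _).map _).count_le q
    omega

open Classical in
/-- Indicator of the event that the state `t` is recurrent and one of the pairs of its class does not
occur in the first `m` transitions of `l`. -/
noncomputable def unseen (m : ℕ) (q : Q) (t : S) (l : List (Q × S)) : ℝ :=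
  if c.Recur t ∧ q ∈ c.future t ∧ ∀ r ∈ l.take m, ¬ r.1 = q then 1 else 0

theorem unseen_nonneg (m : ℕ) (q : Q) (t : S) (l : List (Q × S)) : 0 ≤ c.unseen m q t l := by
  unfold unseen
  split_ifs
  exacts [zero_le_one, le_rfl]

open Classical in
theorem ite_findsClass_le [DecidableEq Q] (m : ℕ) {s : S} {l : List (Q × S)}
    (hl : c.IsPath s l) (hlen : (m + 2) * m ≤ l.length) (hm : 0 < m) :
    (if c.FindsClass m l s then (0 : ℝ) else 1) ≤
      (if ¬ c.Recur (lastState s (l.take m)) then 1 else 0) +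
      ∑ w ∈ Finset.range (m + 1), ∑ q ∈ c.acts,
        c.unseen m q (lastState s (l.take ((w + 1) * m))) (l.drop ((w + 1) * m)) := by
  have hnn : ∀ w ∈ Finset.range (m + 1), ∀ q ∈ c.acts, 0 ≤
        c.unseen m q (lastState s (l.take ((w + 1) * m))) (l.drop ((w + 1) * m)) :=
    fun w _ q _ => c.unseen_nonneg ..
  have hsum := Finset.sum_nonneg fun w hw => Finset.sum_nonneg (hnn w hw)
  by_cases h : c.FindsClass m l s
  · rw [if_pos h]
    split_ifs <;> linarith
  rw [if_neg h]
  by_cases h1 : c.Recur (lastState s (l.take m))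
  · have h2 : ∃ w ∈ Finset.range (m + 1), ∃ q ∈ c.acts,
        c.Recur (lastState s (l.take ((w + 1) * m))) ∧
          q ∈ c.future (lastState s (l.take ((w + 1) * m))) ∧
          ∀ r ∈ (l.drop ((w + 1) * m)).take m, ¬ r.1 = q := by
      by_contra h3
      refine h (c.findsClass_of m hl hlen hm h1 fun w hw q hq hrec hfut => ?_)
      by_contra h4
      exact h3 ⟨w, Finset.mem_range.2 hw, q, hq, hrec, hfut, fun r hr hrq => h4 ⟨r, hr, hrq⟩⟩
    obtain ⟨w, hw, q, hq, h3⟩ := h2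
    rw [if_neg (not_not.2 h1), zero_add]
    refine le_trans ?_ (Finset.single_le_sum (fun w hw => Finset.sum_nonneg (hnn w hw)) hw)
    refine le_trans ?_ (Finset.single_le_sum (hnn w hw) hq)
    rw [unseen, if_pos h3]
  · rw [if_pos h1]
    linarith

variable {c} in
open Classical in
/-- With high probability a path that does not reach an end makes known a recurrent class. -/
theorem Bounded.expect_not_findsClass_le [DecidableEq Q] {x : ℝ} {blk : S → Finset S} (hc : c.Bounded x blk)
    {κ m N : ℕ} (hκ : Fintype.card S ≤ κ) (hm : 0 < m) (hN : (m + 2) * m ≤ N) (s : S) :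
    c.expect N s (fun _ => 0) (fun l => if c.FindsClass m l s then 0 else 1) ≤
      (1 + (m + 1) * c.acts.card) * (1 - x ^ Fintype.card S) ^ (m / κ) := by
  set ρ := 1 - x ^ Fintype.card S with hρ
  have hρ0 : 0 ≤ ρ := sub_nonneg.2 (pow_le_one₀ hc.pos.le hc.le_one)
  -- From every state in `I` a round of `κ` steps hits `T` with probability at least `x ^ card S`,
  -- and `m` steps contain `m / κ` rounds.
  have hmiss : ∀ (T : Q × S → Prop) (I : S → Prop),
      (∀ s, I s → ∀ r, c.Pos s r → ¬ T r → I r.2) → (∀ s, I s → c.CanHit (fun _ => True) T s) →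
      ∀ s, I s → c.miss T m s ≤ ρ ^ (m / κ) := by
    intro T I hI hhit s hs
    conv_lhs => rw [← Nat.div_add_mod m κ]
    refine c.miss_le_pow T I hI κ ρ hρ0 (fun t ht => ?_) _ _ s hs
    have h1 := c.miss_add_hit_le T κ t
    have h2 := hc.le_hit (hhit t ht) (k := Fintype.card S) (fun X _ => Finset.card_le_univ X) hκ
    linarith
  have hρm : 0 ≤ ρ ^ (m / κ) := pow_nonneg hρ0 _
  refine (c.expect_mono N s (gT' := fun _ => 0 + ∑ w ∈ Finset.range (m + 1), ∑ q ∈ c.acts, 0)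
    (fun l _ _ _ => by simp) fun l hl hlen => c.ite_findsClass_le m hl (hlen ▸ hN) hm).trans ?_
  rw [c.expect_add, c.expect_sum]
  simp only [c.expect_sum]
  have hmN : m ≤ N := le_trans (by nlinarith) hN
  rw [add_mul, one_mul]
  refine add_le_add ?_ ?_
  · obtain ⟨k, hk⟩ := Nat.exists_eq_add_of_le hmN
    by_cases hs : c.Recur s
    · refine le_trans (le_of_eq ?_) hρm
      refine (c.expect_congr N s (fun _ _ _ _ => rfl) fun l hl _ => ?_).trans (c.expect_const N s 0)
      rw [if_neg]
      rw [not_not]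
      refine hs.reach (c.reach_lastState ?_)
      have := hl
      rw [← List.take_append_drop m l, c.isPath_append] at this
      exact this.1
    · refine le_trans ?_ (hmiss (fun r => c.Recur r.2) (fun s => ¬ c.Recur s) (fun _ _ _ _ h => h)
        (fun s hs => c.canHit_recur hs) s hs)
      refine (c.expect_mono N s (fun _ _ _ _ => le_rfl) fun l hl _ => ?_).trans
        (c.expect_forall_take_le_miss (fun r => c.Recur r.2) m N hmN s)
      have hl' := hl
      rw [← List.take_append_drop m l, c.isPath_append] at hl'
      by_cases h1 : c.Recur (lastState s (l.take m))
      · rw [if_neg (not_not.2 h1)]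
        split_ifs
        exacts [zero_le_one, le_rfl]
      -- Recurrence is inherited along the path, so a last state that is not recurrent excludes all
      -- earlier visits to recurrent states.
      · rw [if_pos h1, if_pos]
        intro r hr hrec
        apply h1
        obtain ⟨l1, l2, h2⟩ := List.append_of_mem hr
        rw [h2, lastState_append]
        rw [h2, c.isPath_append] at hl'
        exact hrec.reach (c.reach_lastState hl'.1.2.2)
  · have : ((m : ℝ) + 1) * c.acts.card * ρ ^ (m / κ) =
        ∑ w ∈ Finset.range (m + 1), ∑ q ∈ c.acts, ρ ^ (m / κ) := by
      simp only [Finset.sum_const, Finset.card_range, nsmul_eq_mul]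
      push_cast; ring
    rw [this]
    refine Finset.sum_le_sum fun w hw => Finset.sum_le_sum fun q hq => ?_
    have hwN : (w + 1) * m + m ≤ N := by
      have : w + 1 ≤ m + 1 := Finset.mem_range.1 hw
      nlinarith
    obtain ⟨k, hk⟩ : ∃ k, N = (w + 1) * m + (m + k) := ⟨N - ((w + 1) * m + m), by omega⟩
    rw [hk]
    refine c.expect_drop_le (c.unseen m q) (m + k) _ hρm (fun t => ?_) ((w + 1) * m) s
    unfold unseen
    by_cases ht : c.Recur t ∧ q ∈ c.future t
    · simp only [ht.1, ht.2, true_and]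
      have h5 := (c.expect_forall_take_le_miss (fun r => r.1 = q) m (m + k) (by omega) t).trans
        (hmiss (fun r => r.1 = q) (fun t => c.Recur t ∧ q ∈ c.future t) ?_
          (fun s hs => c.canHit_act hs.2) t ht)
      · refine le_of_eq_of_le ?_ h5
        congr!
      intro s hs r hr _
      have hr' : c.Reach s r.2 := .single ⟨r.1, hr⟩
      exact ⟨hs.1.reach hr', (hs.1 r.2 hr') ▸ hs.2⟩
    · have h0 : ∀ l : List (Q × S), ¬ (c.Recur t ∧ q ∈ c.future t ∧ ∀ r ∈ l.take m, ¬ r.1 = q) :=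
        fun l h => ht ⟨h.1, h.2.1⟩
      simp only [h0, if_false]
      rw [c.expect_const]
      exact hρm

end Chain

/-! ### The structure of the collapsed MDP -/

section Collapsed

variable {S : Type u} {A : Type v} [Fintype S] [DecidableEq S] [DecidableEq A]

/-- The collapsed MDP is obtained from `M` by collapsing end components. -/
structure Coherent (M : MDP S A) (F : Finset S) (cls : S → Node S) (inner : Finset (S × A)) :
    Prop where
  one_iff : ∀ s, cls s = .one ↔ s ∈ F
  zero : ∀ s, cls s = .zero → value M F s = 0
  mem : ∀ s R, cls s = .block R → s ∈ R
  block : ∀ s R, cls s = .block R → ∀ t ∈ R, cls t = .block R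
  avail : ∀ s R, cls s = .block R → (available M.E inner R).Nonempty
  enabled : ∀ q ∈ inner, q.2 ∈ M.E q.1
  closed : ∀ s R, cls s = .block R → ∀ t, JStep M ↑inner s t → t ∈ R
  conn : ∀ s R, cls s = .block R → ∀ t ∈ R, Relation.ReflTransGen (JStep M ↑inner) s t

omit [Fintype S] in
theorem mem_available {E : S → Finset A} {inner : Finset (S × A)} {R : Finset S} {q : S × A} :
    q ∈ available E inner R ↔ q.1 ∈ R ∧ q.2 ∈ E q.1 ∧ q ∉ inner := by
  obtain ⟨s, a⟩ := q
  simp only [available, Finset.mem_sdiff, Finset.mem_biUnion, Finset.mem_image, Prod.mk.injEq]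
  constructor
  · rintro ⟨⟨t, ht, b, hb, rfl, rfl⟩, h⟩
    exact ⟨ht, hb, h⟩
  · rintro ⟨h1, h2, h3⟩
    exact ⟨⟨s, h1, a, h2, rfl, rfl⟩, h3⟩

variable {M : MDP S A} {F : Finset S} {cls : S → Node S} {inner : Finset (S × A)}

theorem Coherent.notMem (h : Coherent M F cls inner) {s : S} {R : Finset S}
    (hs : cls s = .block R) : ∀ t ∈ R, t ∉ F := fun t ht htF => by
  have := (h.one_iff t).2 htF
  rw [h.block s R hs t ht] at this
  cases this

theorem Coherent.value_eq (h : Coherent M F cls inner) {s : S} {R : Finset S}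
    (hs : cls s = .block R) {t : S} (ht : t ∈ R) : value M F t = value M F s := by
  have hsup : ∀ s ∈ R, ∀ a, (s, a) ∈ (↑inner : Set (S × A)) →
      ∑ s', (M.Δ s a s').toReal * value M F s' ≤ value M F s :=
    fun s _ a ha => valueAct_le_value M F s a (h.enabled _ ha)
  have hcl : ∀ s ∈ R, ∀ t, JStep M ↑inner s t → t ∈ R :=
    fun u hu => h.closed u R (h.block s R hs u hu)
  have hco : ∀ u ∈ R, ∀ t ∈ R, Relation.ReflTransGen (JStep M ↑inner) u t :=
    fun u hu => h.conn u R (h.block s R hs u hu)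
  exact le_antisymm (le_of_superharmonic M _ R _ hsup hcl hco ht (h.mem s R hs))
    (le_of_superharmonic M _ R _ hsup hcl hco (h.mem s R hs) ht)

theorem Coherent.valueAct_le (h : Coherent M F cls inner) {s : S} {R : Finset S}
    (hs : cls s = .block R) {q : S × A} (hq : q ∈ available M.E inner R) :
    valueAct M F q ≤ value M F s := by
  rw [mem_available] at hq
  rw [← h.value_eq hs hq.1]
  exact valueAct_le_value M F q.1 q.2 hq.2.1

/-- The removed pairs alone never lead out of the block and hence to no target, so only the
remaining pairs can produce the value, and the best of them bounds it. -/
theorem Coherent.exists_value_le (h : Coherent M F cls inner) {s : S} {R : Finset S}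
    (hs : cls s = .block R) :
    ∃ q ∈ available M.E inner R, value M F s ≤ valueAct M F q := by
  obtain ⟨q, hq, hmax⟩ := (available M.E inner R).exists_max_image (valueAct M F) (h.avail s R hs)
  refine ⟨q, hq, ?_⟩
  refine value_le_of_endComponent M F ↑inner R (h.notMem hs) (fun q hq => h.enabled q hq)
    (fun u hu => h.closed u R (h.block s R hs u hu))
    (fun u hu => h.conn u R (h.block s R hs u hu)) _ (valueAct_nonneg M F q) ?_ s (h.mem s R hs)
  intro u hu a ha hua
  exact hmax (u, a) (mem_available.2 ⟨hu, ha, hua⟩)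

theorem coherent_start {I : LimitedInfo S A} (hI : I.IsAbout M F) :
    Coherent M F (startMemory I).cls (startMemory I).inner := by
  have hblock : ∀ s R, (startMemory I).cls s = .block R → R = {s} ∧ s ∉ I.target ∧ s ∉ I.sink := by
    intro s R h
    simp only [startMemory] at h
    split_ifs at h with h1 h2
    cases h
    exact ⟨rfl, h1, h2⟩
  have hinner : (startMemory I).inner = ∅ := rfl
  refine ⟨fun s => ?_, fun s h => ?_, fun s R h => ?_, fun s R h t ht => ?_, fun s R h => ?_, ?_, ?_,
    fun s R h t ht => ?_⟩
  · simp only [startMemory, ← hI.target_eq]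
    split_ifs with h1 h2 <;> simp [h1]
  · have hs : s ∈ I.sink := by
      simp only [startMemory] at h
      split_ifs at h with h1 h2
      exact h2
    obtain ⟨hterm, hsF⟩ := hI.sink_terminal s hs
    refine le_antisymm ?_ (value_nonneg ..)
    -- A sink is never left, so the indicator of all other states is pre-fixed.
    have h := value_le_of_prefixed M F (fun t => if t = s then 0 else 1)
      (fun t => by split_ifs <;> norm_num) (fun t ht => by
        rw [if_neg (by rintro rfl; exact hsF ht)]) (fun t _ a ha => by
        split_ifs with hts
        · subst hts
          refine le_of_eq (Finset.sum_eq_zero fun s' _ => ?_)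
          split_ifs with hs'
          · simp
          · have h1 := hterm a ha
            have h2 : M.Δ t a s' = 0 := by
              by_contra h3
              rw [PMF.apply_eq_one_iff] at h1
              have : s' ∈ (M.Δ t a).support := (PMF.mem_support_iff _ _).2 h3
              rw [h1] at this
              exact hs' this
            simp [h2]
        · calc _ ≤ ∑ s', (M.Δ t a s').toReal := Finset.sum_le_sum fun s' _ => by
                split_ifs <;> simp
            _ = 1 := sum_toReal_pmf _) s
    simpa using h
  · rw [(hblock s R h).1]; exact Finset.mem_singleton_self s
  · have := (hblock s R h).1
    rw [this, Finset.mem_singleton] at ht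
    rw [ht, h]
  · obtain ⟨a, ha⟩ := M.E_nonempty s
    exact ⟨(s, a), mem_available.2 ⟨by
      rw [(hblock s R h).1]; exact Finset.mem_singleton_self s, ha, by simp [hinner]⟩⟩
  · simp [hinner]
  · rintro s R h t ⟨a, ha, _⟩
    simp [hinner] at ha
  · rw [(hblock s R h).1, Finset.mem_singleton] at ht
    rw [ht]

/-! #### The chain of the explored paths -/

/-- All enabled pairs. -/
def allPairs (E : S → Finset A) : Finset (S × A) := available E ∅ Finset.univ

theorem mem_allPairs {E : S → Finset A} {q : S × A} : q ∈ allPairs E ↔ q.2 ∈ E q.1 := by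
  simp [allPairs, mem_available]

theorem card_allPairs (E : S → Finset A) : (allPairs E).card = ∑ s, (E s).card := by
  have : allPairs E = Finset.univ.biUnion fun s => (E s).image fun a => (s, a) := by
    ext q; simp [allPairs, available]
  rw [this, Finset.card_biUnion]
  · refine Finset.sum_congr rfl fun s _ => Finset.card_image_of_injective _ fun a b h => ?_
    exact (Prod.mk.inj h).2
  · intro s _ t _ hst
    rw [Function.onFun, Finset.disjoint_left]
    intro q hq hq'
    obtain ⟨a, _, rfl⟩ := Finset.mem_image.1 hq
    obtain ⟨b, _, h⟩ := Finset.mem_image.1 hq'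
    exact hst (Prod.mk.inj h).1.symm

omit [Fintype S] in
theorem mem_greedy {I : LimitedInfo S A} {μ : Memory S A} {ξ : Node S} {q : S × A} :
    q ∈ μ.greedy I ξ ↔ q ∈ μ.enabledAt I ξ ∧ ∀ q' ∈ μ.enabledAt I ξ, μ.U.val q' ≤ μ.U.val q := by
  classical
  rw [Memory.greedy, Finset.mem_filter]

omit [Fintype S] in
theorem greedy_nonempty {I : LimitedInfo S A} {μ : Memory S A} {ξ : Node S}
    (h : (μ.enabledAt I ξ).Nonempty) : (μ.greedy I ξ).Nonempty := by
  obtain ⟨q, hq, hmax⟩ := (μ.enabledAt I ξ).exists_max_image μ.U.val h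
  exact ⟨q, mem_greedy.2 ⟨hq, hmax⟩⟩

omit [Fintype S] [DecidableEq S] in
theorem exists_block {s : S} (h : ¬ (cls s).IsEnd) : ∃ R, cls s = .block R := by
  cases hs : cls s with
  | one => rw [hs] at h; exact absurd trivial h
  | zero => rw [hs] at h; exact absurd trivial h
  | block R => exact ⟨R, rfl⟩

open Classical in
/-- The chain of the paths explored with the memory `μ`. -/
noncomputable def exploreChain (M : MDP S A) {F : Finset S} (I : LimitedInfo S A)
    (hI : I.IsAbout M F) (μ : Memory S A) (h : Coherent M F μ.cls μ.inner) : Chain (S × A) S where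
  acts := allPairs M.E
  pol s q := if q ∈ μ.greedy I (μ.cls s) then ((μ.greedy I (μ.cls s)).card : ℝ)⁻¹ else 0
  D q s' := (M.Δ q.1 q.2 s').toReal
  End s := (μ.cls s).IsEnd
  pol_nonneg s q := by split_ifs <;> positivity
  D_nonneg q s := ENNReal.toReal_nonneg
  pol_sum s hs := by
    obtain ⟨R, hR⟩ := exists_block hs
    have hne : (μ.greedy I (μ.cls s)).Nonempty := by
      refine greedy_nonempty ?_
      rw [Memory.enabledAt, hI.E_eq, hR]
      exact h.avail s R hR
    have hsub : μ.greedy I (μ.cls s) ⊆ allPairs M.E := fun q hq => by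
      rw [mem_greedy, Memory.enabledAt, mem_available, hI.E_eq] at hq
      exact mem_allPairs.2 hq.1.2.1
    rw [← Finset.sum_filter, Finset.filter_mem_eq_inter, Finset.inter_eq_right.2 hsub,
      Finset.sum_const, nsmul_eq_mul]
    exact mul_inv_cancel₀ (Nat.cast_ne_zero.2 (Finset.card_pos.2 hne).ne')
  D_sum q _ := sum_toReal_pmf _

variable {I : LimitedInfo S A} {hI : I.IsAbout M F} {μ : Memory S A}
  {h : Coherent M F μ.cls μ.inner}

theorem exploreChain_pos {s : S} {r : (S × A) × S} :
    (exploreChain M I hI μ h).Pos s r ↔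
      (¬ (μ.cls s).IsEnd) ∧ r.1 ∈ μ.greedy I (μ.cls s) ∧ r.2 ∈ (M.Δ r.1.1 r.1.2).support := by
  classical
  have hD : 0 < (M.Δ r.1.1 r.1.2 r.2).toReal ↔ r.2 ∈ (M.Δ r.1.1 r.1.2).support := by
    rw [PMF.mem_support_iff, ENNReal.toReal_pos_iff, pos_iff_ne_zero]
    simp [(PMF.apply_ne_top (M.Δ r.1.1 r.1.2) r.2).lt_top]
  have hg : r.1 ∈ μ.greedy I (μ.cls s) → r.1 ∈ allPairs M.E := fun hq => by
    rw [mem_greedy, Memory.enabledAt, mem_available, hI.E_eq] at hq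
    exact mem_allPairs.2 hq.1.2.1
  simp only [Chain.Pos, exploreChain, hD]
  refine and_congr_right fun _ => ?_
  constructor
  · rintro ⟨_, h2, h3⟩
    split_ifs at h2 with h4
    · exact ⟨h4, h3⟩
    · exact absurd h2 (lt_irrefl 0)
  · rintro ⟨h2, h3⟩
    refine ⟨hg h2, ?_, h3⟩
    rw [if_pos h2]
    exact inv_pos.2 (Nat.cast_pos.2 (Finset.card_pos.2 ⟨_, h2⟩))

omit [Fintype S] in
theorem card_available_le (E : S → Finset A) (inner : Finset (S × A)) (R : Finset S) {n : ℕ}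
    (hE : ∀ s, (E s).card ≤ n) : (available E inner R).card ≤ R.card * n :=
  (Finset.card_le_card Finset.sdiff_subset).trans
    (Finset.card_biUnion_le_card_mul _ _ _ fun s _ => Finset.card_image_le.trans (hE s))

theorem LimitedInfo.IsAbout.one_le_Em (hI : I.IsAbout M F) : 1 ≤ I.Em :=
  (Finset.card_pos.2 (M.E_nonempty M.init)).trans_le (hI.enabled_le M.init)

theorem LimitedInfo.IsAbout.one_le_K (hI : I.IsAbout M F) : 1 ≤ I.K :=
  (Fintype.card_pos_iff.2 ⟨M.init⟩).trans_le hI.card_le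

theorem LimitedInfo.IsAbout.pmin_le_one (hI : I.IsAbout M F) : I.pmin ≤ 1 := by
  obtain ⟨a, ha⟩ := M.E_nonempty M.init
  obtain ⟨s', hs'⟩ := (M.Δ M.init a).support_nonempty
  refine (hI.pmin_le M.init a ha s' hs').trans ?_
  have := ENNReal.toReal_mono ENNReal.one_ne_top (PMF.coe_le_one (M.Δ M.init a) s')
  simpa using this

theorem LimitedInfo.IsAbout.ratio_pos (hI : I.IsAbout M F) : 0 < I.pmin / I.Em :=
  div_pos hI.pmin_pos (Nat.cast_pos.2 hI.one_le_Em)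

theorem LimitedInfo.IsAbout.ratio_le_pmin (hI : I.IsAbout M F) : I.pmin / I.Em ≤ I.pmin :=
  div_le_self hI.pmin_pos.le (Nat.one_le_cast.2 hI.one_le_Em)

theorem LimitedInfo.IsAbout.ratio_le_one (hI : I.IsAbout M F) : I.pmin / I.Em ≤ 1 :=
  hI.ratio_le_pmin.trans hI.pmin_le_one

/-- At most `b * Em` pairs compete in a block with `b` states, so each transition has probability at
least `pmin / (b * Em)`. This is compared with `(pmin / Em) ^ b`. -/
theorem exploreChain_bounded :
    (exploreChain M I hI μ h).Bounded (I.pmin / I.Em) (fun s => (μ.cls s).states) := by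
  classical
  have hEm : (0 : ℝ) < I.Em := Nat.cast_pos.2 hI.one_le_Em
  have hblk : ∀ s R, μ.cls s = .block R → ∀ t ∈ (μ.cls s).states, μ.cls t = μ.cls s := by
    intro s R hR t ht
    rw [hR] at ht ⊢
    exact h.block s R hR t ht
  refine ⟨hI.ratio_pos, hI.ratio_le_one, fun s hs t ht => ?_, fun s hs t ht => ?_, fun s r hr => ?_⟩
  · obtain ⟨R, hR⟩ := exists_block hs
    change ¬ (μ.cls t).IsEnd
    rw [hblk s R hR t ht]; exact hs
  · obtain ⟨R, hR⟩ := exists_block hs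
    funext q
    simp only [exploreChain, hblk s R hR t ht]
  · rw [exploreChain_pos] at hr
    obtain ⟨hs, hg, hsupp⟩ := hr
    obtain ⟨R, hR⟩ := exists_block hs
    have hg' := hg
    rw [mem_greedy, Memory.enabledAt, hI.E_eq, mem_available] at hg'
    have hD : I.pmin ≤ (M.Δ r.1.1 r.1.2 r.2).toReal := hI.pmin_le _ _ hg'.1.2.1 _ hsupp
    have hcard : (μ.greedy I (μ.cls s)).card ≤ R.card * I.Em := by
      refine (Finset.card_le_card (fun q hq => (mem_greedy.1 hq).1)).trans ?_
      rw [Memory.enabledAt, hR]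
      exact card_available_le _ _ _ fun s => by rw [hI.E_eq]; exact hI.enabled_le s
    have hgpos : (0 : ℝ) < (μ.greedy I (μ.cls s)).card := Nat.cast_pos.2 (Finset.card_pos.2 ⟨_, hg⟩)
    have hRpos : 0 < R.card := Finset.card_pos.2 ⟨s, h.mem s R hR⟩
    change _ ≤ (if r.1 ∈ μ.greedy I (μ.cls s) then ((μ.greedy I (μ.cls s)).card : ℝ)⁻¹ else 0) *
      (M.Δ r.1.1 r.1.2 r.2).toReal
    rw [if_pos hg]
    have hstates : (μ.cls s).states = R := by rw [hR]; rfl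
    rw [hstates]
    have hcard' : ((μ.greedy I (μ.cls s)).card : ℝ) ≤ R.card * I.Em := by exact_mod_cast hcard
    refine le_trans ?_ (mul_le_mul (inv_anti₀ hgpos hcard') hD hI.pmin_pos.le
      (inv_nonneg.2 (Nat.cast_nonneg _)))
    have hpow : (R.card : ℝ) * I.Em ≤ (I.Em : ℝ) ^ R.card := by
      rcases Nat.lt_or_ge 1 R.card with h1 | h1
      -- With at least two states in the block, the state of the played pair also has a removed
      -- pair, by which it is connected to the others. Hence `Em ≥ 2`, and `b ≤ 2 ^ (b - 1)` gives
      -- `b * Em ≤ Em ^ b`.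
      · have hEm2 : 2 ≤ I.Em := by
          have hq1 : r.1.1 ∈ R := by
            have h4 := hg'.1.1
            rw [hR] at h4
            exact h4
          obtain ⟨t, ht, hne⟩ := Finset.exists_mem_ne h1 r.1.1
          obtain ⟨a, ha⟩ : ∃ a, (r.1.1, a) ∈ μ.inner := by
            rcases (h.conn r.1.1 R (h.block s R hR _ hq1) t ht).cases_head with h2 | ⟨_, ⟨a, ha, _⟩, _⟩
            · exact absurd h2.symm hne
            · exact ⟨a, ha⟩
          have hne' : a ≠ r.1.2 := fun h3 => hg'.1.2.2 (by
            rw [show r.1 = (r.1.1, a) from Prod.ext rfl h3.symm]; exact ha)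
          refine le_trans ?_ (hI.enabled_le r.1.1)
          rw [← Finset.card_pair hne']
          refine Finset.card_le_card fun b hb => ?_
          rcases Finset.mem_insert.1 hb with rfl | hb
          · exact h.enabled _ ha
          · rw [Finset.mem_singleton] at hb
            exact hb ▸ hg'.1.2.1
        obtain ⟨k, hk⟩ : ∃ k, R.card = k + 1 := ⟨R.card - 1, by omega⟩
        rw [hk, pow_succ]
        refine mul_le_mul_of_nonneg_right ?_ hEm.le
        have h2 : k + 1 ≤ 2 ^ k := Nat.lt_two_pow_self
        calc ((k + 1 : ℕ) : ℝ) ≤ ((2 ^ k : ℕ) : ℝ) := Nat.cast_le.2 h2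
          _ = 2 ^ k := by push_cast; rfl
          _ ≤ _ := pow_le_pow_left₀ (by norm_num) (by exact_mod_cast hEm2) k
      · have : R.card = 1 := by omega
        rw [this, Nat.cast_one, one_mul, pow_one]
    have hpp : I.pmin ^ R.card ≤ I.pmin := pow_le_of_le_one hI.pmin_pos.le hI.pmin_le_one hRpos.ne'
    have hR' : (0 : ℝ) < R.card := Nat.cast_pos.2 hRpos
    rw [div_pow, inv_mul_eq_div]
    exact div_le_div₀ hI.pmin_pos.le hpp (mul_pos hR' hEm) hpow

/-! #### Collapsing a recurrent class -/

theorem mem_future_explore {t : S} {q : S × A} (hq : q ∈ (exploreChain M I hI μ h).future t) :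
    ∃ u R, (exploreChain M I hI μ h).Reach t u ∧ μ.cls u = .block R ∧ μ.cls q.1 = .block R ∧ q.1 ∈ R ∧
      q ∈ μ.greedy I (.block R) ∧ q ∉ μ.inner ∧ q.2 ∈ M.E q.1 := by
  classical
  obtain ⟨_, u, hu, hend, hpol⟩ := (Chain.mem_future _).1 hq
  obtain ⟨R, hR⟩ := exists_block (cls := μ.cls) hend
  simp only [exploreChain] at hpol
  split_ifs at hpol with hg
  · have hg' := hg
    rw [mem_greedy, Memory.enabledAt, hI.E_eq, mem_available, hR] at hg'
    exact ⟨u, R, hu, hR, h.block u R hR _ hg'.1.1, hg'.1.1, hR ▸ hg, hg'.1.2.2, hg'.1.2.1⟩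
  · exact absurd hpol (lt_irrefl 0)

/-- The union of the nodes of the pairs in `B`. -/
def nodeUnion (cls : S → Node S) (B : Finset (S × A)) : Finset S :=
  B.biUnion fun q => (cls q.1).states

omit [Fintype S] [DecidableEq A] in
theorem mem_nodeUnion {B : Finset (S × A)} {s : S} :
    s ∈ nodeUnion cls B ↔ ∃ q ∈ B, s ∈ (cls q.1).states := Finset.mem_biUnion

/-- A transition of the chain starts from the state that owns the pair, possibly another state of
the block than the current one; removed pairs lead there. Equality of nodes instead of states in the
conclusion is needed for the empty path only. -/
theorem jstep_path {t u : S} {B : Finset (S × A)} (hu : (exploreChain M I hI μ h).Reach t u)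
    (hB : (exploreChain M I hI μ h).future t ⊆ B) (R : Finset S) (hR : μ.cls t = .block R) :
    ∀ s ∈ R, ∃ u' , μ.cls u' = μ.cls u ∧
      Relation.ReflTransGen (JStep M ↑(μ.inner ∪ B)) s u' := by
  have hmono : ∀ s t, JStep M ↑μ.inner s t → JStep M ↑(μ.inner ∪ B) s t := by
    rintro s t ⟨a, ha, ht⟩
    exact ⟨a, Finset.mem_coe.2 (Finset.mem_union_left _ ha), ht⟩
  induction hu with
  | refl =>
    intro s hs
    exact ⟨s, by rw [h.block t R hR s hs, hR], .refl⟩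
  | @tail v w hv hstep ih =>
    intro s hs
    obtain ⟨u', hu', hpath⟩ := ih s hs
    obtain ⟨q, hq⟩ := hstep
    have hq' := hq
    rw [exploreChain_pos] at hq'
    obtain ⟨hend, hg, hsupp⟩ := hq'
    obtain ⟨Rv, hRv⟩ := exists_block hend
    rw [mem_greedy, Memory.enabledAt, hI.E_eq, mem_available, hRv] at hg
    have hqf : q ∈ (exploreChain M I hI μ h).future t :=
      (Chain.mem_future _).2 ⟨hq.2.1, v, hv, hq.1, hq.2.2.1⟩
    refine ⟨w, rfl, hpath.trans ?_⟩
    have h1 : Relation.ReflTransGen (JStep M ↑μ.inner) u' q.1 :=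
      h.conn u' Rv (hu'.trans hRv) q.1 hg.1.1
    exact (Relation.ReflTransGen.lift id hmono _ _ h1).tail
      ⟨q.2, Finset.mem_coe.2 (Finset.mem_union_right _ (hB hqf)), hsupp⟩

/-- Nothing is played at ends, so a recurrent class with a pair never reaches one. The merged set is
therefore closed and free of targets, and merging with `one` does not occur. Recurrence means that
every pair of the class can follow any other, which gives connectedness. If no action is left, no
pair leaves the end component, and its value is 0. -/
theorem onTheFlyEC_coherent {i : ℕ} {t : S} (ht : (exploreChain M I hI μ h).Recur t)
    (hend : ¬ (μ.cls t).IsEnd)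
    {p : List ((S × A) × S)} (hp : Memory.appear { μ with path := p } i =
      (exploreChain M I hI μ h).future t) :
    Coherent M F (Memory.onTheFlyEC I i { μ with path := p }).cls
      (Memory.onTheFlyEC I i { μ with path := p }).inner := by
  set c := exploreChain M I hI μ h with hc
  set B := c.future t with hB
  have hcls : ∀ s, (Memory.onTheFlyEC I i { μ with path := p }).cls s =
      if s ∈ nodeUnion μ.cls B then
        (if (nodeUnion μ.cls B ∩ I.target).Nonempty then .one
          else if available I.E (μ.inner ∪ B) (nodeUnion μ.cls B) = ∅ then .zero
          else .block (nodeUnion μ.cls B)) else μ.cls s := by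
    intro s
    simp only [Memory.onTheFlyEC, hp]
    rfl
  have hinner : (Memory.onTheFlyEC I i { μ with path := p }).inner = μ.inner ∪ B := by
    simp only [Memory.onTheFlyEC, hp]
  rw [show (Memory.onTheFlyEC I i { μ with path := p }).cls = _ from funext hcls, hinner]
  set R' := nodeUnion μ.cls B with hR'
  have hfut : ∀ q ∈ B, ∃ u R, c.Reach t u ∧ μ.cls u = .block R ∧ μ.cls q.1 = .block R ∧ q.1 ∈ R ∧
      q ∈ μ.greedy I (.block R) ∧ q ∉ μ.inner ∧ q.2 ∈ M.E q.1 := fun q hq => mem_future_explore hq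
  have hmem : ∀ s, s ∈ R' ↔ ∃ q ∈ B, ∃ R, μ.cls q.1 = .block R ∧ s ∈ R ∧ μ.cls s = .block R := by
    intro s
    rw [hR', mem_nodeUnion]
    constructor
    · rintro ⟨q, hq, hs⟩
      obtain ⟨u, R, _, _, hqR, _⟩ := hfut q hq
      rw [hqR] at hs
      exact ⟨q, hq, R, hqR, hs, h.block _ R hqR s hs⟩
    · rintro ⟨q, hq, R, hqR, hs, _⟩
      exact ⟨q, hq, by rw [hqR]; exact hs⟩
  have hsub : ∀ s ∈ R', ∀ R, μ.cls s = .block R → R ⊆ R' := by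
    intro s hs R hsR u hu
    obtain ⟨q, hq, R1, hqR, hs1, hsR1⟩ := (hmem s).1 hs
    rw [hsR] at hsR1
    cases hsR1
    exact (hmem u).2 ⟨q, hq, R, hqR, hu, h.block s R hsR u hu⟩
  have hqR' : ∀ q ∈ B, q.1 ∈ R' := by
    intro q hq
    obtain ⟨u, R, _, _, hqR, hq1, _⟩ := hfut q hq
    exact (hmem _).2 ⟨q, hq, R, hqR, hq1, hqR⟩
  -- states reached after `t` are in `R'`
  have hBne : B.Nonempty := by
    obtain ⟨q, hq, hpos⟩ := c.exists_pol_pos hend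
    exact ⟨q, (c.mem_future).2 ⟨hq, t, .refl, hend, hpos⟩⟩
  have hreach : ∀ u, c.Reach t u → u ∈ R' ∧ ∃ R, μ.cls u = .block R := by
    intro u hu
    have hfu : c.future u = B := ht u hu
    have hu_end : ¬ (μ.cls u).IsEnd := by
      intro he
      obtain ⟨q, hq⟩ := hBne
      rw [← hfu, c.mem_future] at hq
      obtain ⟨_, v, hv, hvend, _⟩ := hq
      rcases hv.cases_head with h1 | ⟨_, ⟨_, h2⟩, _⟩
      · exact hvend (h1 ▸ he)
      · exact h2.1 he
    obtain ⟨R, hR⟩ := exists_block hu_end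
    obtain ⟨q, hq, hpos⟩ := c.exists_pol_pos (s := u) hu_end
    have hqB : q ∈ B := hfu ▸ (c.mem_future).2 ⟨hq, u, .refl, hu_end, hpos⟩
    have hg : q ∈ μ.greedy I (μ.cls u) := by
      classical
      simp only [hc, exploreChain] at hpos
      split_ifs at hpos with hg
      · exact hg
      · exact absurd hpos (lt_irrefl 0)
    rw [mem_greedy, Memory.enabledAt, mem_available, hR] at hg
    exact ⟨(hmem u).2 ⟨q, hqB, R, h.block u R hR _ hg.1.1, h.mem u R hR, hR⟩, R, hR⟩
  have hBstep : ∀ q ∈ B, ∀ s' ∈ (M.Δ q.1 q.2).support, c.Reach t s' := by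
    intro q hq s' hs'
    obtain ⟨u, R, hu, huR, _, _, hg, _⟩ := hfut q hq
    exact hu.tail ⟨q, exploreChain_pos.2 ⟨by rw [huR]; exact fun h => h, by rw [huR]; exact hg, hs'⟩⟩
  have hJE : ∀ q ∈ (↑(μ.inner ∪ B) : Set (S × A)), q.2 ∈ M.E q.1 := by
    intro q hq
    rcases Finset.mem_union.1 (Finset.mem_coe.1 hq) with hq | hq
    · exact h.enabled q hq
    · obtain ⟨_, _, _, _, _, _, _, _, hE⟩ := hfut q hq
      exact hE
  have hmono : ∀ s t, JStep M ↑μ.inner s t → JStep M ↑(μ.inner ∪ B) s t := by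
    rintro s t ⟨a, ha, ht⟩
    exact ⟨a, Finset.mem_coe.2 (Finset.mem_union_left _ ha), ht⟩
  have hclosed : ∀ s ∈ R', ∀ v, JStep M ↑(μ.inner ∪ B) s v → v ∈ R' := by
    rintro s hs v ⟨a, ha, hv⟩
    rcases Finset.mem_union.1 (Finset.mem_coe.1 ha) with ha | ha
    · obtain ⟨_, _, R, _, _, hsR⟩ := (hmem s).1 hs
      exact hsub s hs R hsR (h.closed s R hsR v ⟨a, ha, hv⟩)
    · exact (hreach v (hBstep _ ha v hv)).1
  have hconn : ∀ s ∈ R', ∀ v ∈ R', Relation.ReflTransGen (JStep M ↑(μ.inner ∪ B)) s v := by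
    intro s hs v hv
    obtain ⟨q1, hq1, R1, hq1R, hs1, hsR⟩ := (hmem s).1 hs
    obtain ⟨q2, hq2, R2, hq2R, hv2, hvR⟩ := (hmem v).1 hv
    obtain ⟨_, _, _, _, hq1R', hq1mem, _⟩ := hfut q1 hq1
    rw [hq1R] at hq1R'
    cases hq1R'
    -- go to `q1`, play it, then go to the node of `q2`
    obtain ⟨s', hs'⟩ := (M.Δ q1.1 q1.2).support_nonempty
    have h1 : Relation.ReflTransGen (JStep M ↑(μ.inner ∪ B)) s s' :=
      (Relation.ReflTransGen.lift id hmono _ _ (h.conn s R1 hsR q1.1 hq1mem)).tail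
        ⟨q1.2, Finset.mem_coe.2 (Finset.mem_union_right _ hq1), hs'⟩
    have hs't := hBstep q1 hq1 s' hs'
    obtain ⟨_, Rs', hRs'⟩ := hreach s' hs't
    have hfs' : c.future s' = B := ht s' hs't
    obtain ⟨u, R, hu, huR, hq2R', _⟩ := mem_future_explore (hfs' ▸ hq2 : q2 ∈ c.future s')
    rw [hq2R] at hq2R'
    cases hq2R'
    obtain ⟨u', hu', hpath⟩ := jstep_path hu hfs'.le Rs' hRs' s' (h.mem s' Rs' hRs')
    exact (h1.trans hpath).trans
      (Relation.ReflTransGen.lift id hmono _ _ (h.conn u' R2 (hu'.trans huR) v hv2))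
  have hRF : ∀ s ∈ R', s ∉ F := by
    intro s hs hsF
    obtain ⟨_, _, R, _, _, hsR⟩ := (hmem s).1 hs
    rw [(h.one_iff s).2 hsF] at hsR
    cases hsR
  have hnt : ¬ (R' ∩ I.target).Nonempty := by
    rintro ⟨s, hs⟩
    rw [Finset.mem_inter, hI.target_eq] at hs
    exact hRF s hs.1 hs.2
  simp only [if_neg hnt]
  have hdisj : ∀ s ∉ R', ∀ R, μ.cls s = .block R → ∀ u ∈ R, u ∉ R' := fun s hs R hsR u hu huR' =>
    hs (hsub u huR' R (h.block s R hsR u hu) (h.mem s R hsR))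
  have hblk : ∀ s R, (if s ∈ R' then (if available I.E (μ.inner ∪ B) R' = ∅ then Node.zero
      else .block R') else μ.cls s) = .block R →
      (s ∈ R' ∧ R = R' ∧ (available M.E (μ.inner ∪ B) R').Nonempty) ∨ (s ∉ R' ∧ μ.cls s = .block R) := by
    intro s R hs
    split_ifs at hs with h1 h2
    · cases hs
      exact Or.inl ⟨h1, rfl, by rw [← hI.E_eq]; exact Finset.nonempty_iff_ne_empty.2 h2⟩
    · exact Or.inr ⟨h1, hs⟩
  constructor
  · intro s
    split_ifs with h1 h2
    · simp [hRF s h1]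
    · simp [hRF s h1]
    · exact h.one_iff s
  · intro s hs
    split_ifs at hs with h1 h2
    · refine le_antisymm ?_ (value_nonneg ..)
      refine value_le_of_endComponent M F ↑(μ.inner ∪ B) R' hRF hJE hclosed hconn 0 le_rfl ?_ s h1
      intro u hu a ha hua
      have : (u, a) ∈ available I.E (μ.inner ∪ B) R' :=
        mem_available.2 ⟨hu, by rw [hI.E_eq]; exact ha, fun h => hua (Finset.mem_coe.2 h)⟩
      rw [h2] at this
      exact absurd this (Finset.notMem_empty _)
    · exact h.zero s hs
  · intro s R hs
    rcases hblk s R hs with ⟨h1, rfl, _⟩ | ⟨_, h2⟩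
    · exact h1
    · exact h.mem s R h2
  · intro s R hs u hu
    rcases hblk s R hs with ⟨h1, rfl, h3⟩ | ⟨h1, h2⟩
    · rw [if_pos h1] at hs
      rw [if_pos hu, hs]
    · rw [if_neg (hdisj s h1 R h2 u hu)]
      exact h.block s R h2 u hu
  · intro s R hs
    rcases hblk s R hs with ⟨h1, rfl, h3⟩ | ⟨h1, h2⟩
    · exact h3
    · obtain ⟨q, hq⟩ := h.avail s R h2
      rw [mem_available] at hq
      refine ⟨q, mem_available.2 ⟨hq.1, hq.2.1, fun hqB => ?_⟩⟩
      rcases Finset.mem_union.1 hqB with h3 | h3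
      · exact hq.2.2 h3
      · exact hdisj s h1 R h2 q.1 hq.1 (hqR' q h3)
  · exact fun q hq => hJE q (Finset.mem_coe.2 hq)
  · intro s R hs v hv
    rcases hblk s R hs with ⟨h1, rfl, _⟩ | ⟨h1, h2⟩
    · exact hclosed s h1 v hv
    · obtain ⟨a, ha, hv⟩ := hv
      rcases Finset.mem_union.1 (Finset.mem_coe.1 ha) with ha | ha
      · exact h.closed s R h2 v ⟨a, ha, hv⟩
      · exact absurd (hqR' _ ha) h1
  · intro s R hs v hv
    rcases hblk s R hs with ⟨h1, rfl, _⟩ | ⟨h1, h2⟩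
    · exact hconn s h1 v hv
    · exact Relation.ReflTransGen.lift id hmono _ _ (h.conn s R h2 v hv)

end Collapsed

/-! ### The probability of a correct output as a function of the snapshot -/

section Expectation

variable {α : Type u} {β : Type v}

/-- The expectation of a nonnegative function. -/
noncomputable def pmfExp (p : PMF α) (f : α → ℝ≥0∞) : ℝ≥0∞ := ∑' x, p x * f x

theorem pmfExp_pure (a : α) (f : α → ℝ≥0∞) : pmfExp (PMF.pure a) f = f a := by
  unfold pmfExp
  rw [tsum_eq_single a]
  · simp
  · intro b hb; simp [hb]

theorem pmfExp_bind (p : PMF α) (g : α → PMF β) (f : β → ℝ≥0∞) :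
    pmfExp (p.bind g) f = pmfExp p fun x => pmfExp (g x) f := by
  simp only [pmfExp, PMF.bind_apply, ← ENNReal.tsum_mul_right, ← ENNReal.tsum_mul_left]
  rw [ENNReal.tsum_comm]
  simp only [mul_assoc]

theorem pmfExp_map (p : PMF α) (g : α → β) (f : β → ℝ≥0∞) :
    pmfExp (p.map g) f = pmfExp p fun x => f (g x) := by
  rw [PMF.map, pmfExp_bind]
  simp only [Function.comp, pmfExp_pure]

theorem pmfExp_uniform (T : Finset α) (h : T.Nonempty) (f : α → ℝ≥0∞) :
    pmfExp (PMF.uniformOfFinset T h) f = ∑ x ∈ T, (T.card : ℝ≥0∞)⁻¹ * f x := by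
  unfold pmfExp
  rw [tsum_eq_sum (s := T)]
  · refine Finset.sum_congr rfl fun x hx => ?_
    rw [PMF.uniformOfFinset_apply_of_mem h hx]
  · intro x hx
    rw [PMF.uniformOfFinset_apply_of_notMem h hx, zero_mul]

theorem pmfExp_mono (p : PMF α) {f g : α → ℝ≥0∞} (h : ∀ x, f x ≤ g x) : pmfExp p f ≤ pmfExp p g :=
  ENNReal.tsum_le_tsum fun x => mul_le_mul_right (h x) _

theorem pmfExp_le_one (p : PMF α) {f : α → ℝ≥0∞} (h : ∀ x, f x ≤ 1) : pmfExp p f ≤ 1 :=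
  (pmfExp_mono p h).trans (by simp [pmfExp, PMF.tsum_coe])

theorem pmfExp_iSup (p : PMF α) (f : ℕ → α → ℝ≥0∞) (hf : ∀ x, Monotone fun n => f n x) :
    pmfExp p (fun x => ⨆ n, f n x) ≤ ⨆ n, pmfExp p (f n) := by
  unfold pmfExp
  rw [ENNReal.tsum_eq_iSup_sum]
  refine iSup_le fun s => ?_
  simp only [ENNReal.mul_iSup]
  rw [ENNReal.finsetSum_iSup_of_monotone (f := fun x n => p x * f n x) fun x m n hmn => mul_le_mul_right (hf x hmn) _]
  exact iSup_mono fun n => ENNReal.sum_le_tsum s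

end Expectation

/-! ### Stopping probabilities by backward recursion -/

namespace SimAlgorithm

variable {S : Type u} {A : Type v} {Mem : Type w} (alg : SimAlgorithm S A Mem) (M : MDP S A)
  (Q : Mem → Prop)

open Classical in
/-- The probability to stop within `n` steps with a memory satisfying `Q`. -/
noncomputable def stopWithin : ℕ → Snapshot S Mem → ℝ≥0∞
  | 0, c => if ∃ μ, c = .stopped μ ∧ Q μ then 1 else 0
  | n + 1, c => pmfExp (alg.step M c) (stopWithin n)

/-- The probability to stop with a memory satisfying `Q`. -/
noncomputable def stopProb (c : Snapshot S Mem) : ℝ≥0∞ := ⨆ n, alg.stopWithin M Q n c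

theorem stopWithin_le_one (n : ℕ) (c : Snapshot S Mem) : alg.stopWithin M Q n c ≤ 1 := by
  induction n generalizing c with
  | zero => rw [stopWithin]; split_ifs; exacts [le_rfl, zero_le]
  | succ n ih => exact pmfExp_le_one _ ih

theorem stopProb_le_one (c : Snapshot S Mem) : alg.stopProb M Q c ≤ 1 :=
  iSup_le fun n => alg.stopWithin_le_one M Q n c

theorem stopWithin_mono (c : Snapshot S Mem) : Monotone fun n => alg.stopWithin M Q n c := by
  refine monotone_nat_of_le_succ fun n => ?_
  induction n generalizing c with
  | zero =>
    rw [stopWithin, stopWithin]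
    split_ifs with h
    · obtain ⟨μ, rfl, hμ⟩ := h
      rw [step, pmfExp_pure, stopWithin, if_pos ⟨μ, rfl, hμ⟩]
    · exact zero_le
  | succ n ih => exact pmfExp_mono _ ih

/-- Failure is to be bounded from above, so one inequality suffices. With `stopProb_stopped` it is
all that is used about the run of the algorithm; nothing has to be shown to happen almost surely. -/
theorem pmfExp_step_le_stopProb (c : Snapshot S Mem) :
    pmfExp (alg.step M c) (alg.stopProb M Q) ≤ alg.stopProb M Q c :=
  (pmfExp_iSup _ _ fun c => alg.stopWithin_mono M Q c).trans
    (iSup_le fun n => le_iSup (fun n => alg.stopWithin M Q n c) (n + 1))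

theorem stopProb_stopped {μ : Mem} (h : Q μ) : alg.stopProb M Q (.stopped μ) = 1 := by
  refine le_antisymm (alg.stopProb_le_one ..) ?_
  refine le_trans ?_ (le_iSup _ 0)
  rw [stopWithin, if_pos ⟨μ, rfl, h⟩]

theorem probStopsWith_eq : alg.probStopsWith M Q = alg.stopProb M Q (.running alg.start M.init) := by
  -- The forward evolution for `n` steps is followed by the backward recursion for `k` steps.
  have key : ∀ n k, pmfExp (alg.law M n) (alg.stopWithin M Q k) =
      alg.stopWithin M Q (n + k) (.running alg.start M.init) := by
    intro n
    induction n with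
    | zero => intro k; rw [law, pmfExp_pure, zero_add]
    | succ n ih =>
      intro k
      rw [law, pmfExp_bind, Nat.succ_add, ← Nat.add_succ, ← ih]
      rfl
  unfold probStopsWith stopProb
  congr 1
  funext n
  have h := key n 0
  rw [add_zero] at h
  rw [← h, PMF.toOuterMeasure_apply, pmfExp]
  refine tsum_congr fun c => ?_
  classical
  rw [stopWithin]
  by_cases hc : ∃ μ, c = .stopped μ ∧ Q μ
  · rw [Set.indicator_of_mem (show c ∈ {c | ∃ μ, c = Snapshot.stopped μ ∧ Q μ} from hc), if_pos hc,
      mul_one]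
  · rw [Set.indicator_of_notMem (show c ∉ {c | ∃ μ, c = Snapshot.stopped μ ∧ Q μ} from hc), if_neg hc,
      mul_zero]

/-- The probability to stop with a memory satisfying `Q` after the command. -/
noncomputable def commandProb (μ : Mem) (s : S) : Command S A Mem → ℝ≥0∞
  | .halt => alg.stopProb M Q (.stopped μ)
  | .restart μ' => alg.stopProb M Q (.running μ' M.init)
  | .play a k => pmfExp (M.Δ s a) fun s' => alg.stopProb M Q (.running (k s') s')

theorem commandProb_le_one (μ : Mem) (s : S) (b : Command S A Mem) :
    alg.commandProb M Q μ s b ≤ 1 := by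
  cases b with
  | halt => exact alg.stopProb_le_one ..
  | restart μ' => exact alg.stopProb_le_one ..
  | play a k => exact pmfExp_le_one _ fun s' => alg.stopProb_le_one ..

theorem pmfExp_decide_le (μ : Mem) (s : S) :
    pmfExp (alg.decide μ s) (alg.commandProb M Q μ s) ≤ alg.stopProb M Q (.running μ s) := by
  refine le_trans (le_of_eq ?_) (alg.pmfExp_step_le_stopProb M Q _)
  rw [step, pmfExp_bind]
  congr 1
  funext b
  cases b with
  | halt => simp only [commandProb, pmfExp_pure]
  | restart μ' => simp only [commandProb, pmfExp_pure]
  | play a k => simp only [commandProb, pmfExp_map]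

/-- The probability not to stop with a memory satisfying `Q`. -/
noncomputable def failProb (c : Snapshot S Mem) : ℝ := 1 - (alg.stopProb M Q c).toReal

theorem failProb_le_one (c : Snapshot S Mem) : alg.failProb M Q c ≤ 1 :=
  sub_le_self _ ENNReal.toReal_nonneg

theorem failProb_le_of_le {c c' : Snapshot S Mem} (h : alg.stopProb M Q c' ≤ alg.stopProb M Q c) :
    alg.failProb M Q c ≤ alg.failProb M Q c' :=
  sub_le_sub_left (ENNReal.toReal_mono (ne_top_of_le_ne_top ENNReal.one_ne_top
    (alg.stopProb_le_one M Q c)) h) 1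

end SimAlgorithm

/-! ### One EXPLORE phase of the algorithm -/

section Explore

variable {S : Type u} {A : Type v} [Fintype S] [DecidableEq S] [DecidableEq A]

theorem pmfExp_fintype (p : PMF S) (f : S → ℝ≥0∞) (hf : ∀ s, f s ≤ 1) :
    (pmfExp p f).toReal = ∑ s, (p s).toReal * (f s).toReal := by
  unfold pmfExp
  rw [tsum_fintype, ENNReal.toReal_sum fun s _ => ENNReal.mul_ne_top (PMF.apply_ne_top _ _)
    (ne_top_of_le_ne_top ENNReal.one_ne_top (hf s))]
  simp only [ENNReal.toReal_mul]

/-- A function that dominates the averages of its averages over the actions in `T`, except in `z`, is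
at least its value in `z`. -/
theorem le_of_avg_superharmonic (M : MDP S A) (J : Set (S × A)) (R : Finset S) (f : S → ℝ) (z : S)
    (T : S → Finset A) (hT : ∀ s a, (s, a) ∈ J ↔ a ∈ T s)
    (hf : ∀ s ∈ R, s ≠ z → ∑ b ∈ T s, ∑ s', (M.Δ s b s').toReal * f s' ≤ (T s).card * f s)
    (hcl : ∀ s ∈ R, ∀ t, JStep M J s t → t ∈ R)
    (hconn : ∀ s ∈ R, Relation.ReflTransGen (JStep M J) s z) :
    ∀ s ∈ R, f z ≤ f s := by
  intro s hs
  obtain ⟨m, hm, hmin⟩ := R.exists_min_image f ⟨s, hs⟩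
  -- The minimum spreads along the steps, as long as the exceptional state `z` is not met; once it
  -- is met, it attains the minimum itself.
  suffices h : ∀ u, Relation.ReflTransGen (JStep M J) m u → u ∈ R ∧ (f z ≤ f m ∨ f u = f m) by
    have h1 := (h z (hconn m hm)).2
    have h2 := hmin s hs
    rcases h1 with h1 | h1 <;> linarith
  intro u hu
  induction hu with
  | refl => exact ⟨hm, Or.inr rfl⟩
  | @tail u w _ hstep ih =>
    obtain ⟨huR, hfu⟩ := ih
    refine ⟨hcl u huR w hstep, ?_⟩
    obtain ⟨a, ha, hw⟩ := hstep
    rcases hfu with hfu | hfu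
    · exact Or.inl hfu
    by_cases huz : u = z
    · exact Or.inl (huz ▸ hfu.le)
    refine Or.inr ?_
    by_contra hne
    have hlt : f m < f w := lt_of_le_of_ne (hmin w (hcl u huR w ⟨a, ha, hw⟩)) (Ne.symm hne)
    have h1 := hf u huR huz
    have hge : ∀ b ∈ T u, ∀ s', (M.Δ u b s').toReal * f m ≤ (M.Δ u b s').toReal * f s' := by
      intro b hb s'
      by_cases h0 : M.Δ u b s' = 0
      · simp [h0]
      · exact mul_le_mul_of_nonneg_left (hmin s' (hcl u huR s'
          ⟨b, (hT u b).2 hb, (PMF.mem_support_iff _ _).2 h0⟩)) ENNReal.toReal_nonneg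
    have hone : ∀ b, ∑ s', (M.Δ u b s').toReal * f m = f m := fun b => by
      rw [← Finset.sum_mul, sum_toReal_pmf, one_mul]
    have h2 : ∑ b ∈ T u, f m < ∑ b ∈ T u, ∑ s', (M.Δ u b s').toReal * f s' := by
      refine Finset.sum_lt_sum (fun b hb => ?_) ⟨a, (hT u a).1 ha, ?_⟩
      · rw [← hone b]
        exact Finset.sum_le_sum fun s' _ => hge b hb s'
      · rw [← hone a]
        refine Finset.sum_lt_sum (fun s' _ => hge a ((hT u a).1 ha) s') ⟨w, Finset.mem_univ _, ?_⟩
        refine mul_lt_mul_of_pos_left hlt (ENNReal.toReal_pos ?_ (PMF.apply_ne_top _ _))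
        exact (PMF.mem_support_iff _ _).1 hw
    rw [Finset.sum_const, nsmul_eq_mul] at h2
    rw [hfu] at h1
    linarith

variable {M : MDP S A} {F : Finset S} {I : LimitedInfo S A}
  (Q : Memory S A → Prop) (ε : ℝ) (m : ℕ) (ebar : ℝ) (ℓ : ℕ → ℕ)

/-- In an end component that has been collapsed, the selected pair is reached and played. -/
theorem le_pursue (hI : I.IsAbout M F) {μ : Memory S A} (h : Coherent M F μ.cls μ.inner) {R : Finset S} {q : S × A}
    (hR : μ.cls q.1 = .block R) {s : S} (hs : s ∈ R) (μ' : Memory S A) :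
    pmfExp (M.Δ q.1 q.2) (fun s' => (algorithm I ε m ebar ℓ).stopProb M Q
      (.running { μ with path := (q, s') :: μ.path, goal := none } s')) ≤
    pmfExp (μ.pursue I s q) ((algorithm I ε m ebar ℓ).commandProb M Q μ' s) := by
  set alg := algorithm I ε m ebar ℓ with halg
  set P : S → ℝ≥0∞ := fun t => pmfExp (μ.pursue I t q) (alg.commandProb M Q μ' t) with hP
  have hq : q.1 ∈ R := h.mem _ R hR
  have hP1 : ∀ t, P t ≤ 1 := fun t => pmfExp_le_one _ fun b => alg.commandProb_le_one ..
  set W : S → ℝ≥0∞ := fun t => alg.stopProb M Q (.running { μ with goal := some q } t) with hW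
  -- A stored goal is pursued like a goal just selected, so away from `q.1` the function `P`
  -- dominates its own average over the removed pairs.
  have hPW : ∀ t, P t ≤ W t := by
    intro t
    have h1 := alg.pmfExp_decide_le M Q { μ with goal := some q } t
    refine le_trans (le_of_eq ?_) h1
    change _ = pmfExp (Memory.pursue I { μ with goal := some q } t q) _
    unfold P
    simp only [Memory.pursue]
    split_ifs with htq
    · simp only [pmfExp_pure, SimAlgorithm.commandProb]
    · unfold drawFrom
      split_ifs
      · simp only [pmfExp_bind, pmfExp_pure, SimAlgorithm.commandProb]
      · simp only [pmfExp_pure, SimAlgorithm.commandProb]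
  have hPq : P q.1 = pmfExp (M.Δ q.1 q.2) (fun s' => alg.stopProb M Q
      (.running { μ with path := (q, s') :: μ.path, goal := none } s')) := by
    unfold P
    simp only [Memory.pursue, if_true, pmfExp_pure, SimAlgorithm.commandProb]
  rw [← hPq]
  change P q.1 ≤ P s
  -- The minimum principle replaces a proof that the uniform walk inside the block reaches `q.1`
  -- almost surely.
  have hreal : (P q.1).toReal ≤ (P s).toReal := by
    refine le_of_avg_superharmonic M ↑μ.inner R (fun t => (P t).toReal) q.1
      (fun t => (I.E t).filter fun b => (t, b) ∈ μ.inner) (fun t a => ?_) (fun t ht htq => ?_)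
      (fun t ht => h.closed t R (h.block _ R hR t ht))
      (fun t ht => h.conn t R (h.block _ R hR t ht) q.1 hq) s hs
    · rw [Finset.mem_filter, Finset.mem_coe]
      exact ⟨fun ha => ⟨by rw [hI.E_eq]; exact h.enabled _ ha, ha⟩, fun ha => ha.2⟩
    · set T := (I.E t).filter fun b => (t, b) ∈ μ.inner with hTdef
      have hT : T.Nonempty := by
        rcases (h.conn t R (h.block _ R hR t ht) q.1 hq).cases_head with h2 | ⟨_, ⟨a, ha, _⟩, _⟩
        · exact absurd h2 htq
        · exact ⟨a, Finset.mem_filter.2 ⟨by rw [hI.E_eq]; exact h.enabled _ ha, ha⟩⟩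
      have hPt : P t = ∑ b ∈ T, (T.card : ℝ≥0∞)⁻¹ * pmfExp (M.Δ t b) W := by
        change pmfExp (μ.pursue I t q) _ = _
        simp only [Memory.pursue, if_neg htq]
        unfold drawFrom
        rw [dif_pos hT, pmfExp_bind, pmfExp_uniform]
        simp only [pmfExp_pure, SimAlgorithm.commandProb]
        rfl
      have hge : ∑ b ∈ T, (T.card : ℝ≥0∞)⁻¹ * pmfExp (M.Δ t b) P ≤ P t := by
        rw [hPt]
        exact Finset.sum_le_sum fun b _ => mul_le_mul_right (pmfExp_mono _ hPW) _
      have hc : (0 : ℝ) < T.card := Nat.cast_pos.2 (Finset.card_pos.2 hT)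
      have hge' := ENNReal.toReal_mono (ne_top_of_le_ne_top ENNReal.one_ne_top (hP1 t)) hge
      rw [← Finset.mul_sum, ENNReal.toReal_mul, ENNReal.toReal_inv, ENNReal.toReal_natCast,
        ENNReal.toReal_sum (fun b _ => ne_top_of_le_ne_top ENNReal.one_ne_top (pmfExp_le_one _ hP1))]
        at hge'
      simp only [pmfExp_fintype _ P hP1] at hge'
      have := mul_le_mul_of_nonneg_left hge' hc.le
      rwa [← mul_assoc, mul_inv_cancel₀ hc.ne', one_mul] at this
  exact (ENNReal.toReal_le_toReal (ne_top_of_le_ne_top ENNReal.one_ne_top (hP1 _))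
    (ne_top_of_le_ne_top ENNReal.one_ne_top (hP1 _))).1 hreal

/-- Walks inside blocks are absorbed by `le_pursue`, so an EXPLORE phase becomes a run of a chain on
the original states; `n` is the number of transitions left before the path is cut off. The gap is
needed only to exclude halting. Stored paths have the latest transition first, hence the reversal.
-/
theorem failProb_running_le (hI : I.IsAbout M F) {μ : Memory S A} (h : Coherent M F μ.cls μ.inner)
    (hgap : ε ≤ μ.upper I I.init - μ.lower I I.init) (n : ℕ) :
    ∀ (s : S) (p : List ((S × A) × S)), p.length + n + 1 = 3 * ℓ μ.iter ^ 3 →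
    (algorithm I ε m ebar ℓ).failProb M Q (.running { μ with path := p, goal := none } s) ≤
      (exploreChain M I hI μ h).expect n s
        (fun l => (algorithm I ε m ebar ℓ).failProb M Q
          (.running (Memory.updatePhase I m ebar { μ with path := l.reverse ++ p, goal := none }) M.init))
        (fun l => (algorithm I ε m ebar ℓ).failProb M Q
          (.running (Memory.onTheFlyEC I (ℓ μ.iter) { μ with path := l.reverse ++ p, goal := none })
            M.init)) := by
  classical
  set alg := algorithm I ε m ebar ℓ with halg
  have hnohalt : ∀ p : List ((S × A) × S), ¬ (p = [] ∧ μ.upper I I.init - μ.lower I I.init < ε) :=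
    fun p hp => absurd hp.2 (not_lt.2 hgap)
  induction n with
  | zero =>
    intro s p hp
    refine alg.failProb_le_of_le M Q ?_
    refine le_trans (le_of_eq ?_) (alg.pmfExp_decide_le M Q _ s)
    have hdec : alg.decide { μ with path := p, goal := none } s =
        PMF.pure (.restart (Memory.onTheFlyEC I (ℓ μ.iter) { μ with path := p, goal := none })) := by
      change (if p = [] ∧ μ.upper I I.init - μ.lower I I.init < ε then _ else
        if p.length + 1 = 3 * ℓ μ.iter ^ 3 then _ else _) = _
      rw [if_neg (hnohalt p), if_pos (by omega)]
    rw [hdec, pmfExp_pure]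
    rfl
  | succ n ih =>
    intro s p hp
    have hdec : alg.decide { μ with path := p, goal := none } s =
        if (μ.cls s).IsEnd then
          PMF.pure (.restart (Memory.updatePhase I m ebar { μ with path := p, goal := none }))
        else drawFrom (μ.greedy I (μ.cls s)) (.restart { μ with path := [], goal := none })
          (Memory.pursue I { μ with path := p, goal := none } s) := by
      change (if p = [] ∧ μ.upper I I.init - μ.lower I I.init < ε then _ else
        if p.length + 1 = 3 * ℓ μ.iter ^ 3 then _ else _) = _
      rw [if_neg (hnohalt p), if_neg (by omega)]
      rfl
    have hstep := alg.pmfExp_decide_le M Q { μ with path := p, goal := none } s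
    rw [hdec] at hstep
    rw [Chain.expect]
    by_cases hs : (μ.cls s).IsEnd
    · rw [if_pos (show (exploreChain M I hI μ h).End s from hs)]
      rw [if_pos hs, pmfExp_pure] at hstep
      exact alg.failProb_le_of_le M Q hstep
    · rw [if_neg (show ¬ (exploreChain M I hI μ h).End s from hs)]
      rw [if_neg hs] at hstep
      obtain ⟨R, hR⟩ := exists_block hs
      set T := μ.greedy I (μ.cls s) with hT
      have hne : T.Nonempty := by
        refine greedy_nonempty ?_
        rw [Memory.enabledAt, hI.E_eq, hR]
        exact h.avail s R hR
      unfold drawFrom at hstep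
      rw [dif_pos hne, pmfExp_bind, pmfExp_uniform] at hstep
      set X : (S × A) × S → Snapshot S (Memory S A) := fun r =>
        .running { μ with path := r :: p, goal := none } r.2 with hX
      have hle : ∑ q ∈ T, (T.card : ℝ≥0∞)⁻¹ * pmfExp (M.Δ q.1 q.2)
          (fun s' => alg.stopProb M Q (X (q, s'))) ≤
          alg.stopProb M Q (.running { μ with path := p, goal := none } s) := by
        refine le_trans (Finset.sum_le_sum fun q hq => mul_le_mul_right ?_ _) hstep
        rw [hT, mem_greedy, Memory.enabledAt, mem_available, hR] at hq
        exact le_pursue Q ε m ebar ℓ hI (μ := { μ with path := p, goal := none }) h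
          (h.block s R hR _ hq.1.1) (h.mem s R hR) _
      have hX1 : ∀ r, alg.stopProb M Q (X r) ≤ 1 := fun r => alg.stopProb_le_one ..
      have hle' := ENNReal.toReal_mono (ne_top_of_le_ne_top ENNReal.one_ne_top
        (alg.stopProb_le_one M Q _)) hle
      rw [ENNReal.toReal_sum (fun q _ => ENNReal.mul_ne_top (ENNReal.inv_ne_top.2 (Nat.cast_ne_zero.2
        (Finset.card_pos.2 hne).ne')) (ne_top_of_le_ne_top ENNReal.one_ne_top
          (pmfExp_le_one _ fun s' => hX1 _)))] at hle'
      simp only [ENNReal.toReal_mul, ENNReal.toReal_inv, ENNReal.toReal_natCast] at hle'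
      simp only [pmfExp_fintype _ _ fun s' => hX1 (_, s')] at hle'
      have havg : (exploreChain M I hI μ h).avg s (fun r => (alg.stopProb M Q (X r)).toReal) =
          ∑ q ∈ T, (T.card : ℝ)⁻¹ * ∑ s', (M.Δ q.1 q.2 s').toReal *
            (alg.stopProb M Q (X (q, s'))).toReal := by
        classical
        have hsub : T ⊆ allPairs M.E := fun q hq => by
          rw [hT, mem_greedy, Memory.enabledAt, mem_available, hI.E_eq] at hq
          exact mem_allPairs.2 hq.1.2.1
        simp only [Chain.avg, exploreChain, ite_mul, zero_mul]
        rw [← Finset.sum_filter, Finset.filter_mem_eq_inter, Finset.inter_eq_right.2 hsub]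
      rw [← havg] at hle'
      have h1 : alg.failProb M Q (.running { μ with path := p, goal := none } s) ≤
          (exploreChain M I hI μ h).avg s (fun r => alg.failProb M Q (X r)) := by
        have h2 : (exploreChain M I hI μ h).avg s (fun r => alg.failProb M Q (X r)) =
            1 - (exploreChain M I hI μ h).avg s (fun r => (alg.stopProb M Q (X r)).toReal) := by
          have h3 := (exploreChain M I hI μ h).avg_add s (fun r => alg.failProb M Q (X r))
            (fun r => (alg.stopProb M Q (X r)).toReal)
          simp only [SimAlgorithm.failProb, sub_add_cancel] at h3 ⊢
          rw [Chain.avg_const _ (show ¬ (exploreChain M I hI μ h).End s from hs)] at h3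
          linarith
        rw [h2]
        unfold SimAlgorithm.failProb
        linarith
      refine h1.trans (Chain.avg_mono _ hs fun r _ => ?_)
      refine (ih r.2 (r :: p) (by simp only [List.length_cons]; omega)).trans (le_of_eq ?_)
      simp only [List.reverse_cons, List.append_assoc, List.singleton_append]

theorem failProb_halt {μ : Memory S A} (hpath : μ.path = []) (hgoal : μ.goal = none)
    (hgap : μ.upper I I.init - μ.lower I I.init < ε) (hQ : Q μ) (s : S) :
    (algorithm I ε m ebar ℓ).failProb M Q (.running μ s) = 0 := by
  set alg := algorithm I ε m ebar ℓ with halg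
  have hdec : alg.decide μ s = PMF.pure .halt := by
    rw [halg]
    simp only [algorithm, hgoal, hpath, hgap, and_self, if_true]
  have hstep := alg.pmfExp_decide_le M Q μ s
  rw [hdec, pmfExp_pure] at hstep
  have h1 : alg.stopProb M Q (.running μ s) = 1 :=
    le_antisymm (alg.stopProb_le_one ..) (by rw [← alg.stopProb_stopped M Q hQ]; exact hstep)
  simp [SimAlgorithm.failProb, h1]

end Explore

/-! ### One update of an estimate -/

section Update

variable {S : Type u} {A : Type v} [DecidableEq S] [DecidableEq A]

/-- Invariants of the learning data at time `t`. -/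
structure Estimate.Sound (m t : ℕ) (e : Estimate S A) : Prop where
  acc_nonneg : ∀ q, 0 ≤ e.acc q
  acc_le : ∀ q, e.acc q ≤ e.cnt q
  cnt_lt : ∀ q, e.cnt q < m
  acc_off : ∀ q, e.learn q = false → e.acc q = 0
  cnt_off : ∀ q, e.learn q = false → e.cnt q = 0
  last_le : ∀ q, e.last q ≤ t
  star_le : e.star ≤ t
  val_nonneg : ∀ q, 0 ≤ e.val q
  val_le_one : ∀ q, e.val q ≤ 1

omit [DecidableEq S] [DecidableEq A] in
theorem Estimate.sound_fresh {m : ℕ} (hm : 0 < m) {f : S × A → ℝ} (h0 : ∀ q, 0 ≤ f q)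
    (h1 : ∀ q, f q ≤ 1) : (Estimate.fresh f).Sound m 0 where
  acc_nonneg _ := le_rfl
  acc_le _ := by simp [Estimate.fresh]
  cnt_lt _ := hm
  acc_off _ _ := rfl
  cnt_off _ _ := rfl
  last_le _ := le_rfl
  star_le := le_rfl
  val_nonneg := h0
  val_le_one := h1

/-- The average of the samples at an update attempt. -/
noncomputable def Estimate.sampleAvg (m : ℕ) (e : Estimate S A) (q : S × A) (x : ℝ) : ℝ :=
  (e.acc q + x) / m

/-- The possible effects of an update. -/
inductive Estimate.Step (m : ℕ) (ebar sgn : ℝ) (wake t : ℕ) (q : S × A) (x : ℝ)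
    (e : Estimate S A) : Estimate S A → Prop
  | cont (h1 : e.learn q = true) (h2 : e.cnt q + 1 ≠ m) : Step m ebar sgn wake t q x e
      { e with
        acc := Function.update e.acc q (e.acc q + x)
        cnt := Function.update e.cnt q (e.cnt q + 1) }
  | success (h1 : e.learn q = true) (h2 : e.cnt q + 1 = m)
      (h3 : 2 * ebar ≤ sgn * (e.val q - e.sampleAvg m q x)) : Step m ebar sgn wake t q x e
      { e with
        acc := Function.update e.acc q 0
        cnt := Function.update e.cnt q 0
        last := Function.update e.last q t
        val := Function.update e.val q (e.sampleAvg m q x + sgn * ebar)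
        star := t }
  | settle (h1 : e.learn q = true) (h2 : e.cnt q + 1 = m)
      (h3 : sgn * (e.val q - e.sampleAvg m q x) < 2 * ebar) (h4 : e.star ≤ e.last q) :
      Step m ebar sgn wake t q x e
      { e with
        acc := Function.update e.acc q 0
        cnt := Function.update e.cnt q 0
        last := Function.update e.last q t
        learn := Function.update e.learn q false }
  | retry (h1 : e.learn q = true) (h2 : e.cnt q + 1 = m)
      (h3 : sgn * (e.val q - e.sampleAvg m q x) < 2 * ebar) (h4 : e.last q < e.star) :
      Step m ebar sgn wake t q x e
      { e with
        acc := Function.update e.acc q 0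
        cnt := Function.update e.cnt q 0
        last := Function.update e.last q t }
  | wake (h1 : e.learn q = false) (h2 : e.last q < wake) : Step m ebar sgn wake t q x e
      { e with learn := Function.update e.learn q true }
  | idle (h1 : e.learn q = false) (h2 : wake ≤ e.last q) : Step m ebar sgn wake t q x e e

theorem Estimate.step_update (m : ℕ) (ebar sgn : ℝ) (wake t : ℕ) (q : S × A) (x : ℝ)
    (e : Estimate S A) : e.Step m ebar sgn wake t q x (e.update m ebar sgn wake t q x) := by
  unfold Estimate.update
  dsimp only
  split_ifs with h1 h2 h3 h4 h5
  · exact .success h1 h2 h3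
  · exact .settle h1 h2 (not_le.1 h3) h4
  · exact .retry h1 h2 (not_le.1 h3) (not_le.1 h4)
  · exact .cont h1 h2
  · exact .wake (by simpa using h1) h5
  · exact .idle (by simpa using h1) (not_lt.1 h5)

variable {m : ℕ} {ebar sgn : ℝ} {wake t : ℕ} {q : S × A} {x : ℝ} {e e' : Estimate S A}

theorem Estimate.Sound.sampleAvg_mem (h : e.Sound m t) (hx0 : 0 ≤ x) (hx1 : x ≤ 1)
    (hm : e.cnt q + 1 = m) : 0 ≤ e.sampleAvg m q x ∧ e.sampleAvg m q x ≤ 1 := by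
  have hm0 : (0 : ℝ) < m := by rw [← hm]; positivity
  have h1 := h.acc_nonneg q
  have h2 := h.acc_le q
  unfold Estimate.sampleAvg
  constructor
  · positivity
  · rw [div_le_one hm0, ← hm]
    push_cast; linarith

theorem Estimate.Step.sound (hs : e.Step m ebar sgn wake (t + 1) q x e') (h : e.Sound m t)
    (hx0 : 0 ≤ x) (hx1 : x ≤ 1) (he : 0 < ebar) (hsgn : sgn = 1 ∨ sgn = -1) :
    e'.Sound m (t + 1) := by
  have hm : 0 < m := (Nat.zero_le _).trans_lt (h.cnt_lt q)
  cases hs with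
  | cont h1 h2 =>
    refine ⟨fun p => ?_, fun p => ?_, fun p => ?_, fun p hp => ?_, fun p hp => ?_,
      fun p => (h.last_le p).trans (Nat.le_succ t), h.star_le.trans (Nat.le_succ t), h.val_nonneg,
      h.val_le_one⟩
    · by_cases hpq : p = q
      · subst hpq; simpa using add_nonneg (h.acc_nonneg p) hx0
      · simpa [hpq] using h.acc_nonneg p
    · by_cases hpq : p = q
      · subst hpq; simpa using add_le_add (h.acc_le p) hx1
      · simpa [hpq] using h.acc_le p
    · by_cases hpq : p = q
      · subst hpq
        have := h.cnt_lt p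
        simp only [Function.update_self]; omega
      · simpa [hpq] using h.cnt_lt p
    · have hpq : p ≠ q := by rintro rfl; exact absurd (h1.symm.trans hp) (by simp)
      simpa [hpq] using h.acc_off p hp
    · have hpq : p ≠ q := by rintro rfl; exact absurd (h1.symm.trans hp) (by simp)
      simpa [hpq] using h.cnt_off p hp
  | success h1 h2 h3 =>
    obtain ⟨ha0, ha1⟩ := h.sampleAvg_mem hx0 hx1 h2
    refine ⟨fun p => ?_, fun p => ?_, fun p => ?_, fun p hp => ?_, fun p hp => ?_,
      fun p => ?_, le_rfl, fun p => ?_, fun p => ?_⟩ <;> by_cases hpq : p = q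
    all_goals first
      | subst hpq; simp only [Function.update_self]
      | simp only [Function.update_of_ne, ne_eq, hpq, not_false_eq_true]
    all_goals first
      | exact le_rfl
      | exact h.acc_nonneg _
      | exact h.acc_le _
      | exact h.cnt_lt _
      | exact h.acc_off _ hp
      | exact h.cnt_off _ hp
      | exact (h.last_le _).trans (Nat.le_succ t)
      | exact h.val_nonneg _
      | exact h.val_le_one _
      | skip
    · simp
    · exact hm
    · have := h.val_nonneg p
      rcases hsgn with rfl | rfl <;> linarith
    · have := h.val_le_one p
      rcases hsgn with rfl | rfl <;> linarith
  | settle h1 h2 h3 h4 =>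
    refine ⟨fun p => ?_, fun p => ?_, fun p => ?_, fun p hp => ?_, fun p hp => ?_,
      fun p => ?_, h.star_le.trans (Nat.le_succ t), h.val_nonneg, h.val_le_one⟩ <;>
      by_cases hpq : p = q
    all_goals first
      | subst hpq; simp only [Function.update_self]
      | simp only [Function.update_of_ne, ne_eq, hpq, not_false_eq_true]
    all_goals first
      | exact le_rfl
      | exact h.acc_nonneg _
      | exact h.acc_le _
      | exact h.cnt_lt _
      | exact h.acc_off _ (by simpa [hpq] using hp)
      | exact h.cnt_off _ (by simpa [hpq] using hp)
      | exact (h.last_le _).trans (Nat.le_succ t)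
      | skip
    · simp
    · exact hm
  | retry h1 h2 h3 h4 =>
    refine ⟨fun p => ?_, fun p => ?_, fun p => ?_, fun p hp => ?_, fun p hp => ?_,
      fun p => ?_, h.star_le.trans (Nat.le_succ t), h.val_nonneg, h.val_le_one⟩ <;>
      by_cases hpq : p = q
    all_goals first
      | subst hpq; simp only [Function.update_self]
      | simp only [Function.update_of_ne, ne_eq, hpq, not_false_eq_true]
    all_goals first
      | exact le_rfl
      | exact h.acc_nonneg _
      | exact h.acc_le _
      | exact h.cnt_lt _
      | exact h.acc_off _ hp
      | exact h.cnt_off _ hp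
      | exact (h.last_le _).trans (Nat.le_succ t)
      | skip
    · simp
    · exact hm
  | wake h1 h2 =>
    refine ⟨h.acc_nonneg, h.acc_le, h.cnt_lt, fun p hp => ?_, fun p hp => ?_,
      fun p => (h.last_le p).trans (Nat.le_succ t), h.star_le.trans (Nat.le_succ t), h.val_nonneg,
      h.val_le_one⟩ <;> by_cases hpq : p = q
    · subst hpq; simp at hp
    · exact h.acc_off p (by simpa [hpq] using hp)
    · subst hpq; simp at hp
    · exact h.cnt_off p (by simpa [hpq] using hp)
  | idle h1 h2 =>
    exact ⟨h.acc_nonneg, h.acc_le, h.cnt_lt, h.acc_off, h.cnt_off,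
      fun p => (h.last_le p).trans (Nat.le_succ t), h.star_le.trans (Nat.le_succ t), h.val_nonneg,
      h.val_le_one⟩

/-- A step for `q` does not affect the data of other pairs. -/
theorem Estimate.Step.other (hs : e.Step m ebar sgn wake t q x e') {p : S × A} (hp : p ≠ q) :
    e'.val p = e.val p ∧ e'.acc p = e.acc p ∧ e'.cnt p = e.cnt p ∧ e'.last p = e.last p ∧
      e'.learn p = e.learn p := by
  cases hs <;> simp [hp]

/-- Either a step is successful and marks its time, or it leaves all values unchanged. -/
theorem Estimate.Step.star (hs : e.Step m ebar sgn wake t q x e') :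
    e'.star = t ∨ (e'.star = e.star ∧ e'.val = e.val) := by
  cases hs <;> simp

open Classical in
/-- A bound for the number of successful updates that are still possible. -/
noncomputable def Estimate.room (P : Finset (S × A)) (ebar sgn : ℝ) (e : Estimate S A) : ℝ :=
  ∑ q ∈ P, (sgn * e.val q + (1 - sgn) / 2) / ebar

omit [DecidableEq S] [DecidableEq A] in
theorem Estimate.Sound.room_nonneg (h : e.Sound m t) (P : Finset (S × A)) (he : 0 < ebar)
    (hsgn : sgn = 1 ∨ sgn = -1) : 0 ≤ e.room P ebar sgn :=
  Finset.sum_nonneg fun p _ => by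
    have h0 := h.val_nonneg p
    have h1 := h.val_le_one p
    refine div_nonneg ?_ he.le
    rcases hsgn with rfl | rfl <;> linarith

omit [DecidableEq S] [DecidableEq A] in
theorem Estimate.Sound.room_le (h : e.Sound m t) (P : Finset (S × A)) (he : 0 < ebar)
    (hsgn : sgn = 1 ∨ sgn = -1) : e.room P ebar sgn ≤ P.card / ebar := by
  rw [div_eq_mul_inv, ← nsmul_eq_mul]
  refine Finset.sum_le_card_nsmul _ _ _ fun p _ => ?_
  have h0 := h.val_nonneg p
  have h1 := h.val_le_one p
  rw [← one_div]
  refine div_le_div_of_nonneg_right ?_ he.le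
  rcases hsgn with rfl | rfl <;> linarith

/-- A success finds the estimate at least `2 * ebar` from the average and stops `ebar` short of it,
so the estimate moves by at least `ebar`, which is one unit of `room`. -/
theorem Estimate.Step.room (hs : e.Step m ebar sgn wake t q x e') {P : Finset (S × A)} (hq : q ∈ P)
    (he : 0 < ebar) (hsgn : sgn = 1 ∨ sgn = -1) :
    (e'.star = t ∧ e'.room P ebar sgn ≤ e.room P ebar sgn - 1) ∨
      (e'.star = e.star ∧ e'.val = e.val ∧ e'.room P ebar sgn = e.room P ebar sgn) := by
  cases hs with
  | success h1 h2 h3 =>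
    refine Or.inl ⟨rfl, ?_⟩
    unfold Estimate.room
    rw [← Finset.add_sum_erase _ _ hq, ← Finset.add_sum_erase P (fun q => (sgn * e.val q + _) / _) hq]
    have h4 : ∀ p ∈ P.erase q, (sgn * (Function.update e.val q (e.sampleAvg m q x + sgn * ebar)) p +
        (1 - sgn) / 2) / ebar = (sgn * e.val p + (1 - sgn) / 2) / ebar := by
      intro p hp
      rw [Function.update_of_ne (Finset.mem_erase.1 hp).1]
    dsimp only
    rw [Finset.sum_congr rfl h4, Function.update_self]
    have h5 : (sgn * (e.sampleAvg m q x + sgn * ebar) + (1 - sgn) / 2) / ebar ≤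
        (sgn * e.val q + (1 - sgn) / 2) / ebar - 1 := by
      rw [div_le_iff₀ he, sub_mul, div_mul_cancel₀ _ he.ne']
      rcases hsgn with rfl | rfl <;> linarith
    linarith
  | cont h1 h2 => exact Or.inr ⟨rfl, rfl, rfl⟩
  | settle h1 h2 h3 h4 => exact Or.inr ⟨rfl, rfl, rfl⟩
  | retry h1 h2 h3 h4 => exact Or.inr ⟨rfl, rfl, rfl⟩
  | wake h1 h2 => exact Or.inr ⟨rfl, rfl, rfl⟩
  | idle h1 h2 => exact Or.inr ⟨rfl, rfl, rfl⟩

open Classical in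
/-- A bound for the number of sample windows for `q` that can still be begun before the next
successful update. -/
noncomputable def Estimate.pending (e : Estimate S A) (wake : ℕ) (q : S × A) : ℝ :=
  -- The first term is a repetition of an attempt made before the last success, the second the
  -- waking of a pair that has stopped learning. Each can happen once.
  (if e.last q < e.star then 1 else 0) + (if e.learn q = false ∧ e.last q < wake then 1 else 0)

omit [DecidableEq S] [DecidableEq A] in
theorem Estimate.pending_nonneg (e : Estimate S A) (wake : ℕ) (q : S × A) :
    0 ≤ e.pending wake q := by
  unfold Estimate.pending
  split_ifs <;> norm_num

omit [DecidableEq S] [DecidableEq A] in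
theorem Estimate.pending_le (e : Estimate S A) (wake : ℕ) (q : S × A) :
    e.pending wake q ≤ 2 := by
  unfold Estimate.pending
  split_ifs <;> norm_num

/-- A success can renew both pending windows of every pair, hence the factor 2 of the room `N`. A
success of the partner bound can only wake pairs, hence the factor 1 of `K`. -/
theorem Estimate.Step.budget_other (hs : e.Step m ebar sgn wake (t + 1) q x e')
    {N N' K K' : ℝ} {y y' : ℕ} (hN : (e'.star = t + 1 ∧ N' ≤ N - 1) ∨ (e'.star = e.star ∧ N' = N))
    (hK : K' ≤ K - 1 ∨ (K' = K ∧ y' = y)) {p : S × A} (hp : p ≠ q) :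
    2 * N' + K' + e'.pending (max e'.star y') p ≤ 2 * N + K + e.pending (max e.star y) p := by
  obtain ⟨_, _, _, h4, h5⟩ := hs.other hp
  have h0 := e.pending_nonneg (max e.star y) p
  rcases hN with ⟨_, hN⟩ | ⟨h6, hN⟩
  · have h1 := e'.pending_le (max e'.star y') p
    rcases hK with hK | ⟨hK, _⟩ <;> linarith
  · rcases hK with hK | ⟨hK, hy⟩
    · have : e'.pending (max e'.star y') p ≤ e.pending (max e.star y) p + 1 := by
        unfold Estimate.pending
        rw [h4, h5, h6]
        split_ifs <;> norm_num
      linarith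
    · have : e'.pending (max e'.star y') p = e.pending (max e.star y) p := by
        unfold Estimate.pending
        rw [h4, h5, h6, hy]
      linarith

/-- The effect of a step on the sample window of its pair: the window goes on, a new window begins and
uses up the budget, the pair stops learning, or nothing happens. -/
theorem Estimate.Step.budget_self (hs : e.Step m ebar sgn (max e.star y') (t + 1) q x e')
    (h : e.Sound m t) {N N' K K' : ℝ} {y : ℕ} (hyy : y ≤ y') (hy : y' ≤ t + 1)
    (hN : (e'.star = t + 1 ∧ N' ≤ N - 1) ∨ (e'.star = e.star ∧ N' = N))
    (hK : K' ≤ K - 1 ∨ (K' = K ∧ y' = y)) :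
    2 * N' + K' + e'.pending (max e'.star y') q ≤ 2 * N + K + e.pending (max e.star y) q ∧
    ((e.learn q = true ∧ e.cnt q + 1 < m ∧ e'.learn q = true ∧ e'.cnt q = e.cnt q + 1 ∧
        e'.acc q = e.acc q + x ∧ e'.last q = e.last q ∧ e'.star = e.star ∧ e'.val = e.val) ∨
      ((e.learn q = true → e.cnt q + 1 = m) ∧ e'.learn q = true ∧ e'.cnt q = 0 ∧ e'.acc q = 0 ∧
        2 * N' + K' + e'.pending (max e'.star y') q ≤
          2 * N + K + e.pending (max e.star y) q - 1) ∨
      (e.learn q = true ∧ e.cnt q + 1 = m ∧ e'.learn q = false) ∨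
      (e.learn q = false ∧ max e.star y' ≤ e.last q ∧ e' = e)) := by
  have h0 := e.pending_nonneg (max e.star y) q
  have hlast := h.last_le q
  have hstar := h.star_le
  have hK' : K' ≤ K := by rcases hK with hK | ⟨hK, _⟩ <;> linarith
  cases hs with
  | cont h1 h2 =>
    have hN' : N' = N ∨ N' ≤ N - 1 := by rcases hN with ⟨_, hN⟩ | ⟨_, hN⟩ <;> tauto
    have hN'' : N' ≤ N := by rcases hN' with hN' | hN' <;> linarith
    refine ⟨?_, Or.inl ⟨h1, ?_, h1, ?_, ?_, rfl, rfl, rfl⟩⟩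
    · have : ∀ z : ℕ, Estimate.pending { e with
          acc := Function.update e.acc q (e.acc q + x)
          cnt := Function.update e.cnt q (e.cnt q + 1) } z q = e.pending (max e.star y) q := by
        intro z
        simp [Estimate.pending, h1]
      rw [this]; linarith
    · have := h.cnt_lt q; omega
    · simp
    · simp
  | success h1 h2 h3 =>
    have hN' : N' ≤ N - 1 := by
      rcases hN with ⟨_, hN⟩ | ⟨h5, hN⟩
      · exact hN
      · simp only at h5; omega
    set e₁ : Estimate S A := { e with
        acc := Function.update e.acc q 0
        cnt := Function.update e.cnt q 0
        last := Function.update e.last q (t + 1)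
        val := Function.update e.val q (e.sampleAvg m q x + sgn * ebar)
        star := t + 1 } with he₁
    have : ∀ z : ℕ, e₁.pending z q = 0 := by
      intro z
      simp [Estimate.pending, h1, he₁]
    have h9 : 2 * N' + K' + e₁.pending (max e₁.star y') q ≤
        2 * N + K + e.pending (max e.star y) q - 1 := by rw [this]; linarith
    exact ⟨by linarith, Or.inr (Or.inl ⟨fun _ => h2, h1, by simp [he₁], by simp [he₁], h9⟩)⟩
  | settle h1 h2 h3 h4 =>
    have hN' : N' ≤ N := by rcases hN with ⟨_, hN⟩ | ⟨_, hN⟩ <;> linarith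
    refine ⟨?_, Or.inr (Or.inr (Or.inl ⟨h1, h2, by simp⟩))⟩
    have hle : max e.star y' ≤ t + 1 := max_le (by omega) hy
    have : Estimate.pending { e with
        acc := Function.update e.acc q 0
        cnt := Function.update e.cnt q 0
        last := Function.update e.last q (t + 1)
        learn := Function.update e.learn q false } (max e.star y') q = 0 := by
      simp only [Estimate.pending, Function.update_self]
      rw [if_neg (by omega), if_neg (fun hh => absurd hh.2 (not_lt.2 hle)), add_zero]
    simp only at this ⊢
    rw [this]; linarith
  | retry h1 h2 h3 h4 =>
    have hN' : N' ≤ N := by rcases hN with ⟨_, hN⟩ | ⟨_, hN⟩ <;> linarith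
    set e₁ : Estimate S A := { e with
        acc := Function.update e.acc q 0
        cnt := Function.update e.cnt q 0
        last := Function.update e.last q (t + 1) } with he₁
    have h5 : ∀ z : ℕ, e₁.pending z q = 0 := by
      intro z
      simp only [Estimate.pending, Function.update_self, h1, he₁]
      rw [if_neg (by omega), if_neg (by simp), add_zero]
    have h6 : e.pending (max e.star y) q = 1 := by
      simp [Estimate.pending, h1, h4]
    have h9 : 2 * N' + K' + e₁.pending (max e₁.star y') q ≤
        2 * N + K + e.pending (max e.star y) q - 1 := by rw [h5, h6]; linarith
    exact ⟨by linarith, Or.inr (Or.inl ⟨fun _ => h2, h1, by simp [he₁], by simp [he₁], h9⟩)⟩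
  | wake h1 h2 =>
    have hN' : N' ≤ N := by rcases hN with ⟨_, hN⟩ | ⟨_, hN⟩ <;> linarith
    set e₁ : Estimate S A := { e with learn := Function.update e.learn q true } with he₁
    have h5 : ∀ z, e₁.pending z q = if e.last q < e.star then 1 else 0 := by
      intro z
      simp [Estimate.pending, he₁]
    have h6 : e.pending (max e.star y) q = (if e.last q < e.star then 1 else 0) +
        (if e.last q < max e.star y then 1 else 0) := by
      simp [Estimate.pending, h1]
    have h9 : 2 * N' + K' + e₁.pending (max e₁.star y') q ≤
        2 * N + K + e.pending (max e.star y) q - 1 := by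
      rw [h5, h6]
      by_cases h7 : e.last q < max e.star y
      · rw [if_pos h7]; linarith
      · rw [if_neg h7]
        rcases hK with hK | ⟨_, hK⟩
        · linarith
        · rw [hK] at h2; exact absurd h2 h7
    exact ⟨by linarith, Or.inr (Or.inl ⟨fun h8 => absurd (h1.symm.trans h8) (by simp), by simp [he₁],
      h.cnt_off q h1, h.acc_off q h1, h9⟩)⟩
  | idle h1 h2 =>
    have hN' : N' ≤ N := by rcases hN with ⟨_, hN⟩ | ⟨_, hN⟩ <;> linarith
    refine ⟨?_, Or.inr (Or.inr (Or.inr ⟨h1, h2, rfl⟩))⟩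
    have h5 : e.pending (max e.star y') q = e.pending (max e.star y) q := by
      unfold Estimate.pending
      have : ¬ e.last q < max e.star y := by
        have : max e.star y ≤ max e.star y' := max_le_max le_rfl hyy
        omega
      rw [if_neg (show ¬ (e.learn q = false ∧ e.last q < max e.star y') from fun h => absurd h.2 (not_lt.2 h2)),
        if_neg (show ¬ (e.learn q = false ∧ e.last q < max e.star y) from fun h => this h.2)]
    rw [h5]; linarith

end Update

namespace Chain

variable {Q : Type u} {S : Type v} [Fintype S] (c : Chain Q S)

/-! ### Windows of samples on a path -/

variable {c} in
theorem IsPath.mem_acts : ∀ {s : S} {l : List (Q × S)}, c.IsPath s l → ∀ r ∈ l, r.1 ∈ c.acts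
  | _, [], _, _, hr => by simp at hr
  | _, _ :: _, h, r, hr => by
    rcases List.mem_cons.1 hr with rfl | hr
    · exact h.1.2.1
    · exact h.2.mem_acts r hr

open Classical in
/-- The number of occurrences of `q₀` on a path. -/
noncomputable def occ (q₀ : Q) : List (Q × S) → ℕ
  | [] => 0
  | r :: l => if r.1 = q₀ then occ q₀ l + 1 else occ q₀ l

open Classical in
/-- Whether `q₀` has occurred exactly `k` times. -/
noncomputable def reached (q₀ : Q) (k : ℕ) (l : List (Q × S)) : ℝ := if occ q₀ l = k then 1 else 0

/-- The decrease of `R` in the first transition of a path. -/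
noncomputable def decrease (R : List (Q × S) → ℝ) : List (Q × S) → ℝ
  | [] => 0
  | r :: l => max 0 (R l - R (r :: l))

theorem reached_nonneg (q₀ : Q) (k : ℕ) (l : List (Q × S)) : 0 ≤ reached q₀ k l := by
  unfold reached; split_ifs <;> norm_num

theorem decrease_nonneg (R : List (Q × S) → ℝ) (l : List (Q × S)) : 0 ≤ decrease R l := by
  cases l with
  | nil => exact le_rfl
  | cons r l => exact le_max_left _ _

/-- The decreases telescope, and those at `q₀` are only a part of them. -/
theorem excess_one_decrease_le (q₀ : Q) {R : List (Q × S) → ℝ}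
    (hR : ∀ r l, (∀ p ∈ r :: l, p.1 ∈ c.acts) → R (r :: l) ≤ R l) :
    ∀ l : List (Q × S), (∀ p ∈ l, p.1 ∈ c.acts) → excess q₀ 1 (decrease R) l ≤ R [] - R l
  | [], _ => by simp [excess]
  | r :: l, hl => by
    have ih := excess_one_decrease_le q₀ hR l fun p hp => hl p (List.mem_cons_of_mem _ hp)
    have h1 := hR r l hl
    rw [excess, decrease, max_eq_right (by linarith)]
    split_ifs <;> linarith

-- Counted from the end of the path, there is at most one occurrence with number `k`.
open Classical in
theorem excess_one_reached (q₀ : Q) (k : ℕ) (l : List (Q × S)) :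
    excess q₀ 1 (reached q₀ k) l = if 0 < k ∧ k ≤ occ q₀ l then 1 else 0 := by
  induction l with
  | nil => rw [excess, occ, if_neg]; omega
  | cons r l ih =>
    rw [excess, ih]
    by_cases h : r.1 = q₀
    · rw [if_pos h]
      simp only [reached, occ, h, if_true]
      by_cases h1 : occ q₀ l + 1 = k
      · rw [if_neg (by omega), if_pos h1, if_pos (by omega)]; norm_num
      · rw [if_neg h1, one_mul, add_zero]
        refine if_congr ?_ rfl rfl
        omega
    · rw [if_neg h, occ, if_neg h]

/-- A supermartingale in forward time. The product does not depend on the order of its factors, so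
it can be used for samples that are processed backwards. -/
theorem expect_weight_le_one (q₀ : Q) {φ : S → ℝ} (hφ0 : ∀ s, 0 ≤ φ s)
    (hφ1 : ∑ s', c.D q₀ s' * φ s' ≤ 1) (n : ℕ) (s : S) :
    c.expect n s (weight q₀ φ) (weight q₀ φ) ≤ 1 := by
  classical
  induction n generalizing s with
  | zero => exact le_rfl
  | succ n ih =>
    rw [expect]
    split_ifs with hs
    · exact le_rfl
    · have h1 : ∀ r : Q × S, c.expect n r.2 (fun l => weight q₀ φ (r :: l))
          (fun l => weight q₀ φ (r :: l)) ≤ if r.1 = q₀ then φ r.2 else 1 := by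
        intro r
        simp only [weight]
        rw [c.expect_mul]
        refine mul_le_of_le_one_right ?_ (ih _)
        split_ifs
        exacts [hφ0 _, zero_le_one]
      refine (c.avg_mono hs fun r _ => h1 r).trans ?_
      refine le_trans ?_ (c.pol_sum s hs).le
      rw [avg]
      refine Finset.sum_le_sum fun q hq => mul_le_of_le_one_right (c.pol_nonneg s q) ?_
      by_cases hqq : q = q₀
      · subst hqq; simpa using hφ1
      · simpa [hqq] using (c.D_sum q hq).le

open Classical in
/-- The expected contribution of the windows of `q₀`: an initial window with value `W₀` that lasts for
`k` samples, and new windows that are paid for by the decrease of `R`. -/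
theorem expect_window_le (q₀ : Q) {φ : S → ℝ} {w η : ℝ} (hw : 1 ≤ w) (hη : 0 < η)
    (hwη : 2 * (w - 1) * w ≤ η) (hφ : ∀ s, w⁻¹ ≤ φ s) (hφ1 : ∑ s', c.D q₀ s' * φ s' ≤ 1)
    (hD : ∑ s', c.D q₀ s' ≤ 1) (halt : c.EndAlternative q₀ η) {R : List (Q × S) → ℝ}
    (hR : ∀ r l, (∀ p ∈ r :: l, p.1 ∈ c.acts) → R (r :: l) ≤ R l) {W₀ : ℝ} (hW₀ : 0 ≤ W₀)
    (k n : ℕ) (s : S) :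
    c.expect n s (fun l => 2 * (if occ q₀ l < k then W₀ * weight q₀ φ l else 0) +
        W₀ * weight q₀ φ l * excess q₀ w (reached q₀ k) l + 2 * excess q₀ w (decrease R) l + 4 * R l)
      (fun _ => 4 * R []) ≤ 2 * W₀ + 4 * R [] := by
  have hw0 : 0 < w := lt_of_lt_of_le one_pos hw
  have hφ0 : ∀ s, 0 ≤ φ s := fun s => (inv_pos.2 hw0).le.trans (hφ s)
  have h1 := c.expect_excess_le q₀ hw hη hwη hφ hφ1 halt (reached_nonneg q₀ k) n s
  have h2 := c.expect_excess_le q₀ hw hη hwη (φ := fun _ => 1) (fun _ => inv_le_one_of_one_le₀ hw)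
    (by simpa using hD) halt (decrease_nonneg R) n s
  have hone : ∀ l : List (Q × S), weight q₀ (fun _ => 1) l = 1 := by
    intro l
    induction l with
    | nil => rfl
    | cons r l ih => rw [weight, ih]; simp
  simp only [hone, one_mul] at h2
  have h3 := c.expect_weight_le_one q₀ hφ0 hφ1 n s
  set E₁ := c.expect n s (fun l => if occ q₀ l < k then weight q₀ φ l else 0) (fun _ => 0) with hE₁
  set E₂ := c.expect n s (fun l => weight q₀ φ l * excess q₀ w (reached q₀ k) l) (fun _ => 0)
  set E₂' := c.expect n s (fun l => weight q₀ φ l * excess q₀ 1 (reached q₀ k) l) (fun _ => 0) with hE₂'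
  set E₃ := c.expect n s (fun l => excess q₀ w (decrease R) l) (fun _ => 0)
  set E₃' := c.expect n s (fun l => excess q₀ 1 (decrease R) l) (fun _ => 0) with hE₃'
  set E₄ := c.expect n s R (fun _ => R []) with hE₄
  have h4 : c.expect n s (fun l => 2 * (if occ q₀ l < k then W₀ * weight q₀ φ l else 0) +
        W₀ * weight q₀ φ l * excess q₀ w (reached q₀ k) l + 2 * excess q₀ w (decrease R) l + 4 * R l)
      (fun _ => 4 * R []) = 2 * W₀ * E₁ + W₀ * E₂ + 2 * E₃ + 4 * E₄ := by
    simp only [hE₁, E₂, E₃, hE₄, ← expect_mul, ← expect_add]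
    refine c.expect_congr n s (fun l _ _ _ => ?_) fun l _ _ => by ring
    split_ifs <;> ring
  -- Either the initial window is still open when the whole path has been processed, or it is
  -- completed at exactly one suffix; the weight is counted once in both cases.
  have h5 : E₁ + E₂' ≤ 1 := by
    rw [hE₁, hE₂', ← expect_add]
    refine le_trans (c.expect_mono n s (fun l _ _ _ => ?_) fun l _ _ => ?_) h3
    · rw [excess_one_reached]
      have := weight_nonneg q₀ hφ0 l
      split_ifs
      · omega
      · simp
      · simp
      · simpa using this
    · simpa using weight_nonneg q₀ hφ0 l
  have h6 : E₃' + E₄ ≤ R [] := by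
    rw [hE₃', hE₄, ← expect_add]
    refine le_trans (c.expect_mono n s (gT' := fun _ => R []) (gC' := fun _ => R [])
      (fun l hl _ _ => ?_) fun l _ _ => ?_) (c.expect_const n s _).le
    · have := c.excess_one_decrease_le q₀ hR l hl.mem_acts
      linarith
    · simp
  -- With the factors 2 of `h1` and `h2`, the sum is at most `2 * W₀ * (E₁ + E₂') + 4 * (E₃' + E₄)`;
  -- this explains the coefficients in the statement.
  rw [h4]
  nlinarith [mul_le_mul_of_nonneg_left h1 hW₀, mul_le_mul_of_nonneg_left h5 hW₀]

theorem excess_le_cons (q₀ : Q) {w : ℝ} (hw : 1 ≤ w) {g : List (Q × S) → ℝ} (hg : ∀ l, 0 ≤ g l)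
    (r : Q × S) (l : List (Q × S)) : excess q₀ w g l ≤ excess q₀ w g (r :: l) := by
  rw [excess]
  have h0 := excess_nonneg q₀ (zero_le_one.trans hw) hg l
  split_ifs
  · nlinarith [hg (r :: l)]
  · exact le_rfl

/-- A further sample can shrink the weight by at most `w⁻¹`, for which the factor `w` in `excess`
makes up. So what has been recorded at a suffix is not lost when the path is extended. -/
theorem weight_excess_le_cons (q₀ : Q) {w : ℝ} (hw : 1 ≤ w) {φ : S → ℝ} (hφ : ∀ s, w⁻¹ ≤ φ s)
    {g : List (Q × S) → ℝ} (hg : ∀ l, 0 ≤ g l) (r : Q × S) (l : List (Q × S)) :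
    weight q₀ φ l * excess q₀ w g l ≤ weight q₀ φ (r :: l) * excess q₀ w g (r :: l) := by
  have hw0 : 0 < w := lt_of_lt_of_le one_pos hw
  have hφ0 : ∀ s, 0 ≤ φ s := fun s => (inv_pos.2 hw0).le.trans (hφ s)
  have h0 := excess_nonneg q₀ hw0.le hg l
  have h1 := weight_nonneg q₀ hφ0 l
  rw [excess, weight]
  split_ifs
  · have h2 : 1 ≤ φ r.2 * w := by
      rw [← inv_mul_cancel₀ hw0.ne']; exact mul_le_mul_of_nonneg_right (hφ r.2) hw0.le
    have h3 := hg (r :: l)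
    have h4 : weight q₀ φ l * excess q₀ w g l * 1 ≤ weight q₀ φ l * excess q₀ w g l * (φ r.2 * w) :=
      mul_le_mul_of_nonneg_left h2 (mul_nonneg h1 h0)
    have h5 : 0 ≤ φ r.2 * weight q₀ φ l * g (r :: l) := mul_nonneg (mul_nonneg (hφ0 _) h1) h3
    linarith
  · rw [one_mul]

end Chain

/-! ### Exponential tilts -/

section Tilt

variable {S : Type u} {A : Type v} [Fintype S]

/-- The expectation of `f` at the successor of a pair. -/
noncomputable def mean (M : MDP S A) (q : S × A) (f : S → ℝ) : ℝ :=
  ∑ s', (M.Δ q.1 q.2 s').toReal * f s'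

theorem mean_mono (M : MDP S A) (q : S × A) {f g : S → ℝ} (h : ∀ s, f s ≤ g s) :
    mean M q f ≤ mean M q g :=
  Finset.sum_le_sum fun s _ => mul_le_mul_of_nonneg_left (h s) ENNReal.toReal_nonneg

theorem mean_const (M : MDP S A) (q : S × A) (a : ℝ) : mean M q (fun _ => a) = a := by
  rw [mean, ← Finset.sum_mul, sum_toReal_pmf, one_mul]

/-- The exponential tilt of the successor distribution of `q`, in direction `z`. -/
noncomputable def tilt (M : MDP S A) (z lam : ℝ) (q : S × A) (f : S → ℝ) (s' : S) : ℝ :=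
  Real.exp (z * lam * (f s' - mean M q f) - lam ^ 2 / 8)

/-- An upper bound for the exponential tilts. -/
noncomputable def tiltMax (lam : ℝ) : ℝ := Real.exp (lam + lam ^ 2 / 8)

theorem one_le_tiltMax {lam : ℝ} (h : 0 ≤ lam) : 1 ≤ tiltMax lam :=
  Real.one_le_exp (by positivity)

variable {M : MDP S A} {z lam : ℝ} {q : S × A} {f : S → ℝ}

theorem abs_tilt_arg (hz : z = 1 ∨ z = -1) (hl : 0 ≤ lam) (h0 : ∀ s, 0 ≤ f s) (h1 : ∀ s, f s ≤ 1)
    (s' : S) : |z * lam * (f s' - mean M q f)| ≤ lam := by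
  have h2 : |f s' - mean M q f| ≤ 1 := by
    have h3 := mean_mono M q h0
    have h4 := mean_mono M q h1
    rw [mean_const] at h3 h4
    have := h0 s'
    have := h1 s'
    rw [abs_le]
    constructor <;> linarith
  have h5 : |z| = 1 := by rcases hz with rfl | rfl <;> simp
  rw [abs_mul, abs_mul, h5, one_mul, abs_of_nonneg hl]
  exact mul_le_of_le_one_right hl h2

theorem tilt_le (hz : z = 1 ∨ z = -1) (hl : 0 ≤ lam) (h0 : ∀ s, 0 ≤ f s) (h1 : ∀ s, f s ≤ 1)
    (s' : S) : tilt M z lam q f s' ≤ tiltMax lam := by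
  have := (abs_le.1 (abs_tilt_arg (M := M) (q := q) hz hl h0 h1 s')).2
  refine Real.exp_le_exp.2 ?_
  nlinarith [sq_nonneg lam]

theorem le_tilt (hz : z = 1 ∨ z = -1) (hl : 0 ≤ lam) (h0 : ∀ s, 0 ≤ f s) (h1 : ∀ s, f s ≤ 1)
    (s' : S) : (tiltMax lam)⁻¹ ≤ tilt M z lam q f s' := by
  have := (abs_le.1 (abs_tilt_arg (M := M) (q := q) hz hl h0 h1 s')).1
  rw [tiltMax, ← Real.exp_neg]
  refine Real.exp_le_exp.2 ?_
  nlinarith [sq_nonneg lam]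

-- Hoeffding's lemma for a variable with values in [0, 1]; the term `lam ^ 2 / 8` normalises the
-- exponential moment.
open MeasureTheory ProbabilityTheory in
theorem sum_mul_tilt_le_one (hz : z = 1 ∨ z = -1) (h0 : ∀ s, 0 ≤ f s) (h1 : ∀ s, f s ≤ 1) :
    ∑ s', (M.Δ q.1 q.2 s').toReal * tilt M z lam q f s' ≤ 1 := by
  let _ : MeasurableSpace S := ⊤
  have : MeasurableSingletonClass S := ⟨fun _ => trivial⟩
  set p := M.Δ q.1 q.2
  have hsub := hasSubgaussianMGF_of_mem_Icc (X := f) (μ := p.toMeasure) (a := 0) (b := 1)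
    (measurable_of_finite f).aemeasurable (Filter.Eventually.of_forall fun s => ⟨h0 s, h1 s⟩)
  have hmean : ∫ s, f s ∂p.toMeasure = mean M q f := by
    rw [PMF.integral_eq_sum]; rfl
  have h := hsub.mgf_le (z * lam)
  rw [mgf, PMF.integral_eq_sum, hmean] at h
  have hz2 : z ^ 2 = 1 := by rcases hz with rfl | rfl <;> norm_num
  have h2 : (((‖(1 : ℝ) - 0‖₊ / 2) ^ 2 : NNReal) : ℝ) * (z * lam) ^ 2 / 2 = lam ^ 2 / 8 := by
    rw [mul_pow, hz2]
    push_cast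
    norm_num
    ring
  rw [h2] at h
  have h3 : ∑ s', (p s').toReal * tilt M z lam q f s' =
      (∑ s', (p s').toReal • Real.exp (z * lam * (f s' - mean M q f))) * Real.exp (-(lam ^ 2 / 8)) := by
    rw [Finset.sum_mul]
    refine Finset.sum_congr rfl fun s' _ => ?_
    rw [tilt, sub_eq_add_neg (z * lam * _), Real.exp_add, smul_eq_mul]
    ring
  rw [h3]
  calc _ ≤ Real.exp (lam ^ 2 / 8) * Real.exp (-(lam ^ 2 / 8)) :=
        mul_le_mul_of_nonneg_right h (Real.exp_nonneg _)
    _ = 1 := by rw [← Real.exp_add, add_neg_cancel, Real.exp_zero]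

end Tilt

/-! ### Bounds of the collapsed MDP -/

section Bounds

variable {S : Type u} {A : Type v} [Fintype S] [DecidableEq S] [DecidableEq A]

theorem maxOver_spec {T : Finset (S × A)} (hT : T.Nonempty) (f : S × A → ℝ) :
    ∃ q ∈ T, maxOver T f = f q ∧ ∀ p ∈ T, f p ≤ f q := by
  obtain ⟨q, hq, h⟩ := T.exists_mem_eq_sup' hT f
  refine ⟨q, hq, ?_, fun p hp => ?_⟩
  · rw [maxOver, dif_pos hT, h]
  · rw [← h]; exact Finset.le_sup' f hp

theorem le_maxOver {T : Finset (S × A)} {f : S × A → ℝ} {q : S × A} (hq : q ∈ T) :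
    f q ≤ maxOver T f := by
  obtain ⟨p, _, h1, h2⟩ := maxOver_spec ⟨q, hq⟩ f
  rw [h1]; exact h2 q hq

theorem maxOver_mem {T : Finset (S × A)} {f : S × A → ℝ} (h0 : ∀ q, 0 ≤ f q) (h1 : ∀ q, f q ≤ 1) :
    0 ≤ maxOver T f ∧ maxOver T f ≤ 1 := by
  rcases T.eq_empty_or_nonempty with rfl | hT
  · simp [maxOver]
  · obtain ⟨q, _, h, _⟩ := maxOver_spec hT f
    rw [h]; exact ⟨h0 q, h1 q⟩

/-- The learning data for the upper (`true`) or lower (`false`) bound. -/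
def Memory.est (μ : Memory S A) : Bool → Estimate S A
  | true => μ.U
  | false => μ.L

/-- The sign that belongs to the upper or lower bound. -/
def sgn : Bool → ℝ
  | true => 1
  | false => -1

theorem sgn_eq (b : Bool) : sgn b = 1 ∨ sgn b = -1 := by cases b <;> simp [sgn]

/-- The current upper or lower bound. -/
noncomputable def Memory.bound (I : LimitedInfo S A) (μ : Memory S A) (b : Bool) (s : S) : ℝ :=
  μ.nodeVal I (μ.est b).val (μ.cls s)

theorem Memory.nodeVal_mem (I : LimitedInfo S A) (μ : Memory S A) {f : S × A → ℝ}
    (h0 : ∀ q, 0 ≤ f q) (h1 : ∀ q, f q ≤ 1) (ξ : Node S) :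
    0 ≤ μ.nodeVal I f ξ ∧ μ.nodeVal I f ξ ≤ 1 := by
  cases ξ with
  | one => simp [Memory.nodeVal]
  | zero => simp [Memory.nodeVal]
  | block R => exact maxOver_mem h0 h1

variable {M : MDP S A} {F : Finset S} {I : LimitedInfo S A} {μ : Memory S A} {m : ℕ} {ebar : ℝ}

theorem Memory.bound_nonneg (h : ∀ b, (μ.est b).Sound m μ.time) (b : Bool) (s : S) :
    0 ≤ μ.bound I b s := (μ.nodeVal_mem I (h b).val_nonneg (h b).val_le_one _).1

theorem Memory.bound_le_one (h : ∀ b, (μ.est b).Sound m μ.time) (b : Bool) (s : S) :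
    μ.bound I b s ≤ 1 := (μ.nodeVal_mem I (h b).val_nonneg (h b).val_le_one _).2

/-- The two bounds are not symmetric: the upper one needs a remaining pair that attains the value of
the block, the lower one only that no pair exceeds it. -/
theorem Memory.bound_correct (hI : I.IsAbout M F) (h : Coherent M F μ.cls μ.inner) {b : Bool}
    (hA : ∀ q ∈ allPairs M.E, 0 ≤ sgn b * ((μ.est b).val q - valueAct M F q)) (s : S) :
    0 ≤ sgn b * (μ.bound I b s - value M F s) := by
  rw [Memory.bound]
  cases hs : μ.cls s with
  | one => simp [Memory.nodeVal, value_of_mem M F s ((h.one_iff s).1 hs)]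
  | zero => simp [Memory.nodeVal, h.zero s hs]
  | block R =>
    simp only [Memory.nodeVal, Memory.enabledAt, Node.states, hI.E_eq]
    cases b with
    | true =>
      obtain ⟨q, hq, h1⟩ := h.exists_value_le hs
      have h2 := hA q (mem_allPairs.2 (mem_available.1 hq).2.1)
      have h3 := le_maxOver (f := (μ.est true).val) hq
      simp only [sgn] at h2 ⊢
      linarith
    | false =>
      obtain ⟨q, hq, h1, _⟩ := maxOver_spec (h.avail s R hs) (μ.est false).val
      have h2 := hA q (mem_allPairs.2 (mem_available.1 hq).2.1)
      have h3 := h.valueAct_le hs hq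
      simp only [sgn] at h2 ⊢
      rw [h1]
      linarith

end Bounds

/-! ### One call of the update procedure -/

section MemoryUpdate

variable {S : Type u} {A : Type v} [Fintype S] [DecidableEq S] [DecidableEq A]

/-- The time of the last successful update of the upper bounds, if it matters for the bound. -/
def Memory.partner (μ : Memory S A) : Bool → ℕ
  | true => 0
  | false => μ.U.star

/-- The number of possible successful updates of the upper bounds, if it matters for the bound. -/
noncomputable def Memory.partnerRoom (P : Finset (S × A)) (ebar : ℝ) (μ : Memory S A) : Bool → ℝ
  | true => 0
  | false => μ.U.room P ebar 1

/-- A bound for the number of sample windows for `q` that can still be begun. -/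
noncomputable def Memory.budget (P : Finset (S × A)) (ebar : ℝ) (μ : Memory S A) (b : Bool)
    (q : S × A) : ℝ :=
  -- The pairs not yet removed pay for the windows begun afresh after a collapse; the other terms
  -- pay for those begun by updates.
  (P \ μ.inner).card + (2 * (μ.est b).room P ebar (sgn b) + μ.partnerRoom P ebar b +
    (μ.est b).pending (max (μ.est b).star (μ.partner b)) q)

variable {M : MDP S A} {F : Finset S} {I : LimitedInfo S A} {μ : Memory S A} {m : ℕ} {ebar : ℝ}
  {P : Finset (S × A)} {r : (S × A) × S}

theorem Memory.partnerRoom_nonneg (h : ∀ b, (μ.est b).Sound m μ.time) (he : 0 < ebar) (b : Bool) :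
    0 ≤ μ.partnerRoom P ebar b := by
  cases b with
  | true => exact le_rfl
  | false => exact (h true).room_nonneg P he (Or.inl rfl)

theorem Memory.budget_nonneg (h : ∀ b, (μ.est b).Sound m μ.time) (he : 0 < ebar) (b : Bool)
    (q : S × A) : 0 ≤ μ.budget P ebar b q := by
  have h1 := (h b).room_nonneg P he (sgn_eq b)
  have h2 := Memory.partnerRoom_nonneg (P := P) h he b
  have h3 := (μ.est b).pending_nonneg (max (μ.est b).star (μ.partner b)) q
  unfold Memory.budget
  positivity

theorem Memory.step (I : LimitedInfo S A) (m : ℕ) (ebar : ℝ) (μ : Memory S A) (r : (S × A) × S)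
    (b : Bool) : (μ.est b).Step m ebar (sgn b)
      (max (μ.est b).star ((μ.update I m ebar r).partner b)) (μ.time + 1) r.1 (μ.bound I b r.2)
      ((μ.update I m ebar r).est b) := by
  cases b with
  | true =>
    simp only [Memory.partner, Nat.max_zero]
    exact Estimate.step_update ..
  | false => exact Estimate.step_update ..

theorem Memory.update_sound (h : ∀ b, (μ.est b).Sound m μ.time) (he : 0 < ebar) (b : Bool) :
    ((μ.update I m ebar r).est b).Sound m (μ.update I m ebar r).time :=
  (μ.step I m ebar r b).sound (h b) (Memory.bound_nonneg h b _) (Memory.bound_le_one h b _) he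
    (sgn_eq b)

theorem Memory.update_room (hr : r.1 ∈ P) (he : 0 < ebar) (b : Bool) :
    (((μ.update I m ebar r).est b).star = μ.time + 1 ∧
        ((μ.update I m ebar r).est b).room P ebar (sgn b) ≤ (μ.est b).room P ebar (sgn b) - 1) ∨
      (((μ.update I m ebar r).est b).star = (μ.est b).star ∧
        ((μ.update I m ebar r).est b).room P ebar (sgn b) = (μ.est b).room P ebar (sgn b)) := by
  rcases (μ.step I m ebar r b).room hr he (sgn_eq b) with h | ⟨h1, _, h2⟩
  · exact Or.inl h
  · exact Or.inr ⟨h1, h2⟩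

theorem Memory.update_partnerRoom (hr : r.1 ∈ P) (he : 0 < ebar) (b : Bool) :
    (μ.update I m ebar r).partnerRoom P ebar b ≤ μ.partnerRoom P ebar b - 1 ∨
      ((μ.update I m ebar r).partnerRoom P ebar b = μ.partnerRoom P ebar b ∧
        (μ.update I m ebar r).partner b = μ.partner b) := by
  cases b with
  | true => exact Or.inr ⟨rfl, rfl⟩
  | false =>
    rcases Memory.update_room (μ := μ) (I := I) (m := m) hr he true with ⟨_, h⟩ | ⟨h1, h2⟩
    · exact Or.inl h
    · exact Or.inr ⟨h2, h1⟩

theorem Memory.update_partner (h : ∀ b, (μ.est b).Sound m μ.time) (b : Bool) :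
    μ.partner b ≤ (μ.update I m ebar r).partner b ∧
      (μ.update I m ebar r).partner b ≤ μ.time + 1 := by
  cases b with
  | true => exact ⟨le_rfl, Nat.zero_le _⟩
  | false =>
    have h1 := (h true).star_le
    rcases (μ.step I m ebar r true).star with h2 | ⟨h2, _⟩
    · exact ⟨by change μ.U.star ≤ (μ.update I m ebar r).U.star; change _ = _ at h2
                exact (h1.trans (Nat.le_succ _)).trans h2.ge, h2.le⟩
    · exact ⟨h2.ge, h2.le.trans (h1.trans (Nat.le_succ _))⟩

theorem Memory.update_budget_other (hr : r.1 ∈ P) (he : 0 < ebar) (b : Bool) {q : S × A}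
    (hq : q ≠ r.1) : (μ.update I m ebar r).budget P ebar b q ≤ μ.budget P ebar b q :=
  add_le_add_right ((μ.step I m ebar r b).budget_other (Memory.update_room hr he b)
    (Memory.update_partnerRoom hr he b) hq) _

/-- The effect of an update on the sample window of its pair. -/
theorem Memory.update_budget_self (h : ∀ b, (μ.est b).Sound m μ.time) (hr : r.1 ∈ P) (he : 0 < ebar)
    (b : Bool) :
    (μ.update I m ebar r).budget P ebar b r.1 ≤ μ.budget P ebar b r.1 ∧
    (((μ.est b).learn r.1 = true ∧ (μ.est b).cnt r.1 + 1 < m ∧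
        ((μ.update I m ebar r).est b).learn r.1 = true ∧
        ((μ.update I m ebar r).est b).cnt r.1 = (μ.est b).cnt r.1 + 1 ∧
        ((μ.update I m ebar r).est b).acc r.1 = (μ.est b).acc r.1 + μ.bound I b r.2 ∧
        ((μ.update I m ebar r).est b).last r.1 = (μ.est b).last r.1 ∧
        ((μ.update I m ebar r).est b).star = (μ.est b).star ∧
        ((μ.update I m ebar r).est b).val = (μ.est b).val) ∨
      (((μ.est b).learn r.1 = true → (μ.est b).cnt r.1 + 1 = m) ∧
        ((μ.update I m ebar r).est b).learn r.1 = true ∧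
        ((μ.update I m ebar r).est b).cnt r.1 = 0 ∧ ((μ.update I m ebar r).est b).acc r.1 = 0 ∧
        (μ.update I m ebar r).budget P ebar b r.1 ≤ μ.budget P ebar b r.1 - 1) ∨
      ((μ.est b).learn r.1 = true ∧ (μ.est b).cnt r.1 + 1 = m ∧
        ((μ.update I m ebar r).est b).learn r.1 = false) ∨
      ((μ.est b).learn r.1 = false ∧
        max (μ.est b).star ((μ.update I m ebar r).partner b) ≤ (μ.est b).last r.1 ∧
        (μ.update I m ebar r).est b = μ.est b)) := by
  obtain ⟨h1, h2⟩ := (μ.step I m ebar r b).budget_self (h b) (Memory.update_partner h b).1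
    (Memory.update_partner h b).2 (Memory.update_room hr he b) (Memory.update_partnerRoom hr he b)
  refine ⟨add_le_add_right h1 _, ?_⟩
  rcases h2 with h2 | ⟨h3, h4, h5, h6, h7⟩ | h2 | h2
  · exact Or.inl h2
  · refine Or.inr (Or.inl ⟨h3, h4, h5, h6, ?_⟩)
    have : ((P \ (μ.update I m ebar r).inner).card : ℝ) = ((P \ μ.inner).card : ℝ) := rfl
    unfold Memory.budget
    rw [this]
    linarith
  · exact Or.inr (Or.inr (Or.inl h2))
  · exact Or.inr (Or.inr (Or.inr h2))

theorem Memory.update_bound_of_val_eq {b : Bool}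
    (h : ((μ.update I m ebar r).est b).val = (μ.est b).val) :
    (μ.update I m ebar r).bound I b = μ.bound I b := by
  funext s
  unfold Memory.bound
  rw [h]
  rfl

/-! ### Sample windows -/

/-- The function whose mean is estimated: the value (`true`) or the current bound (`false`). -/
noncomputable def Memory.ref (M : MDP S A) (F : Finset S) (I : LimitedInfo S A) (μ : Memory S A)
    (b : Bool) : Bool → S → ℝ
  | true => value M F
  | false => μ.bound I b

/-- The direction of deviations that are harmful. -/
def dir (b : Bool) : Bool → ℝ
  | true => -sgn b
  | false => sgn b

theorem dir_eq (b md : Bool) : dir b md = 1 ∨ dir b md = -1 := by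
  cases b <;> cases md <;> simp [dir, sgn]

open Classical in
/-- The exponential supermartingale of the current sample window of `q`.  In mode `false` only windows
count in which no bound has been changed. -/
noncomputable def Memory.window (M : MDP S A) (F : Finset S) (I : LimitedInfo S A) (lam : ℝ)
    (μ : Memory S A) (b md : Bool) (q : S × A) : ℝ :=
  -- Mode `true` compares the samples with the value and guards against a successful update that
  -- makes the bound wrong. Mode `false` compares them with the current bound and guards against
  -- settling a pair that is still inconsistent.
  if (μ.est b).learn q = true ∧ (md = false → (μ.est b).star ≤ (μ.est b).last q) then
    Real.exp (dir b md * lam * ((μ.est b).acc q - (μ.est b).cnt q * mean M q (μ.ref M F I b md)) -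
      (μ.est b).cnt q * (lam ^ 2 / 8))
  else 0

theorem Memory.window_nonneg (M : MDP S A) (F : Finset S) (I : LimitedInfo S A) (lam : ℝ)
    (μ : Memory S A) (b md : Bool) (q : S × A) : 0 ≤ μ.window M F I lam b md q := by
  unfold Memory.window
  split_ifs
  exacts [Real.exp_nonneg _, le_rfl]

theorem Memory.window_off {lam : ℝ} {b md : Bool} {q : S × A} (h : (μ.est b).learn q = false) :
    μ.window M F I lam b md q = 0 := by
  rw [Memory.window, if_neg]
  simp [h]

theorem Memory.window_fresh {lam : ℝ} {b md : Bool} {q : S × A} (h : (μ.est b).cnt q = 0)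
    (h' : (μ.est b).acc q = 0) : μ.window M F I lam b md q ≤ 1 := by
  unfold Memory.window
  rw [h, h']
  split_ifs <;> simp

theorem Memory.ref_nonneg (h : ∀ b, (μ.est b).Sound m μ.time) (b md : Bool) (s : S) :
    0 ≤ μ.ref M F I b md s := by
  cases md
  exacts [Memory.bound_nonneg h b s, value_nonneg M F s]

theorem Memory.ref_le_one (h : ∀ b, (μ.est b).Sound m μ.time) (b md : Bool) (s : S) :
    μ.ref M F I b md s ≤ 1 := by
  cases md
  exacts [Memory.bound_le_one h b s, value_le_one M F s]

/-- A success of another pair changes the reference function of mode `false`. But then `star` is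
later than the last attempt of `q`, and the window no longer counts. -/
theorem Memory.update_window_other {lam : ℝ} (h : ∀ b, (μ.est b).Sound m μ.time) (b md : Bool)
    {q : S × A} (hq : q ≠ r.1) :
    (μ.update I m ebar r).window M F I lam b md q ≤ μ.window M F I lam b md q := by
  obtain ⟨_, h2, h3, h4, h5⟩ := (μ.step I m ebar r b).other hq
  rcases (μ.step I m ebar r b).star with h6 | ⟨h6, h7⟩
  · cases md with
    | true =>
      unfold Memory.window
      rw [h2, h3, h5]
      simp [Memory.ref]
    | false =>
      rw [Memory.window, if_neg]
      · exact Memory.window_nonneg ..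
      · rintro ⟨_, h8⟩
        have h9 := h8 rfl
        rw [h6, h4] at h9
        exact absurd ((h b).last_le q) (by omega)
  · have h8 : (μ.update I m ebar r).ref M F I b md = μ.ref M F I b md := by
      cases md
      · exact Memory.update_bound_of_val_eq h7
      · rfl
    unfold Memory.window
    rw [h2, h3, h4, h5, h6, h8]

/-- The bounds are correct, and pairs that have stopped learning are almost consistent. -/
structure Memory.Good (M : MDP S A) (F : Finset S) (I : LimitedInfo S A) (ebar : ℝ)
    (μ : Memory S A) (b : Bool) (q : S × A) : Prop where
  correct : 0 ≤ sgn b * ((μ.est b).val q - valueAct M F q)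
  consistent : (μ.est b).learn q = false → (μ.est b).star ≤ (μ.est b).last q →
    sgn b * ((μ.est b).val q - mean M q (μ.bound I b)) ≤ 3 * ebar

/-- In mode `true` the samples are bounds instead of values. As the bounds are correct, they differ
from the values only against the harmful direction. -/
theorem Memory.exp_dir_le_tilt (hI : I.IsAbout M F) (hc : Coherent M F μ.cls μ.inner)
    (hg : ∀ b, ∀ q ∈ allPairs M.E, μ.Good M F I ebar b q) {lam : ℝ} (hl : 0 ≤ lam) (b md : Bool)
    (q : S × A) (s' : S) :
    dir b md * lam * (μ.bound I b s' - mean M q (μ.ref M F I b md)) - lam ^ 2 / 8 ≤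
      dir b md * lam * (μ.ref M F I b md s' - mean M q (μ.ref M F I b md)) - lam ^ 2 / 8 := by
  cases md with
  | false => exact le_rfl
  | true =>
    have h := Memory.bound_correct hI hc (fun q hq => (hg b q hq).correct) s'
    simp only [dir, Memory.ref]
    have h1 := mul_nonneg hl h
    linarith

theorem Memory.update_window_cont (hI : I.IsAbout M F) (hc : Coherent M F μ.cls μ.inner)
    (hg : ∀ b, ∀ q ∈ allPairs M.E, μ.Good M F I ebar b q) {lam : ℝ} (hl : 0 ≤ lam) (b md : Bool)
    (h1 : (μ.est b).learn r.1 = true)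
    (h2 : ((μ.update I m ebar r).est b).learn r.1 = true)
    (h3 : ((μ.update I m ebar r).est b).cnt r.1 = (μ.est b).cnt r.1 + 1)
    (h4 : ((μ.update I m ebar r).est b).acc r.1 = (μ.est b).acc r.1 + μ.bound I b r.2)
    (h5 : ((μ.update I m ebar r).est b).last r.1 = (μ.est b).last r.1)
    (h6 : ((μ.update I m ebar r).est b).star = (μ.est b).star)
    (h7 : ((μ.update I m ebar r).est b).val = (μ.est b).val) :
    (μ.update I m ebar r).window M F I lam b md r.1 ≤
      μ.window M F I lam b md r.1 * tilt M (dir b md) lam r.1 (μ.ref M F I b md) r.2 := by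
  have h8 : (μ.update I m ebar r).ref M F I b md = μ.ref M F I b md := by
    cases md
    · exact Memory.update_bound_of_val_eq h7
    · rfl
  have h9 := Memory.exp_dir_le_tilt hI hc hg hl b md r.1 r.2
  unfold Memory.window
  rw [h1, h2, h3, h4, h5, h6, h8]
  split_ifs
  · rw [tilt, ← Real.exp_add]
    refine Real.exp_le_exp.2 ?_
    push_cast
    linarith
  · rw [zero_mul]

end MemoryUpdate

/-! ### Failed update attempts -/

section Failure

variable {S : Type u} {A : Type v} [Fintype S] [DecidableEq S] [DecidableEq A]

theorem Estimate.Step.outcome {m t wake : ℕ} {ebar sg x : ℝ} {q : S × A} {e e' : Estimate S A}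
    (hs : e.Step m ebar sg wake t q x e') :
    (e'.val = e.val ∧ (e'.learn q = true ∨ e' = e)) ∨
    (e.learn q = true ∧ e.cnt q + 1 = m ∧ e'.learn q = true ∧
      e'.val q = e.sampleAvg m q x + sg * ebar) ∨
    (e.learn q = true ∧ e.cnt q + 1 = m ∧ e.star ≤ e.last q ∧ e'.val = e.val ∧
      sg * (e.val q - e.sampleAvg m q x) < 2 * ebar) := by
  cases hs with
  | cont h1 h2 => exact Or.inl ⟨rfl, Or.inl h1⟩
  | success h1 h2 h3 => exact Or.inr (Or.inl ⟨h1, h2, h1, by simp⟩)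
  | settle h1 h2 h3 h4 => exact Or.inr (Or.inr ⟨h1, h2, h4, rfl, h3⟩)
  | retry h1 h2 h3 h4 => exact Or.inl ⟨rfl, Or.inl h1⟩
  | wake h1 h2 => exact Or.inl ⟨rfl, Or.inl (by simp)⟩
  | idle h1 h2 => exact Or.inl ⟨rfl, Or.inr rfl⟩

variable {M : MDP S A} {F : Finset S} {I : LimitedInfo S A} {μ : Memory S A} {m : ℕ} {ebar : ℝ}
  {r : (S × A) × S}

/-- The probability bound for the failure of one update attempt. -/
noncomputable def failBound (m : ℕ) (ebar : ℝ) : ℝ := Real.exp (-(2 * m * ebar ^ 2))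

/-- Chernoff bound in pathwise form. For `m` samples with deviation `ebar` the exponent is `m * (lam
* ebar - lam ^ 2 / 8)`; its maximum, at `lam = 4 * ebar`, is `2 * m * ebar ^ 2`. The window holds `m
- 1` samples and the tilt supplies the last one. -/
theorem Memory.one_le_failBound_mul (hI : I.IsAbout M F) (hc : Coherent M F μ.cls μ.inner)
    (hg : ∀ b, ∀ q ∈ allPairs M.E, μ.Good M F I ebar b q) (he : 0 < ebar) {b md : Bool}
    (h1 : (μ.est b).learn r.1 = true) (h2 : (μ.est b).cnt r.1 + 1 = m)
    (h3 : md = false → (μ.est b).star ≤ (μ.est b).last r.1)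
    (h4 : ebar ≤ dir b md * ((μ.est b).sampleAvg m r.1 (μ.bound I b r.2) -
      mean M r.1 (μ.ref M F I b md))) :
    1 ≤ failBound m ebar * (μ.window M F I (4 * ebar) b md r.1 *
      tilt M (dir b md) (4 * ebar) r.1 (μ.ref M F I b md) r.2) := by
  have h5 := Memory.exp_dir_le_tilt hI hc hg (mul_nonneg zero_le_four he.le) b md r.1 r.2
  have hm : (0 : ℝ) < m := by rw [← h2]; positivity
  have h6 : (μ.est b).acc r.1 + μ.bound I b r.2 =
      m * (μ.est b).sampleAvg m r.1 (μ.bound I b r.2) := by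
    rw [Estimate.sampleAvg, mul_div_cancel₀ _ hm.ne']
  have h7 : ((μ.est b).cnt r.1 : ℝ) = m - 1 := by rw [← h2]; push_cast; ring
  rw [Memory.window, if_pos ⟨h1, h3⟩, failBound, tilt, ← Real.exp_add, ← Real.exp_add]
  refine Real.one_le_exp ?_
  rw [h7]
  have h8 := mul_le_mul_of_nonneg_left h4 (mul_nonneg (mul_nonneg zero_le_four he.le) hm.le)
  generalize (μ.est b).sampleAvg m r.1 (μ.bound I b r.2) = avg at *
  generalize mean M r.1 (μ.ref M F I b md) = c at *
  have h9 : dir b md * (4 * ebar) * ((μ.est b).acc r.1 - (m - 1) * c) +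
      dir b md * (4 * ebar) * (μ.bound I b r.2 - c) = 4 * ebar * m * (dir b md * (avg - c)) := by
    have : (μ.est b).acc r.1 = m * avg - μ.bound I b r.2 := by linarith
    rw [this]; ring
  nlinarith

/-- A success leaves a margin `ebar` to the average, so an incorrect result means that the average
is off by `ebar`. Settling means less than `2 * ebar` from the average, so inconsistency by more
than `3 * ebar` again leaves `ebar`. For other pairs a success only makes the consistency condition
void. -/
theorem Memory.update_good (hI : I.IsAbout M F) (hc : Coherent M F μ.cls μ.inner)
    (h : ∀ b, (μ.est b).Sound m μ.time)
    (hg : ∀ b, ∀ q ∈ allPairs M.E, μ.Good M F I ebar b q) (he : 0 < ebar) (b : Bool) {q : S × A}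
    (hq : q ∈ allPairs M.E) :
    (μ.update I m ebar r).Good M F I ebar b q ∨
      (q = r.1 ∧ (μ.est b).learn q = true ∧ (μ.est b).cnt q + 1 = m ∧ ∃ md,
        1 ≤ failBound m ebar * (μ.window M F I (4 * ebar) b md q *
          tilt M (dir b md) (4 * ebar) q (μ.ref M F I b md) r.2)) := by
  have hs := μ.step I m ebar r b
  obtain ⟨hg1, hg2⟩ := hg b q hq
  by_cases hqr : q = r.1
  · subst hqr
    rcases hs.outcome with ⟨h1, h2⟩ | ⟨h1, h2, h3, h4⟩ | ⟨h1, h2, h3, h4, h5⟩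
    · refine Or.inl ⟨by rw [h1]; exact hg1, fun h3 h4 => ?_⟩
      rcases h2 with h2 | h2
      · rw [h2] at h3; cases h3
      · rw [Memory.update_bound_of_val_eq h1, h2]
        rw [h2] at h3 h4
        exact hg2 h3 h4
    · by_cases h5 : 0 ≤ sgn b * (((μ.update I m ebar r).est b).val r.1 - valueAct M F r.1)
      · exact Or.inl ⟨h5, fun h6 => absurd (h3.symm.trans h6) (by simp)⟩
      · refine Or.inr ⟨rfl, h1, h2, true, Memory.one_le_failBound_mul hI hc hg he h1 h2
          (by simp) ?_⟩
        rw [h4] at h5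
        have h7 : mean M r.1 (μ.ref M F I b true) = valueAct M F r.1 := rfl
        rw [h7]
        simp only [dir]
        rcases sgn_eq b with h6 | h6 <;> rw [h6] at h5 ⊢ <;> linarith
    · by_cases h6 : sgn b * ((μ.est b).val r.1 - mean M r.1 (μ.bound I b)) ≤ 3 * ebar
      · refine Or.inl ⟨by rw [h4]; exact hg1, fun _ _ => ?_⟩
        rw [Memory.update_bound_of_val_eq h4, h4]
        exact h6
      · refine Or.inr ⟨rfl, h1, h2, false, Memory.one_le_failBound_mul hI hc hg he h1 h2
          (fun _ => h3) ?_⟩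
        simp only [dir, Memory.ref]
        linarith
  · left
    obtain ⟨h1, _, _, h4, h5⟩ := hs.other hqr
    refine ⟨by rw [h1]; exact hg1, fun h6 h7 => ?_⟩
    rcases hs.star with h8 | ⟨h8, h9⟩
    · rw [h8, h4] at h7
      exact absurd ((h b).last_le q) (by omega)
    · rw [Memory.update_bound_of_val_eq h9, h1]
      rw [h5] at h6
      rw [h8, h4] at h7
      exact hg2 h6 h7

end Failure

/-! ### Processing a path -/

section PathUpdate

open Chain

variable {S : Type u} {A : Type v} [Fintype S] [DecidableEq S] [DecidableEq A]

/-- The memory after processing a path, the latest transition first. -/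
noncomputable def Memory.process (I : LimitedInfo S A) (m : ℕ) (ebar : ℝ) (μ : Memory S A)
    (l : List ((S × A) × S)) : Memory S A :=
  l.foldr (fun r ν => ν.update I m ebar r) μ

/-- The number of samples that complete the current window of `q`. -/
def Memory.missing (m : ℕ) (μ : Memory S A) (b : Bool) (q : S × A) : ℕ :=
  if (μ.est b).learn q = true then m - (μ.est b).cnt q else 0

variable {M : MDP S A} {F : Finset S} {I : LimitedInfo S A} {μ : Memory S A} {m : ℕ} {ebar : ℝ}

theorem Memory.process_frame (l : List ((S × A) × S)) :
    (μ.process I m ebar l).cls = μ.cls ∧ (μ.process I m ebar l).inner = μ.inner ∧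
      (μ.process I m ebar l).time = μ.time + l.length := by
  induction l with
  | nil => exact ⟨rfl, rfl, rfl⟩
  | cons r l ih =>
    refine ⟨ih.1, ih.2.1, ?_⟩
    change (μ.process I m ebar l).time + 1 = _
    rw [ih.2.2, List.length_cons]; omega

theorem Memory.process_sound (h : ∀ b, (μ.est b).Sound m μ.time) (he : 0 < ebar)
    (l : List ((S × A) × S)) (b : Bool) :
    ((μ.process I m ebar l).est b).Sound m (μ.process I m ebar l).time := by
  induction l generalizing b with
  | nil => exact h b
  | cons r l ih => exact Memory.update_sound ih he b

theorem Memory.process_val (l : List ((S × A) × S)) (b : Bool) :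
    ((μ.process I m ebar l).est b).star ≤ μ.time →
      ((μ.process I m ebar l).est b).val = (μ.est b).val := by
  induction l with
  | nil => exact fun _ => rfl
  | cons r l ih =>
    intro h
    have ht := (Memory.process_frame (μ := μ) (I := I) (m := m) (ebar := ebar) l).2.2
    rcases ((μ.process I m ebar l).step I m ebar r b).star with h1 | ⟨h1, h2⟩
    · change ((μ.process I m ebar l).update I m ebar r |>.est b).star ≤ _ at h
      rw [h1] at h; omega
    · change ((μ.process I m ebar l).update I m ebar r |>.est b).star ≤ _ at h
      rw [h1] at h
      exact h2.trans (ih h)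

theorem Memory.process_budget (h : ∀ b, (μ.est b).Sound m μ.time) (he : 0 < ebar) {P : Finset (S × A)}
    {r : (S × A) × S} {l : List ((S × A) × S)} (hr : r.1 ∈ P) (b : Bool) (q : S × A) :
    (μ.process I m ebar (r :: l)).budget P ebar b q ≤ (μ.process I m ebar l).budget P ebar b q := by
  by_cases hq : q = r.1
  · subst hq
    exact (Memory.update_budget_self (Memory.process_sound h he l) hr he b).1
  · exact Memory.update_budget_other hr he b hq

/-- Until the window of `q` is completed, the samples are added to it. -/
theorem Memory.process_old (h : ∀ b, (μ.est b).Sound m μ.time) (he : 0 < ebar)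
    (l : List ((S × A) × S)) (b : Bool) (q : S × A) (hl : occ q l < μ.missing m b q) :
    ((μ.process I m ebar l).est b).learn q = true ∧
      ((μ.process I m ebar l).est b).cnt q = (μ.est b).cnt q + occ q l ∧
      ((μ.process I m ebar l).est b).last q = (μ.est b).last q := by
  unfold Memory.missing at hl
  by_cases h0 : (μ.est b).learn q = true
  swap
  · rw [if_neg h0] at hl; omega
  induction l with
  | nil => exact ⟨h0, rfl, rfl⟩
  | cons r l ih =>
    rw [if_pos h0] at hl ih
    by_cases hq : q = r.1
    · subst hq
      rw [occ, if_pos rfl] at hl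
      obtain ⟨h1, h2, h3⟩ := ih (by omega)
      rcases (Memory.update_budget_self (P := {r.1}) (Memory.process_sound (I := I) h he l)
        (Finset.mem_singleton_self _) he b).2
        with ⟨_, _, h5, h6, _, h7, _⟩ | ⟨h4, _⟩ | ⟨_, h4, _⟩ | ⟨h4, _⟩
      · rw [occ, if_pos rfl]
        exact ⟨h5, by rw [← add_assoc, ← h2]; exact h6, h7.trans h3⟩
      · have := h4 h1
        omega
      · omega
      · rw [h1] at h4; cases h4
    · obtain ⟨_, _, h3, h4, h5⟩ := ((μ.process I m ebar l).step I m ebar r b).other hq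
      rw [occ, if_neg (Ne.symm hq)] at hl ⊢
      obtain ⟨h6, h7, h8⟩ := ih hl
      exact ⟨h5.trans h6, h3.trans h7, h4.trans h8⟩

/-- The tilt by which the initial window of `q` grows. -/
noncomputable def Memory.factor (M : MDP S A) (F : Finset S) (I : LimitedInfo S A) (ebar : ℝ)
    (μ : Memory S A) (b md : Bool) (q : S × A) : S → ℝ :=
  tilt M (dir b md) (4 * ebar) q (μ.ref M F I b md)

theorem Memory.process_bound_of_val_eq {l : List ((S × A) × S)} {b : Bool}
    (h : ((μ.process I m ebar l).est b).val = (μ.est b).val) :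
    (μ.process I m ebar l).bound I b = μ.bound I b := by
  funext s
  obtain ⟨h1, h2, _⟩ := Memory.process_frame (μ := μ) (I := I) (m := m) (ebar := ebar) l
  unfold Memory.bound
  rw [h, h1]
  cases μ.cls s with
  | one => rfl
  | zero => rfl
  | block R => simp only [Memory.nodeVal, Memory.enabledAt, h2]

/-- In mode `false` the reference moves with the bounds. A window that still counts has seen no
successful update since it began, so the reference is still the initial one; otherwise both sides
are 0. -/
theorem Memory.process_window_mul_factor (h : ∀ b, (μ.est b).Sound m μ.time) (he : 0 < ebar)
    (l : List ((S × A) × S)) (b md : Bool) (q : S × A) (hl : occ q l < μ.missing m b q) (s' : S) :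
    (μ.process I m ebar l).window M F I (4 * ebar) b md q *
        (μ.process I m ebar l).factor M F I ebar b md q s' =
      (μ.process I m ebar l).window M F I (4 * ebar) b md q * μ.factor M F I ebar b md q s' := by
  cases md with
  | true => rfl
  | false =>
    by_cases h1 : ((μ.process I m ebar l).est b).star ≤ ((μ.process I m ebar l).est b).last q
    · have h2 : (μ.process I m ebar l).bound I b = μ.bound I b := by
        refine Memory.process_bound_of_val_eq (Memory.process_val l b (h1.trans ?_))
        rw [(Memory.process_old h he l b q hl).2.2]
        exact (h b).last_le q
      unfold Memory.factor
      simp only [Memory.ref, h2]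
    · rw [Memory.window, if_neg (fun h2 => h1 (h2.2 rfl)), zero_mul, zero_mul]

/-- The number of windows that can still be begun after processing a path. -/
noncomputable def Memory.budgets (P : Finset (S × A)) (I : LimitedInfo S A) (m : ℕ) (ebar : ℝ)
    (μ : Memory S A) (b : Bool) (q : S × A) (l : List ((S × A) × S)) : ℝ :=
  (μ.process I m ebar l).budget P ebar b q

/-- This is the pathwise part of the estimate. Until it is completed, the initial window of `q`
grows at most by the tilts. Every later window begins with value at most 1, paid for by the decrease
of the budget at that suffix, and grows by at most `tiltMax` per sample. A failure is charged to the
window completed by it, and the charge persists because both expressions only grow when earlier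
transitions are added. -/
theorem Memory.process_dichotomy (hI : I.IsAbout M F) (hc : Coherent M F μ.cls μ.inner)
    (h : ∀ b, (μ.est b).Sound m μ.time)
    (hg : ∀ b, ∀ q ∈ allPairs M.E, μ.Good M F I ebar b q) (he : 0 < ebar) (l : List ((S × A) × S))
    (hl : ∀ r ∈ l, r.1 ∈ allPairs M.E) :
    ((∀ b, ∀ q ∈ allPairs M.E, (μ.process I m ebar l).Good M F I ebar b q) ∧
      ∀ b md, ∀ q ∈ allPairs M.E,
        (occ q l < μ.missing m b q → (μ.process I m ebar l).window M F I (4 * ebar) b md q ≤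
          μ.window M F I (4 * ebar) b md q * weight q (μ.factor M F I ebar b md q) l) ∧
        (μ.missing m b q ≤ occ q l → (μ.process I m ebar l).window M F I (4 * ebar) b md q ≤
          excess q (tiltMax (4 * ebar)) (decrease (μ.budgets (allPairs M.E) I m ebar b q)) l)) ∨
    ∃ b md, ∃ q ∈ allPairs M.E, 1 ≤ failBound m ebar * (μ.window M F I (4 * ebar) b md q *
        (weight q (μ.factor M F I ebar b md q) l *
          excess q (tiltMax (4 * ebar)) (reached q (μ.missing m b q)) l) +
        excess q (tiltMax (4 * ebar)) (decrease (μ.budgets (allPairs M.E) I m ebar b q)) l) := by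
  have hlam : 0 ≤ 4 * ebar := by positivity
  have hw := one_le_tiltMax hlam
  have hw0 := zero_le_one.trans hw
  have hφ : ∀ b md q s', (tiltMax (4 * ebar))⁻¹ ≤ μ.factor M F I ebar b md q s' := fun b md q s' =>
    le_tilt (dir_eq b md) hlam (Memory.ref_nonneg h b md) (Memory.ref_le_one h b md) s'
  have hφ0 : ∀ b md q s', 0 ≤ μ.factor M F I ebar b md q s' := fun b md q s' => Real.exp_nonneg _
  have hβ : 0 ≤ failBound m ebar := Real.exp_nonneg _
  have hW0 : ∀ b md q, 0 ≤ μ.window M F I (4 * ebar) b md q := fun b md q =>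
    Memory.window_nonneg ..
  induction l with
  | nil =>
    refine Or.inl ⟨hg, fun b md q _ => ⟨fun _ => ?_, fun h1 => ?_⟩⟩
    · rw [weight, mul_one]; exact le_rfl
    · rw [excess]
      have h2 : (μ.est b).learn q = false := by
        by_contra h2
        rw [Bool.not_eq_false] at h2
        have h3 := (h b).cnt_lt q
        rw [Memory.missing, if_pos h2, occ] at h1
        omega
      exact (Memory.window_off h2).le
  | cons r l ih =>
    have hl' : ∀ r ∈ l, r.1 ∈ allPairs M.E := fun p hp => hl p (List.mem_cons_of_mem _ hp)
    have hr : r.1 ∈ allPairs M.E := hl r List.mem_cons_self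
    rcases ih hl' with ⟨ihg, ihw⟩ | ⟨b, md, q, hq, h1⟩
    swap
    · refine Or.inr ⟨b, md, q, hq, h1.trans (mul_le_mul_of_nonneg_left (add_le_add
        (mul_le_mul_of_nonneg_left ?_ (hW0 b md q)) ?_) hβ)⟩
      · exact weight_excess_le_cons q hw (hφ b md q) (reached_nonneg q _) r l
      · exact excess_le_cons q hw (decrease_nonneg _) r l
    set ν := μ.process I m ebar l with hν
    obtain ⟨hcls, hinn, htime⟩ := Memory.process_frame (μ := μ) (I := I) (m := m) (ebar := ebar) l
    have hcν : Coherent M F ν.cls ν.inner := by rw [hν, hcls, hinn]; exact hc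
    have hsν : ∀ b, (ν.est b).Sound m ν.time := Memory.process_sound h he l
    have hex : ∀ b q, 0 ≤ excess q (tiltMax (4 * ebar))
        (decrease (μ.budgets (allPairs M.E) I m ebar b q)) l := fun b q =>
      excess_nonneg q hw0 (decrease_nonneg _) l
    have hfac : ∀ b md q s', ν.factor M F I ebar b md q s' ≤ tiltMax (4 * ebar) := fun b md q s' =>
      tilt_le (dir_eq b md) hlam (Memory.ref_nonneg hsν b md) (Memory.ref_le_one hsν b md) s'
    have hprod : ∀ b md, (occ r.1 l < μ.missing m b r.1 →
        ν.window M F I (4 * ebar) b md r.1 * ν.factor M F I ebar b md r.1 r.2 ≤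
          μ.window M F I (4 * ebar) b md r.1 * weight r.1 (μ.factor M F I ebar b md r.1) (r :: l)) ∧
        (μ.missing m b r.1 ≤ occ r.1 l →
          ν.window M F I (4 * ebar) b md r.1 * ν.factor M F I ebar b md r.1 r.2 ≤
          excess r.1 (tiltMax (4 * ebar))
            (decrease (μ.budgets (allPairs M.E) I m ebar b r.1)) (r :: l)) := by
      refine fun b md => ⟨fun h1 => ?_, fun h1 => ?_⟩
      · rw [Memory.process_window_mul_factor h he l b md r.1 h1, weight, if_pos rfl,
          mul_left_comm, mul_comm]
        exact mul_le_mul_of_nonneg_left ((ihw b md r.1 hr).1 h1) (hφ0 _ _ _ _)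
      · rw [excess, if_pos rfl, mul_comm]
        have h2 := mul_le_mul (hfac b md r.1 r.2) ((ihw b md r.1 hr).2 h1)
          (Memory.window_nonneg ..) hw0
        have h3 := decrease_nonneg (μ.budgets (allPairs M.E) I m ebar b r.1) (r :: l)
        linarith
    by_cases hgood : ∀ b, ∀ q ∈ allPairs M.E, (ν.update I m ebar r).Good M F I ebar b q
    · refine Or.inl ⟨hgood, fun b md q hq => ?_⟩
      by_cases hqr : q = r.1
      · subst hqr
        have hocc : occ r.1 (r :: l) = occ r.1 l + 1 := by rw [occ, if_pos rfl]
        rw [hocc]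
        have hnn : 0 ≤ μ.window M F I (4 * ebar) b md r.1 *
            weight r.1 (μ.factor M F I ebar b md r.1) (r :: l) :=
          mul_nonneg (hW0 b md r.1) (weight_nonneg _ (hφ0 b md r.1) _)
        have hnn' := excess_nonneg r.1 hw0
          (decrease_nonneg (μ.budgets (allPairs M.E) I m ebar b r.1)) (r :: l)
        have hmiss : occ r.1 l < μ.missing m b r.1 → (ν.est b).learn r.1 = true ∧
            (ν.est b).cnt r.1 + μ.missing m b r.1 = m + occ r.1 l := fun h1 => by
          obtain ⟨h2, h3, _⟩ := Memory.process_old (I := I) h he l b r.1 h1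
          refine ⟨h2, ?_⟩
          have h5 := (h b).cnt_lt r.1
          unfold Memory.missing at h1 ⊢
          split_ifs at h1 ⊢ with h4
          · rw [h3]; omega
          · omega
        rcases (Memory.update_budget_self (I := I) hsν hr he b).2 with
          ⟨h1, h2, h3, h4, h5, h6, h7, h8⟩ | ⟨h1, h2, h3, h4, h5⟩ | ⟨h1, h2, h3⟩ | ⟨h1, h2, h3⟩
        · have h9 := Memory.update_window_cont hI hcν ihg hlam b md h1 h3 h4 h5 h6 h7 h8
          refine ⟨fun h10 => h9.trans ((hprod b md).1 (by omega)), fun h10 =>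
            h9.trans ((hprod b md).2 ?_)⟩
          by_contra h11
          have := (hmiss (by omega)).2
          omega
        · refine ⟨fun h10 => ?_, fun _ => (Memory.window_fresh h3 h4).trans ?_⟩
          · have h11 := hmiss (by omega)
            have := h1 h11.1
            omega
          · rw [excess, if_pos rfl]
            have h12 : 1 ≤ decrease (μ.budgets (allPairs M.E) I m ebar b r.1) (r :: l) :=
              le_max_of_le_right (by
                change 1 ≤ ν.budget (allPairs M.E) ebar b r.1 -
                  (ν.update I m ebar r).budget (allPairs M.E) ebar b r.1
                linarith)
            nlinarith [mul_nonneg hw0 (hex b r.1)]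
        · have h13 : (ν.update I m ebar r).window M F I (4 * ebar) b md r.1 = 0 :=
            Memory.window_off h3
          exact ⟨fun _ => h13.le.trans hnn, fun _ => h13.le.trans hnn'⟩
        · have h13 : (ν.update I m ebar r).window M F I (4 * ebar) b md r.1 = 0 :=
            Memory.window_off (by rw [h3]; exact h1)
          exact ⟨fun _ => h13.le.trans hnn, fun _ => h13.le.trans hnn'⟩
      · have h1 := Memory.update_window_other (M := M) (F := F) (I := I) (ebar := ebar)
          (lam := 4 * ebar) hsν b md hqr
        rw [occ, weight, excess, if_neg (Ne.symm hqr), if_neg (Ne.symm hqr), if_neg (Ne.symm hqr),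
          one_mul]
        exact ⟨fun h2 => h1.trans ((ihw b md q hq).1 h2), fun h2 => h1.trans ((ihw b md q hq).2 h2)⟩
    · push Not at hgood
      obtain ⟨b, q, hq, h1⟩ := hgood
      rcases Memory.update_good (r := r) hI hcν hsν ihg he b hq with h2 | ⟨rfl, h2, h3, md, h4⟩
      · exact absurd h2 h1
      · refine Or.inr ⟨b, md, r.1, hq, h4.trans (mul_le_mul_of_nonneg_left ?_ hβ)⟩
        change ν.window M F I (4 * ebar) b md r.1 * ν.factor M F I ebar b md r.1 r.2 ≤ _
        have hnn' := excess_nonneg r.1 hw0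
          (decrease_nonneg (μ.budgets (allPairs M.E) I m ebar b r.1)) (r :: l)
        have hwn := weight_nonneg r.1 (hφ0 b md r.1) (r :: l)
        by_cases h5 : occ r.1 l < μ.missing m b r.1
        · refine ((hprod b md).1 h5).trans (le_add_of_le_of_nonneg ?_ hnn')
          refine mul_le_mul_of_nonneg_left (le_mul_of_one_le_right hwn ?_) (hW0 b md r.1)
          obtain ⟨h6, h7, _⟩ := Memory.process_old (I := I) h he l b r.1 h5
          have h8 : occ r.1 (r :: l) = μ.missing m b r.1 := by
            rw [occ, if_pos rfl]
            have h9 := h3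
            rw [hν, h7] at h9
            unfold Memory.missing at h5 ⊢
            split_ifs at h5 ⊢ with h4
            · omega
            · omega
          rw [excess, if_pos rfl, reached, if_pos h8]
          have := mul_nonneg hw0 (excess_nonneg r.1 hw0 (reached_nonneg r.1 (μ.missing m b r.1)) l)
          linarith
        · refine ((hprod b md).2 (not_lt.1 h5)).trans (le_add_of_nonneg_left ?_)
          exact mul_nonneg (hW0 b md r.1) (mul_nonneg hwn
            (excess_nonneg r.1 hw0 (reached_nonneg r.1 (μ.missing m b r.1)) _))

end PathUpdate

/-! ### The potential -/

section Potential

open Chain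

variable {S : Type u} {A : Type v} [Fintype S] [DecidableEq S] [DecidableEq A]

/-- A memory at the beginning of an EXPLORE phase in which nothing has gone wrong. -/
structure Memory.Valid (M : MDP S A) (F : Finset S) (I : LimitedInfo S A) (m : ℕ) (ebar : ℝ)
    (μ : Memory S A) : Prop where
  coherent : Coherent M F μ.cls μ.inner
  sound : ∀ b, (μ.est b).Sound m μ.time
  good : ∀ b, ∀ q ∈ allPairs M.E, μ.Good M F I ebar b q

/-- The indices of the sample windows. -/
def windows (M : MDP S A) : Finset (Bool × Bool × (S × A)) :=
  Finset.univ ×ˢ Finset.univ ×ˢ allPairs M.E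

theorem mem_windows {M : MDP S A} {i : Bool × Bool × (S × A)} :
    i ∈ windows M ↔ i.2.2 ∈ allPairs M.E := by
  simp [windows]

/-- A bound for the expected number of failing update attempts, up to the factor `failBound`. -/
noncomputable def Memory.potential (M : MDP S A) (F : Finset S) (I : LimitedInfo S A) (ebar : ℝ)
    (μ : Memory S A) : ℝ :=
  ∑ i ∈ windows M, (2 * μ.window M F I (4 * ebar) i.1 i.2.1 i.2.2 +
    4 * μ.budget (allPairs M.E) ebar i.1 i.2.2)

/-- The part of the potential for windows that have not yet begun. -/
noncomputable def Memory.reserve (M : MDP S A) (ebar : ℝ) (μ : Memory S A) : ℝ :=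
  ∑ i ∈ windows M, 4 * μ.budget (allPairs M.E) ebar i.1 i.2.2

variable {M : MDP S A} {F : Finset S} {I : LimitedInfo S A} {hI : I.IsAbout M F} {μ : Memory S A}
  {m : ℕ} {ebar : ℝ}

theorem Memory.potential_nonneg (h : ∀ b, (μ.est b).Sound m μ.time) (he : 0 < ebar) :
    0 ≤ μ.potential M F I ebar :=
  Finset.sum_nonneg fun _ _ => add_nonneg (mul_nonneg zero_le_two (Memory.window_nonneg ..))
    (mul_nonneg zero_le_four (Memory.budget_nonneg h he _ _))

theorem Memory.process_mem_acts {s : S} {l : List ((S × A) × S)} {hc : Coherent M F μ.cls μ.inner}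
    (hl : (exploreChain M I hI μ hc).IsPath s l) : ∀ r ∈ l, r.1 ∈ allPairs M.E :=
  fun r hr => hl.mem_acts r hr

theorem Memory.process_valid (h : μ.Valid M F I m ebar) (he : 0 < ebar) {l : List ((S × A) × S)}
    (hg : ∀ b, ∀ q ∈ allPairs M.E, (μ.process I m ebar l).Good M F I ebar b q) :
    (μ.process I m ebar l).Valid M F I m ebar := by
  obtain ⟨h1, h2, _⟩ := Memory.process_frame (μ := μ) (I := I) (m := m) (ebar := ebar) l
  exact ⟨by rw [h1, h2]; exact h.coherent, Memory.process_sound h.sound he l, hg⟩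

open Classical in
/-- Failures within an EXPLORE and UPDATE phase are paid for by the potential. -/
theorem expect_update_le (h : μ.Valid M F I m ebar) (he : 0 < ebar)
    (hw : 2 * (tiltMax (4 * ebar) - 1) * tiltMax (4 * ebar) ≤ (I.pmin / I.Em) ^ I.K) (n : ℕ) (s : S) :
    (exploreChain M I hI μ h.coherent).expect n s
      (fun l => if (μ.process I m ebar l).Valid M F I m ebar then
        min 1 (failBound m ebar * (μ.process I m ebar l).potential M F I ebar) else 1)
      (fun _ => failBound m ebar * μ.reserve M ebar) ≤
    failBound m ebar * μ.potential M F I ebar := by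
  set c := exploreChain M I hI μ h.coherent with hc
  set β := failBound m ebar
  have hβ : 0 ≤ β := Real.exp_nonneg _
  have hlam : 0 ≤ 4 * ebar := by positivity
  have hw1 := one_le_tiltMax hlam
  have hw0 := zero_le_one.trans hw1
  have hφ : ∀ b md q s', (tiltMax (4 * ebar))⁻¹ ≤ μ.factor M F I ebar b md q s' := fun b md q s' =>
    le_tilt (dir_eq b md) hlam (Memory.ref_nonneg h.sound b md) (Memory.ref_le_one h.sound b md) s'
  have hφ0 : ∀ b md q s', 0 ≤ μ.factor M F I ebar b md q s' := fun b md q s' => Real.exp_nonneg _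
  have hW0 : ∀ b md q, 0 ≤ μ.window M F I (4 * ebar) b md q := fun b md q =>
    Memory.window_nonneg ..
  have hR : ∀ b q, ∀ (r : (S × A) × S) l, (∀ p ∈ r :: l, p.1 ∈ c.acts) →
      μ.budgets (allPairs M.E) I m ebar b q (r :: l) ≤ μ.budgets (allPairs M.E) I m ebar b q l :=
    fun b q r l hp => Memory.process_budget h.sound he (hp r List.mem_cons_self) b q
  let g : Bool × Bool × (S × A) → List ((S × A) × S) → ℝ := fun i l =>
    2 * (if occ i.2.2 l < μ.missing m i.1 i.2.2 then μ.window M F I (4 * ebar) i.1 i.2.1 i.2.2 *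
        weight i.2.2 (μ.factor M F I ebar i.1 i.2.1 i.2.2) l else 0) +
      μ.window M F I (4 * ebar) i.1 i.2.1 i.2.2 *
        weight i.2.2 (μ.factor M F I ebar i.1 i.2.1 i.2.2) l *
        excess i.2.2 (tiltMax (4 * ebar)) (reached i.2.2 (μ.missing m i.1 i.2.2)) l +
      2 * excess i.2.2 (tiltMax (4 * ebar))
        (decrease (μ.budgets (allPairs M.E) I m ebar i.1 i.2.2)) l +
      4 * μ.budgets (allPairs M.E) I m ebar i.1 i.2.2 l
  have hg : ∀ i ∈ windows M, c.expect n s (g i)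
      (fun _ => 4 * μ.budgets (allPairs M.E) I m ebar i.1 i.2.2 []) ≤
      2 * μ.window M F I (4 * ebar) i.1 i.2.1 i.2.2 +
        4 * μ.budgets (allPairs M.E) I m ebar i.1 i.2.2 [] := by
    intro i hi
    have hq := mem_allPairs.1 (mem_windows.1 hi)
    refine c.expect_window_le i.2.2 hw1 (pow_pos hI.ratio_pos I.K) hw (hφ i.1 i.2.1 i.2.2)
      (sum_mul_tilt_le_one (dir_eq i.1 i.2.1) (Memory.ref_nonneg h.sound i.1 i.2.1)
        (Memory.ref_le_one h.sound i.1 i.2.1)) (sum_toReal_pmf _).le ?_ (hR i.1 i.2.2)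
      (hW0 i.1 i.2.1 i.2.2) _ n s
    refine (exploreChain_bounded (h := h.coherent)).endAlternative i.2.2 (fun s' hs' => ?_) hI.card_le
    refine hI.ratio_le_pmin.trans (hI.pmin_le i.2.2.1 i.2.2.2 hq s' ?_)
    rw [PMF.mem_support_iff]
    intro h0
    change 0 < (M.Δ i.2.2.1 i.2.2.2 s').toReal at hs'
    rw [h0] at hs'
    simp at hs'
  -- On a path that ends, a surviving window is bounded by the open initial part plus the newly
  -- begun part, and a failure by one summand of `g`. A path that is cut off is not processed; the
  -- reserve left for it pays for a collapse, see `onTheFlyEC_valid`.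
  have hpath : ∀ l, c.IsPath s l → (if (μ.process I m ebar l).Valid M F I m ebar then
        min 1 (β * (μ.process I m ebar l).potential M F I ebar) else 1) ≤ β * ∑ i ∈ windows M, g i l := by
    intro l hl
    have hl' := Memory.process_mem_acts hl
    have hbn : ∀ b q, 0 ≤ μ.budgets (allPairs M.E) I m ebar b q l := fun b q =>
      Memory.budget_nonneg (Memory.process_sound h.sound he l) he b q
    have hn1 : ∀ i : Bool × Bool × (S × A), 0 ≤ μ.window M F I (4 * ebar) i.1 i.2.1 i.2.2 *
        weight i.2.2 (μ.factor M F I ebar i.1 i.2.1 i.2.2) l := fun i =>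
      mul_nonneg (hW0 _ _ _) (weight_nonneg _ (hφ0 _ _ _) l)
    have hn2 : ∀ i : Bool × Bool × (S × A), 0 ≤ excess i.2.2 (tiltMax (4 * ebar))
        (reached i.2.2 (μ.missing m i.1 i.2.2)) l := fun i =>
      excess_nonneg _ hw0 (reached_nonneg _ _) l
    have hn3 : ∀ i : Bool × Bool × (S × A), 0 ≤ excess i.2.2 (tiltMax (4 * ebar))
        (decrease (μ.budgets (allPairs M.E) I m ebar i.1 i.2.2)) l := fun i =>
      excess_nonneg _ hw0 (decrease_nonneg _) l
    have hold : ∀ i : Bool × Bool × (S × A), 0 ≤ (if occ i.2.2 l < μ.missing m i.1 i.2.2 then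
        μ.window M F I (4 * ebar) i.1 i.2.1 i.2.2 *
        weight i.2.2 (μ.factor M F I ebar i.1 i.2.1 i.2.2) l else 0) := fun i => by
      split_ifs
      exacts [hn1 i, le_rfl]
    have hg0 : ∀ i ∈ windows M, 0 ≤ g i l := fun i _ => by
      have h1 := mul_nonneg (hn1 i) (hn2 i)
      have h2 := hn3 i
      have h3 := hbn i.1 i.2.2
      have h4 := hold i
      simp only [g]
      positivity
    rcases Memory.process_dichotomy hI h.coherent h.sound h.good he l hl' with
      ⟨hgood, hwin⟩ | ⟨b, md, q, hq, h1⟩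
    · rw [if_pos (Memory.process_valid h he hgood)]
      refine (min_le_right _ _).trans
        (mul_le_mul_of_nonneg_left (Finset.sum_le_sum fun i hi => ?_) hβ)
      obtain ⟨h2, h3⟩ := hwin i.1 i.2.1 i.2.2 (mem_windows.1 hi)
      have h4 := mul_nonneg (hn1 i) (hn2 i)
      have h5 := hn3 i
      have h6 : (μ.process I m ebar l).window M F I (4 * ebar) i.1 i.2.1 i.2.2 ≤
          (if occ i.2.2 l < μ.missing m i.1 i.2.2 then μ.window M F I (4 * ebar) i.1 i.2.1 i.2.2 *
          weight i.2.2 (μ.factor M F I ebar i.1 i.2.1 i.2.2) l else 0) +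
          excess i.2.2 (tiltMax (4 * ebar))
            (decrease (μ.budgets (allPairs M.E) I m ebar i.1 i.2.2)) l := by
        split_ifs with h7
        · linarith [h2 h7]
        · linarith [h3 (not_lt.1 h7)]
      have h8 : (μ.process I m ebar l).budget (allPairs M.E) ebar i.1 i.2.2 =
        μ.budgets (allPairs M.E) I m ebar i.1 i.2.2 l := rfl
      simp only [g]
      rw [h8]
      linarith
    · have h2 : 1 ≤ β * ∑ i ∈ windows M, g i l := by
        refine h1.trans (mul_le_mul_of_nonneg_left ?_ hβ)
        refine le_trans ?_ (Finset.single_le_sum hg0 (mem_windows.2 hq : (b, md, q) ∈ windows M))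
        have h3 := hbn b q
        have h4 := hold (b, md, q)
        have h5 := hn3 (b, md, q)
        simp only [g] at h4 h5 ⊢
        rw [mul_assoc]
        linarith
      refine le_trans ?_ h2
      split_ifs
      exacts [min_le_left _ _, le_rfl]
  calc _ ≤ c.expect n s (fun l => β * ∑ i ∈ windows M, g i l)
        (fun _ => β * ∑ i ∈ windows M, 4 * μ.budgets (allPairs M.E) I m ebar i.1 i.2.2 []) :=
        c.expect_mono n s (fun l hl _ _ => hpath l hl) fun l _ _ => le_rfl
    _ = β * ∑ i ∈ windows M, c.expect n s (g i)
        (fun _ => 4 * μ.budgets (allPairs M.E) I m ebar i.1 i.2.2 []) := by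
        rw [c.expect_mul, c.expect_sum]
    _ ≤ _ := mul_le_mul_of_nonneg_left (Finset.sum_le_sum hg) hβ

end Potential

/-! ### Progress -/

section Progress

open Chain

variable {S : Type u} {A : Type v} [Fintype S] [DecidableEq S] [DecidableEq A]

/-- A bound for the remaining number of samples that change the learning data. -/
noncomputable def Memory.work (P : Finset (S × A)) (m : ℕ) (ebar : ℝ) (μ : Memory S A) : ℝ :=
  ∑ j ∈ (Finset.univ : Finset Bool) ×ˢ P,
    -- A new window adds at most `m` missing samples, so the factor `m + 1` leaves a net loss of
    -- one.
    ((m + 1) * μ.budget P ebar j.1 j.2 + μ.missing m j.1 j.2)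

/-- Further samples of `q` are ignored as long as no bound changes. -/
def Memory.Settled (μ : Memory S A) (b : Bool) (q : S × A) : Prop :=
  (μ.est b).learn q = false ∧ max (μ.est b).star (μ.partner b) ≤ (μ.est b).last q

variable {M : MDP S A} {F : Finset S} {I : LimitedInfo S A} {hI : I.IsAbout M F} {μ : Memory S A}
  {m : ℕ} {ebar : ℝ} {P : Finset (S × A)} {r : (S × A) × S}

theorem Memory.work_nonneg (h : ∀ b, (μ.est b).Sound m μ.time) (he : 0 < ebar) :
    0 ≤ μ.work P m ebar :=
  Finset.sum_nonneg fun _ _ => add_nonneg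
    (mul_nonneg (by positivity) (Memory.budget_nonneg h he _ _)) (Nat.cast_nonneg _)

theorem Memory.partner_congr {ν : Memory S A} (h : ∀ b, ν.est b = μ.est b) (b : Bool) :
    ν.partner b = μ.partner b := by
  have hU : ν.U = μ.U := h true
  cases b <;> simp [Memory.partner, hU]

theorem Memory.work_congr {ν : Memory S A} (h : ∀ b, ν.est b = μ.est b) (hi : ν.inner = μ.inner) :
    ν.work P m ebar = μ.work P m ebar := by
  have hU : ν.U = μ.U := h true
  have h1 : ∀ b, ν.partnerRoom P ebar b = μ.partnerRoom P ebar b := fun b => by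
    cases b <;> simp [Memory.partnerRoom, hU]
  simp only [Memory.work, Memory.budget, Memory.missing, h, hi, h1, Memory.partner_congr h]

theorem Memory.update_work (h : ∀ b, (μ.est b).Sound m μ.time) (he : 0 < ebar) (hr : r.1 ∈ P) :
    (μ.update I m ebar r).work P m ebar ≤ μ.work P m ebar - 1 ∨
      ((∀ b, (μ.update I m ebar r).est b = μ.est b) ∧ ∀ b, μ.Settled b r.1) := by
  set ν := μ.update I m ebar r with hν
  have hother : ∀ b q, q ≠ r.1 → (m + 1) * ν.budget P ebar b q + ν.missing m b q ≤
      (m + 1) * μ.budget P ebar b q + μ.missing m b q := by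
    intro b q hq
    obtain ⟨_, _, h3, _, h5⟩ := (μ.step I m ebar r b).other hq
    have h6 : ν.missing m b q = μ.missing m b q := by
      unfold Memory.missing
      rw [hν, h3, h5]
    rw [h6]
    have := mul_le_mul_of_nonneg_left (Memory.update_budget_other (I := I) (m := m) (μ := μ) hr he b hq)
      (by positivity : (0 : ℝ) ≤ m + 1)
    linarith
  have hself : ∀ b, (m + 1) * ν.budget P ebar b r.1 + ν.missing m b r.1 ≤
      (m + 1) * μ.budget P ebar b r.1 + μ.missing m b r.1 - 1 ∨
      ((m + 1) * ν.budget P ebar b r.1 + ν.missing m b r.1 ≤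
      (m + 1) * μ.budget P ebar b r.1 + μ.missing m b r.1 ∧
      (μ.est b).learn r.1 = false ∧ max (μ.est b).star (ν.partner b) ≤ (μ.est b).last r.1 ∧
        ν.est b = μ.est b) := by
    intro b
    obtain ⟨h1, h2⟩ := Memory.update_budget_self (I := I) h hr he b
    have h3 := mul_le_mul_of_nonneg_left h1 (by positivity : (0 : ℝ) ≤ m + 1)
    have hcast : ∀ k : ℕ, ν.missing m b r.1 + k ≤ μ.missing m b r.1 →
        (ν.missing m b r.1 : ℝ) + k ≤ μ.missing m b r.1 := fun k hk => by exact_mod_cast hk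
    rcases h2 with ⟨h4, h5, h6, h7, _⟩ | ⟨_, h6, h7, _, h8⟩ | ⟨h4, h5, h6⟩ | ⟨h4, h5, h6⟩
    · left
      have := hcast 1 (by
        unfold Memory.missing
        rw [hν, if_pos h6, if_pos h4, h7]
        omega)
      push_cast at this
      linarith
    · left
      have h9 : ν.missing m b r.1 = m := by
        unfold Memory.missing
        rw [hν, if_pos h6, h7, Nat.sub_zero]
      rw [h9]
      have h10 := mul_le_mul_of_nonneg_left h8 (by positivity : (0 : ℝ) ≤ m + 1)
      have h11 : (0 : ℝ) ≤ μ.missing m b r.1 := Nat.cast_nonneg _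
      rw [hν]
      linarith
    · left
      have := hcast 1 (by
        unfold Memory.missing
        rw [hν, if_neg (by rw [h6]; simp), if_pos h4]
        omega)
      push_cast at this
      linarith
    · right
      have := hcast 0 (by
        unfold Memory.missing
        rw [hν, h6]
        omega)
      push_cast at this
      exact ⟨by linarith, h4, h5, h6⟩
  by_cases hall : ∀ b, (μ.est b).learn r.1 = false ∧
      max (μ.est b).star (ν.partner b) ≤ (μ.est b).last r.1 ∧ ν.est b = μ.est b
  · refine Or.inr ⟨fun b => (hall b).2.2, fun b => ⟨(hall b).1, ?_⟩⟩
    rw [← Memory.partner_congr (ν := ν) (fun b => (hall b).2.2) b]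
    exact (hall b).2.1
  · left
    push Not at hall
    obtain ⟨b₀, hb₀⟩ := hall
    have h1 : ∀ j ∈ (Finset.univ : Finset Bool) ×ˢ P,
        (m + 1) * ν.budget P ebar j.1 j.2 + ν.missing m j.1 j.2 ≤
        ((m + 1) * μ.budget P ebar j.1 j.2 + μ.missing m j.1 j.2) -
          if j = (b₀, r.1) then 1 else 0 := by
      rintro ⟨b, q⟩ _
      dsimp only
      by_cases hq : q = r.1
      · subst hq
        rcases hself b with h2 | ⟨h2, h3, h4, h5⟩
        · split_ifs <;> linarith
        · rw [if_neg, sub_zero]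
          · exact h2
          · intro h6
            obtain rfl : b = b₀ := (Prod.mk.inj h6).1
            exact hb₀ h3 h4 h5
      · rw [if_neg (fun h6 => hq (Prod.mk.inj h6).2), sub_zero]
        exact hother b q hq
    unfold Memory.work
    refine (Finset.sum_le_sum h1).trans ?_
    rw [Finset.sum_sub_distrib, Finset.sum_ite_eq', if_pos (by simp [hr])]

theorem Memory.process_work (h : ∀ b, (μ.est b).Sound m μ.time) (he : 0 < ebar)
    (l : List ((S × A) × S)) (hl : ∀ r ∈ l, r.1 ∈ P) :
    (μ.process I m ebar l).work P m ebar ≤ μ.work P m ebar - 1 ∨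
      ((∀ b, (μ.process I m ebar l).est b = μ.est b) ∧ ∀ r ∈ l, ∀ b, μ.Settled b r.1) := by
  induction l with
  | nil => exact Or.inr ⟨fun _ => rfl, by simp⟩
  | cons r l ih =>
    have h1 := Memory.update_work (I := I) (Memory.process_sound (I := I) h he l) he
      (hl r List.mem_cons_self)
    change (μ.process I m ebar (r :: l)).work P m ebar ≤ (μ.process I m ebar l).work P m ebar - 1 ∨
      (∀ b, (μ.process I m ebar (r :: l)).est b = (μ.process I m ebar l).est b) ∧ _ at h1
    have hi : ∀ l, (μ.process I m ebar l).inner = μ.inner := fun l => (Memory.process_frame l).2.1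
    rcases ih fun p hp => hl p (List.mem_cons_of_mem _ hp) with h2 | ⟨h2, h3⟩
    · left
      rcases h1 with h1 | ⟨h1, _⟩
      · linarith
      · rwa [Memory.work_congr h1 ((hi _).trans (hi l).symm)]
    · have h4 := Memory.work_congr (P := P) (m := m) (ebar := ebar) h2 (hi l)
      rcases h1 with h1 | ⟨h1, h5⟩
      · left; linarith
      · refine Or.inr ⟨fun b => (h1 b).trans (h2 b), fun p hp b => ?_⟩
        rcases List.mem_cons.1 hp with rfl | hp
        · have := h5 b
          unfold Memory.Settled at this ⊢
          rwa [h2 b, Memory.partner_congr h2 b] at this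
        · exact h3 p hp b

theorem Memory.process_work_le (h : ∀ b, (μ.est b).Sound m μ.time) (he : 0 < ebar)
    (l : List ((S × A) × S)) (hl : ∀ r ∈ l, r.1 ∈ P) :
    (μ.process I m ebar l).work P m ebar ≤ μ.work P m ebar := by
  rcases Memory.process_work (I := I) h he l hl with h1 | ⟨h1, _⟩
  · linarith
  · exact (Memory.work_congr h1 (Memory.process_frame l).2.1).le

theorem Memory.process_frozen (p : List ((S × A) × S)) (g : Option (S × A)) (l : List ((S × A) × S)) :
    Memory.process I m ebar { μ with path := p, goal := g } l =
      { μ.process I m ebar l with path := p, goal := g } := by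
  induction l with
  | nil => rfl
  | cons r l ih =>
    change Memory.update I m ebar (Memory.process I m ebar { μ with path := p, goal := g } l) r = _
    rw [ih]
    rfl

theorem Memory.updatePhase_eq (p : List ((S × A) × S)) :
    Memory.updatePhase I m ebar { μ with path := p.reverse ++ [], goal := none } =
      { μ.process I m ebar p with iter := μ.iter + 1, path := [], goal := none } := by
  unfold Memory.updatePhase
  have h1 : (p.reverse ++ []).foldl (Memory.update I m ebar)
      { μ with path := p.reverse ++ [], goal := none } =
      Memory.process I m ebar { μ with path := p.reverse ++ [], goal := none } p := by
    rw [Memory.process, List.append_nil, List.foldl_reverse]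
  dsimp only
  rw [h1, Memory.process_frozen]

/-! ### Collapsing -/

/-- The class contains a pair that was not yet removed, so every budget falls by at least 1. This
pays for the fresh windows, which cost 2 out of 4 in the potential and `m` out of `m + 1` in the
work. Correctness refers to the values in `M` and is not affected; consistency is void, as all pairs
learn again. -/
theorem onTheFlyEC_valid (h : μ.Valid M F I m ebar) {i : ℕ} {s : S}
    {l : List ((S × A) × S)} (hf : (exploreChain M I hI μ h.coherent).FindsClass i l s) :
    (Memory.onTheFlyEC I i { μ with path := l.reverse ++ [], goal := none }).Valid M F I m ebar ∧
    (Memory.onTheFlyEC I i { μ with path := l.reverse ++ [], goal := none }).potential M F I ebar ≤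
      μ.reserve M ebar ∧
    (Memory.onTheFlyEC I i { μ with path := l.reverse ++ [], goal := none }).work
      (allPairs M.E) m ebar ≤ μ.work (allPairs M.E) m ebar - 1 := by
  obtain ⟨t, _, ht, hend, hcount⟩ := hf
  set c := exploreChain M I hI μ h.coherent with hc
  have hB : Memory.appear { μ with path := l.reverse ++ [] } i = c.future t := by
    ext q
    have hbeq : @List.count (S × A) instBEqProd q (l.map Prod.fst) =
        @List.count (S × A) instBEqOfDecidableEq q (l.map Prod.fst) := by
      congr 1
      exact lawful_beq_subsingleton _ _
    rw [Memory.appear, List.append_nil, Finset.mem_filter, List.mem_toFinset, ← hcount q,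
      List.map_reverse, List.count_reverse, hbeq]
    exact ⟨fun h1 => h1.2, fun h1 => ⟨List.mem_reverse.2 (List.count_pos_iff.1 (by omega)), h1⟩⟩
  set ν := Memory.onTheFlyEC I i { μ with path := l.reverse ++ [], goal := none } with hν
  have hcoh : Coherent M F ν.cls ν.inner := onTheFlyEC_coherent ht hend hB
  have hinner : ν.inner = μ.inner ∪ c.future t := by rw [← hB]; rfl
  have hest : ∀ b, ν.est b = Estimate.fresh (μ.est b).val := fun b => by cases b <;> rfl
  have hval : ∀ b, (ν.est b).val = (μ.est b).val := fun b => by rw [hest b]; rfl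
  obtain ⟨a, ha⟩ := M.E_nonempty M.init
  have hm : 0 < m := (Nat.zero_le _).trans_lt ((h.sound true).cnt_lt (M.init, a))
  have hcard : ((allPairs M.E \ ν.inner).card : ℝ) ≤ (allPairs M.E \ μ.inner).card - 1 := by
    obtain ⟨q, hq, hpos⟩ := c.exists_pol_pos hend
    have hqf : q ∈ c.future t := c.mem_future.2 ⟨hq, t, .refl, hend, hpos⟩
    obtain ⟨_, _, _, _, _, _, _, hqi, hqE⟩ := mem_future_explore hqf
    have : (allPairs M.E \ ν.inner).card < (allPairs M.E \ μ.inner).card := by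
      refine Finset.card_lt_card (Finset.ssubset_iff_of_subset ?_ |>.2 ⟨q, ?_, ?_⟩)
      · rw [hinner]
        exact Finset.sdiff_subset_sdiff (Finset.Subset.refl _) Finset.subset_union_left
      · exact Finset.mem_sdiff.2 ⟨mem_allPairs.2 hqE, hqi⟩
      · rw [hinner, Finset.mem_sdiff]
        exact fun h1 => h1.2 (Finset.mem_union_right _ hqf)
    have h2 : (allPairs M.E \ ν.inner).card + 1 ≤ (allPairs M.E \ μ.inner).card := this
    have h3 : ((allPairs M.E \ ν.inner).card : ℝ) + 1 ≤ (allPairs M.E \ μ.inner).card := by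
      exact_mod_cast h2
    linarith
  have hbud : ∀ b q, ν.budget (allPairs M.E) ebar b q ≤ μ.budget (allPairs M.E) ebar b q - 1 := by
    intro b q
    have h1 : (ν.est b).room (allPairs M.E) ebar (sgn b) =
        (μ.est b).room (allPairs M.E) ebar (sgn b) := by
      unfold Estimate.room; rw [hval b]
    have h2 : ν.partnerRoom (allPairs M.E) ebar b = μ.partnerRoom (allPairs M.E) ebar b := by
      cases b with
      | true => rfl
      | false => exact Finset.sum_congr rfl fun p _ => rfl
    have h3 : (ν.est b).pending (max (ν.est b).star (ν.partner b)) q = 0 := by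
      rw [hest b]; simp [Estimate.pending, Estimate.fresh]
    have h4 := (μ.est b).pending_nonneg (max (μ.est b).star (μ.partner b)) q
    unfold Memory.budget
    rw [h1, h2, h3]
    linarith
  refine ⟨⟨hcoh, fun b => ?_, fun b q hq => ⟨?_, fun h1 => ?_⟩⟩, ?_, ?_⟩
  · rw [hest b]
    exact Estimate.sound_fresh hm (h.sound b).val_nonneg (h.sound b).val_le_one
  · rw [hval b]; exact (h.good b q hq).correct
  · rw [hest b] at h1; cases h1
  · refine Finset.sum_le_sum fun j _ => ?_
    have h1 := hbud j.1 j.2.2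
    have h2 : ν.window M F I (4 * ebar) j.1 j.2.1 j.2.2 ≤ 1 :=
      Memory.window_fresh (by rw [hest]; rfl) (by rw [hest]; rfl)
    linarith
  · have h1 : ∀ j ∈ (Finset.univ : Finset Bool) ×ˢ allPairs M.E,
        (m + 1) * ν.budget (allPairs M.E) ebar j.1 j.2 + ν.missing m j.1 j.2 ≤
        ((m + 1) * μ.budget (allPairs M.E) ebar j.1 j.2 + μ.missing m j.1 j.2) - 1 := by
      rintro ⟨b, q⟩ _
      have h2 : ν.missing m b q = m := by
        unfold Memory.missing
        rw [hest b]; simp [Estimate.fresh]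
      dsimp only
      rw [h2]
      have h3 := mul_le_mul_of_nonneg_left (hbud b q) (by positivity : (0 : ℝ) ≤ m + 1)
      have h4 : (0 : ℝ) ≤ μ.missing m b q := Nat.cast_nonneg _
      linarith
    unfold Memory.work
    refine (Finset.sum_le_sum h1).trans ?_
    rw [Finset.sum_sub_distrib, Finset.sum_const, nsmul_eq_mul, mul_one]
    have h2 : 0 < ((Finset.univ : Finset Bool) ×ˢ allPairs M.E).card :=
      Finset.card_pos.2 ⟨(true, (M.init, a)), by simp [mem_allPairs, ha]⟩
    have h3 : (1 : ℝ) ≤ ((Finset.univ : Finset Bool) ×ˢ allPairs M.E).card := by exact_mod_cast h2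
    linarith

end Progress

namespace Chain

variable {Q : Type u} {S : Type v} [Fintype S] (c : Chain Q S)

/-! ### The probability of progress -/

/-- An end can be reached. -/
def CanEnd (s : S) : Prop := c.End s ∨ c.CanHit (fun _ => True) (fun r => c.End r.2) s

theorem canEnd_of_isPath {s : S} {l : List (Q × S)} (hl : c.IsPath s l)
    (he : c.End (lastState s l)) : c.CanEnd s := by
  induction l generalizing s with
  | nil => exact Or.inl he
  | cons r l ih =>
    rcases ih hl.2 he with h | h
    · exact Or.inr (.now r hl.1 trivial h)
    · exact Or.inr (.later r hl.1 trivial h)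

-- A path that reaches an end never visits a state from which no end can be reached. So a path that
-- ends without a transition in `U` avoids the set that is hit in the second term.
open Classical in
theorem expect_forall_not_add_hit_le (U : Q × S → Prop) (n : ℕ) (s : S) :
    c.expect n s (fun l => if ∀ r ∈ l, ¬ U r then 1 else 0) (fun _ => 0) +
      c.hit (fun _ => True) (fun r => U r ∨ ¬ c.CanEnd r.2) n s ≤ 1 := by
  induction n generalizing s with
  | zero => simp [expect, hit]
  | succ n ih =>
    rw [expect, hit]
    split_ifs with hs h
    · simp
    · simp
    rw [← c.avg_add]
    refine (c.avg_mono hs fun r hr => ?_).trans (c.avg_const hs 1).le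
    by_cases hU : U r
    · rw [if_pos (Or.inl hU)]
      have h1 : ∀ l : List (Q × S), (if ∀ p ∈ r :: l, ¬ U p then (1 : ℝ) else 0) = 0 := fun l =>
        if_neg fun h => h r List.mem_cons_self hU
      simp only [h1]
      rw [c.expect_const, zero_add]
    · have h1 : ∀ l : List (Q × S), (if ∀ p ∈ r :: l, ¬ U p then (1 : ℝ) else 0) =
          if ∀ p ∈ l, ¬ U p then 1 else 0 := fun l => by
        refine if_congr ?_ rfl rfl
        simp [hU]
      simp only [h1]
      by_cases hE : c.CanEnd r.2
      · rw [if_neg (by tauto)]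
        exact ih r.2
      · rw [if_pos (Or.inr hE)]
        have h2 : c.expect n r.2 (fun l => if ∀ p ∈ l, ¬ U p then 1 else 0) (fun _ => 0) ≤
            c.expect n r.2 (fun _ => 0) (fun _ => 0) :=
          c.expect_mono n r.2 (fun l h3 _ h4 => absurd (c.canEnd_of_isPath h3 h4) hE) fun _ _ _ => le_rfl
        rw [c.expect_const] at h2
        linarith

variable {c} in
/-- A function that vanishes at ends and loses at most `a` per transition is small. -/
theorem Bounded.mul_le_of_le_avg {x : ℝ} {blk : S → Finset S} (hc : c.Bounded x blk) {G : S → ℝ} {a : ℝ}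
    (ha : 0 ≤ a) {s₀ : S} (hend : ∀ s, c.End s → G s = 0)
    (hcan : ∀ s, c.Reach s₀ s → ¬ c.End s → c.CanHit (fun _ => True) (fun r => c.End r.2) s)
    (hG : ∀ s, c.Reach s₀ s → ¬ c.End s → G s ≤ a + c.avg s fun r => G r.2) {K : ℕ}
    (hK : Fintype.card S ≤ K) : x ^ K * G s₀ ≤ a * K := by
  classical
  obtain ⟨t, ht, hmax⟩ := (Finset.univ.filter fun t => c.Reach s₀ t).exists_max_image G
    ⟨s₀, Finset.mem_filter.2 ⟨Finset.mem_univ s₀, .refl⟩⟩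
  rw [Finset.mem_filter] at ht
  have hmax' : ∀ s, c.Reach s₀ s → G s ≤ G t := fun s hs =>
    hmax s (Finset.mem_filter.2 ⟨Finset.mem_univ s, hs⟩)
  have hx := pow_pos hc.pos K
  have haK : 0 ≤ a * K := mul_nonneg ha (Nat.cast_nonneg K)
  have h0 := hmax' s₀ .refl
  by_cases hpos : G t ≤ 0
  · exact (mul_nonpos_of_nonneg_of_nonpos hx.le (h0.trans hpos)).trans haK
  push Not at hpos
  -- Within `n` steps `G` loses at most `a * n`. Then either an end has been hit, where `G`
  -- vanishes, or `G` is at most its maximum `G t`. At the maximiser itself, hitting with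
  -- probability at least `x ^ K` gives the claim.
  have key : ∀ n : ℕ, ∀ s, c.Reach s₀ s →
      G s ≤ a * n + (1 - c.hit (fun _ => True) (fun r => c.End r.2) n s) * G t := by
    intro n
    induction n with
    | zero => intro s hs; simpa [hit] using hmax' s hs
    | succ n ih =>
      intro s hs
      by_cases he : c.End s
      · rw [hend s he]
        have h1 := c.hit_le_one (fun _ => True) (fun r => c.End r.2) (n + 1) s
        have h2 := mul_nonneg (sub_nonneg.2 h1) hpos.le
        positivity
      · have h1 : (c.avg s fun r => G r.2) ≤
            c.avg s fun r => a * n + (G t + (-G t) * (if True then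
              (if c.End r.2 then 1 else c.hit (fun _ => True) (fun r => c.End r.2) n r.2) else 0)) := by
          refine c.avg_mono he fun r hr => ?_
          rw [if_pos trivial]
          have hr' : c.Reach s₀ r.2 := hs.tail ⟨r.1, hr⟩
          split_ifs with h2
          · rw [hend _ h2]
            have : 0 ≤ a * n := mul_nonneg ha (Nat.cast_nonneg n)
            linarith
          · linarith [ih r.2 hr']
        rw [c.avg_add, c.avg_add, c.avg_const he, c.avg_const he, c.avg_mul] at h1
        rw [hit, if_neg he]
        have h2 := hG s hs he
        push_cast
        simp only [if_true] at h1 ⊢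
        linarith
  have hte : ¬ c.End t := fun h => hpos.ne' (hend t h)
  have h1 := hc.le_hit (hcan t ht.2 hte) (k := K) (fun X _ => (Finset.card_le_univ X).trans hK) hK
  have h2 := key K t ht.2
  have h3 := mul_le_mul_of_nonneg_right h1 hpos.le
  have h4 := mul_le_mul_of_nonneg_left h0 hx.le
  linarith

end Chain

/-! ### The gap between the bounds along settled pairs -/

section Gap

open Chain

variable {S : Type u} {A : Type v} [Fintype S] [DecidableEq S] [DecidableEq A]
variable {M : MDP S A} {F : Finset S} {I : LimitedInfo S A} {hI : I.IsAbout M F} {μ : Memory S A}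
  {m : ℕ} {ebar : ℝ}

theorem mean_sub (M : MDP S A) (q : S × A) (f g : S → ℝ) :
    mean M q f - mean M q g = mean M q fun s => f s - g s := by
  simp only [mean, mul_sub, Finset.sum_sub_distrib]

/-- If all greedy pairs are settled, the distance of the bounds loses at most `6 * ebar` per
transition. -/
theorem Memory.gap_le_avg (h : μ.Valid M F I m ebar) {s : S} (hs : ¬ (μ.cls s).IsEnd)
    (hset : ∀ q ∈ μ.greedy I (μ.cls s), ∀ b, μ.Settled b q) :
    μ.bound I true s - μ.bound I false s ≤ 6 * ebar +
      (exploreChain M I hI μ h.coherent).avg s fun r => μ.bound I true r.2 - μ.bound I false r.2 := by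
  classical
  obtain ⟨R, hR⟩ := exists_block hs
  set c := exploreChain M I hI μ h.coherent with hc
  have key : ∀ q ∈ μ.greedy I (μ.cls s), μ.bound I true s - μ.bound I false s ≤
      6 * ebar + mean M q fun s' => μ.bound I true s' - μ.bound I false s' := by
    intro q hq
    have hq' := mem_greedy.1 hq
    have hmem := hq'.1
    rw [Memory.enabledAt, mem_available, hI.E_eq] at hmem
    have hP := mem_allPairs.2 hmem.2.1
    have h1 := (h.good true q hP).consistent (hset q hq true).1 ((le_max_left _ _).trans (hset q hq true).2)
    have h2 := (h.good false q hP).consistent (hset q hq false).1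
      ((le_max_left _ _).trans (hset q hq false).2)
    -- A greedy pair attains the upper bound of its node, and its lower bound is at most that of the
    -- node. Consistency then costs `3 * ebar` for each of the two.
    have h3 : μ.bound I true s ≤ (μ.est true).val q := by
      rw [Memory.bound, hR]
      rw [hR] at hq'
      obtain ⟨p, hp, h4, _⟩ := maxOver_spec ⟨q, hq'.1⟩ (μ.est true).val
      rw [Memory.nodeVal, h4]
      exact hq'.2 p hp
    have h4 : (μ.est false).val q ≤ μ.bound I false s := by
      rw [Memory.bound, hR]
      rw [hR] at hq'
      exact le_maxOver hq'.1
    rw [← mean_sub]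
    simp only [sgn] at h1 h2
    linarith
  have h1 : μ.bound I true s - μ.bound I false s =
      c.avg s fun _ => μ.bound I true s - μ.bound I false s := (c.avg_const hs _).symm
  rw [h1, ← c.avg_const (s := s) hs (6 * ebar), ← c.avg_add]
  refine c.avg_mono_act fun q hq hpos => ?_
  have hgr : q ∈ μ.greedy I (μ.cls s) := by
    by_contra h2
    have : c.pol s q = 0 := if_neg h2
    rw [this] at hpos
    exact lt_irrefl _ hpos
  have h2 := key q hgr
  have h3 : ∑ s', c.D q s' * (6 * ebar + (μ.bound I true s' - μ.bound I false s')) =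
      6 * ebar + mean M q fun s' => μ.bound I true s' - μ.bound I false s' := by
    simp only [mul_add, Finset.sum_add_distrib, ← Finset.sum_mul]
    rw [c.D_sum q hq, one_mul]
    rfl
  dsimp only
  rw [h3, ← Finset.sum_mul, c.D_sum q hq, one_mul]
  exact h2

-- Suppose that from `s₀` neither an unsettled pair nor a state without access to an end could be
-- met. By `gap_le_avg` and `mul_le_of_le_avg` the gap would then be too small for `hgap`. So such a
-- transition can be reached, and by `le_hit` it is met with probability at least `(pmin / Em) ^ K`.
open Classical in
theorem Memory.expect_settled_le (h : μ.Valid M F I m ebar) (he : 0 < ebar) {s₀ : S}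
    (hgap : 6 * ebar * I.K < (I.pmin / I.Em) ^ I.K * (μ.bound I true s₀ - μ.bound I false s₀))
    {n : ℕ} (hn : Fintype.card S ≤ n) :
    (exploreChain M I hI μ h.coherent).expect n s₀
      (fun l => if ∀ r ∈ l, ∀ b, μ.Settled b r.1 then 1 else 0) (fun _ => 0) ≤
      1 - (I.pmin / I.Em) ^ I.K := by
  set c := exploreChain M I hI μ h.coherent with hc
  have hb : c.Bounded _ _ := exploreChain_bounded (hI := hI) (h := h.coherent)
  have hGend : ∀ s, c.End s → μ.bound I true s - μ.bound I false s = 0 := by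
    intro s hs
    change (μ.cls s).IsEnd at hs
    unfold Memory.bound
    cases hs' : μ.cls s with
    | one => simp [Memory.nodeVal]
    | zero => simp [Memory.nodeVal]
    | block R => rw [hs'] at hs; exact absurd hs (fun h => h)
  have h1 := c.expect_forall_not_add_hit_le (fun r => ¬ ∀ b, μ.Settled b r.1) n s₀
  simp only [not_not] at h1
  suffices hcan : c.CanHit (fun _ => True)
      (fun r => (¬ ∀ b, μ.Settled b r.1) ∨ ¬ c.CanEnd r.2) s₀ by
    have h2 := hb.le_hit hcan (k := I.K) (fun X _ => (Finset.card_le_univ X).trans hI.card_le) hn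
    linarith
  by_contra hcan
  have hno : ∀ s, c.Reach s₀ s → ∀ r, c.Pos s r → (∀ b, μ.Settled b r.1) ∧ c.CanEnd r.2 := by
    intro s hs r hr
    by_contra h2
    refine hcan (c.canHit_of_reach hs (.now r hr trivial ?_))
    tauto
  have hact : ∀ s, ¬ c.End s → ∃ r, c.Pos s r := by
    intro s hs
    obtain ⟨q, hq, hpos⟩ := c.exists_pol_pos hs
    obtain ⟨s', hs'⟩ := c.exists_D_pos hq
    exact ⟨(q, s'), hs, hq, hpos, hs'⟩
  refine absurd (hb.mul_le_of_le_avg (a := 6 * ebar)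
    (G := fun s => μ.bound I true s - μ.bound I false s) (by positivity) hGend
    (fun s hs hse => ?_) (fun s hs hse => ?_) hI.card_le) (not_le.2 hgap)
  · obtain ⟨r, hr⟩ := hact s hse
    rcases (hno s hs r hr).2 with h2 | h2
    · exact .now r hr trivial h2
    · exact .later r hr trivial h2
  · refine Memory.gap_le_avg h hse fun q hq => ?_
    obtain ⟨s', hs'⟩ := (M.Δ q.1 q.2).support_nonempty
    exact (hno s hs (q, s') (exploreChain_pos.2 ⟨hse, hq, hs'⟩)).1

end Gap

/-! ### The probability of failure -/

section Failure

open Chain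

variable {S : Type u} {A : Type v} [Fintype S] [DecidableEq S] [DecidableEq A]
variable {M : MDP S A} {F : Finset S} {I : LimitedInfo S A} {μ : Memory S A}
  {m : ℕ} {ebar : ℝ}

theorem Memory.Valid.frozen (h : μ.Valid M F I m ebar) (i : ℕ) (p : List ((S × A) × S))
    (g : Option (S × A)) : Memory.Valid M F I m ebar { μ with iter := i, path := p, goal := g } :=
  ⟨h.coherent, fun b => h.sound b, fun b q hq => ⟨(h.good b q hq).correct, (h.good b q hq).consistent⟩⟩

theorem Memory.potential_frozen (i : ℕ) (p : List ((S × A) × S)) (g : Option (S × A)) :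
    Memory.potential M F I ebar { μ with iter := i, path := p, goal := g } =
      μ.potential M F I ebar := by
  refine Finset.sum_congr rfl fun j _ => ?_
  obtain ⟨b, md, q⟩ := j
  cases b <;> cases md <;> rfl

theorem Memory.work_frozen (P : Finset (S × A)) (i : ℕ) (p : List ((S × A) × S))
    (g : Option (S × A)) : Memory.work P m ebar { μ with iter := i, path := p, goal := g } =
      μ.work P m ebar :=
  Memory.work_congr (fun b => by cases b <;> rfl) rfl

theorem Memory.Valid.correctOutput (hI : I.IsAbout M F) (h : μ.Valid M F I m ebar) {ε : ℝ}
    (hgap : μ.upper I I.init - μ.lower I I.init < ε) : CorrectOutput M F I ε μ := by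
  rw [hI.init_eq] at hgap
  have h1 := Memory.bound_correct hI h.coherent (fun q hq => (h.good true q hq).correct) M.init
  have h2 := Memory.bound_correct hI h.coherent (fun q hq => (h.good false q hq).correct) M.init
  have hU : μ.bound I true M.init = μ.upper I M.init := rfl
  have hL : μ.bound I false M.init = μ.lower I M.init := rfl
  rw [hU] at h1
  rw [hL] at h2
  simp only [sgn] at h1 h2
  refine ⟨by linarith, by linarith, hgap, fun q hq => ?_⟩
  rw [Memory.enabledAt, mem_available, hI.E_eq] at hq
  have hq' := mem_allPairs.2 hq.2.1
  have h3 := (h.good true q hq').correct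
  have h4 := (h.good false q hq').correct
  have hU' : (μ.est true).val q = μ.U.val q := rfl
  have hL' : (μ.est false).val q = μ.L.val q := rfl
  rw [hU'] at h3
  rw [hL'] at h4
  simp only [sgn] at h3 h4
  constructor <;> linarith

-- Induction on the work that is left, and within it on the number `k` of phases that may pass
-- without progress. A phase is idle with probability at most `1 - θ`, so the extra term `(1 - θ) ^
-- k` disappears in the limit. The term `δ / 2 ^ iter` is the sum of the collapse errors `δ / 2 / 2
-- ^ i` from the current iteration on. The factor `β` is left open because it is 0 in the case of a
-- single state.
open Classical in
theorem failProb_le (hI : I.IsAbout M F) {ε δ β : ℝ} {ℓ : ℕ → ℕ} (he : 0 < ebar) (hδ : 0 ≤ δ)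
    (hε : 6 * ebar * I.K < (I.pmin / I.Em) ^ I.K * ε) (hβ : 0 ≤ β)
    (hupdate : ∀ (μ : Memory S A) (h : μ.Valid M F I m ebar), ¬ (μ.cls M.init).IsEnd → ∀ n,
      (exploreChain M I hI μ h.coherent).expect n M.init
        (fun l => if (μ.process I m ebar l).Valid M F I m ebar then
          min 1 (β * (μ.process I m ebar l).potential M F I ebar) else 1)
        (fun _ => β * μ.reserve M ebar) ≤ β * μ.potential M F I ebar)
    (hcap : ∀ (μ : Memory S A) (h : μ.Valid M F I m ebar), 1 ≤ μ.iter →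
      (exploreChain M I hI μ h.coherent).expect (3 * ℓ μ.iter ^ 3 - 1) M.init (fun _ => 0)
        (fun l => if (exploreChain M I hI μ h.coherent).FindsClass (ℓ μ.iter) l M.init then 0 else 1) ≤
        δ / 2 / 2 ^ μ.iter)
    (hcard : ∀ i, 1 ≤ i → Fintype.card S < 3 * ℓ i ^ 3) (n : ℕ) :
    ∀ μ : Memory S A, μ.Valid M F I m ebar → μ.path = [] → μ.goal = none → 1 ≤ μ.iter →
      μ.work (allPairs M.E) m ebar < n →
      (algorithm I ε m ebar ℓ).failProb M (CorrectOutput M F I ε) (.running μ M.init) ≤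
        δ / 2 ^ μ.iter + β * μ.potential M F I ebar := by
  set fail : Memory S A → ℝ := fun μ =>
    (algorithm I ε m ebar ℓ).failProb M (CorrectOutput M F I ε) (.running μ M.init) with hfail
  have hfail1 : ∀ μ, fail μ ≤ 1 := fun μ => SimAlgorithm.failProb_le_one ..
  induction n with
  | zero =>
    intro μ hv _ _ _ hw
    have := Memory.work_nonneg (P := allPairs M.E) hv.sound he
    rw [Nat.cast_zero] at hw
    exact absurd hw (not_lt.2 this)
  | succ n ihn =>
    set θ := (I.pmin / I.Em) ^ I.K with hθ
    have hθ0 : 0 < θ := pow_pos hI.ratio_pos _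
    have hθ1 : θ ≤ 1 := pow_le_one₀ hI.ratio_pos.le hI.ratio_le_one
    have key : ∀ k : ℕ, ∀ μ : Memory S A, μ.Valid M F I m ebar → μ.path = [] → μ.goal = none →
        1 ≤ μ.iter → μ.work (allPairs M.E) m ebar < (n + 1 : ℕ) →
        fail μ ≤ δ / 2 ^ μ.iter + β * μ.potential M F I ebar + (1 - θ) ^ k := by
      intro k
      induction k with
      | zero =>
        intro μ hv _ _ _ _
        have h1 : 0 ≤ δ / 2 ^ μ.iter := by positivity
        have h2 := mul_nonneg hβ (Memory.potential_nonneg (M := M) (F := F) (I := I) hv.sound he)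
        rw [pow_zero]
        linarith [hfail1 μ]
      | succ k ihk =>
        intro μ hv hpath hgoal hiter hwork
        have hδ0 : 0 ≤ δ / 2 ^ (μ.iter + 1) := by positivity
        have h1θ : 0 ≤ 1 - θ := by linarith
        have hpk : 0 ≤ (1 - θ) ^ k := pow_nonneg h1θ k
        by_cases hgap : μ.upper I I.init - μ.lower I I.init < ε
        · have h0 : fail μ = 0 := failProb_halt _ ε m ebar ℓ hpath hgoal hgap
            (hv.correctOutput hI hgap) M.init
          rw [h0]
          have h1 : 0 ≤ δ / 2 ^ μ.iter := by positivity
          have h2 := mul_nonneg hβ (Memory.potential_nonneg (M := M) (F := F) (I := I) hv.sound he)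
          have h3 := pow_nonneg h1θ (k + 1)
          linarith
        push Not at hgap
        have hε0 : 0 < ε := by
          by_contra h
          push Not at h
          have : 0 ≤ 6 * ebar * I.K := by positivity
          have := mul_nonpos_of_nonneg_of_nonpos hθ0.le h
          linarith
        have hend : ¬ (μ.cls M.init).IsEnd := by
          intro h
          rw [hI.init_eq] at hgap
          unfold Memory.upper Memory.lower at hgap
          cases hs : μ.cls M.init with
          | one => rw [hs] at hgap; simp only [Memory.nodeVal] at hgap; linarith
          | zero => rw [hs] at hgap; simp only [Memory.nodeVal] at hgap; linarith
          | block R => rw [hs] at h; exact h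
        set c := exploreChain M I hI μ hv.coherent with hc
        set N := 3 * ℓ μ.iter ^ 3 - 1 with hN
        have hNc := hcard μ.iter hiter
        have hμ : ({ μ with path := [], goal := none } : Memory S A) = μ := by
          rw [← hpath, ← hgoal]
        have hrun := failProb_running_le (CorrectOutput M F I ε) ε m ebar ℓ hI hv.coherent hgap N
          M.init [] (by rw [List.length_nil]; omega)
        rw [hμ] at hrun
        refine hrun.trans ?_
        set a := δ / 2 ^ (μ.iter + 1) with ha
        have hterm : ∀ l, c.IsPath M.init l →
            fail (Memory.updatePhase I m ebar { μ with path := l.reverse ++ [], goal := none }) ≤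
            a + (if (μ.process I m ebar l).Valid M F I m ebar then
              min 1 (β * (μ.process I m ebar l).potential M F I ebar) else 1) +
              (1 - θ) ^ k * (if ∀ r ∈ l, ∀ b, μ.Settled b r.1 then 1 else 0) := by
          intro l hl
          have hl' := Memory.process_mem_acts hl
          rw [Memory.updatePhase_eq]
          by_cases hval : (μ.process I m ebar l).Valid M F I m ebar
          · rw [if_pos hval]
            have h1 := hval.frozen (μ.iter + 1) [] none
            have h2 := Memory.process_work (I := I) hv.sound he l hl'
            have h3 := Memory.process_work_le (I := I) hv.sound he l hl'
            have h4 := Memory.work_frozen (m := m) (ebar := ebar) (μ := μ.process I m ebar l)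
              (allPairs M.E) (μ.iter + 1) [] none
            have h5 := Memory.potential_frozen (M := M) (F := F) (I := I) (ebar := ebar)
              (μ := μ.process I m ebar l) (μ.iter + 1) [] none
            set ν : Memory S A := { μ.process I m ebar l with
              iter := μ.iter + 1, path := [], goal := none } with hν
            have h6 := hfail1 ν
            rw [← h5]
            split_ifs with hset
            -- All pairs of the path are settled: the work need not have fallen, and only `k`
            -- decreases.
            · have h7 : fail ν ≤ a + β * ν.potential M F I ebar + (1 - θ) ^ k :=
                ihk ν h1 rfl rfl (Nat.succ_pos _) (by rw [h4]; exact h3.trans_lt hwork)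
              rcases le_total 1 (β * ν.potential M F I ebar) with h8 | h8
              · rw [min_eq_left h8]; linarith
              · rw [min_eq_right h8]; linarith
            · have h9 : (μ.process I m ebar l).work (allPairs M.E) m ebar < n := by
                rcases h2 with h2 | ⟨_, h2⟩
                · push_cast at hwork; linarith
                · exact absurd h2 hset
              have h7 : fail ν ≤ a + β * ν.potential M F I ebar :=
                ihn ν h1 rfl rfl (Nat.succ_pos _) (by rw [h4]; exact h9)
              rcases le_total 1 (β * ν.potential M F I ebar) with h8 | h8
              · rw [min_eq_left h8]; linarith
              · rw [min_eq_right h8]; linarith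
          · rw [if_neg hval]
            have h6 := hfail1 { μ.process I m ebar l with iter := μ.iter + 1, path := [], goal := none }
            have h7 : 0 ≤ (1 - θ) ^ k * (if ∀ r ∈ l, ∀ b, μ.Settled b r.1 then 1 else 0) := by
              refine mul_nonneg hpk ?_
              split_ifs <;> norm_num
            linarith
        have hcol : ∀ l, fail (Memory.onTheFlyEC I (ℓ μ.iter)
              { μ with path := l.reverse ++ [], goal := none }) ≤
            a + β * μ.reserve M ebar +
              (if c.FindsClass (ℓ μ.iter) l M.init then 0 else 1) := by
          intro l
          have hres : 0 ≤ μ.reserve M ebar := Finset.sum_nonneg fun j _ =>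
            mul_nonneg zero_le_four (Memory.budget_nonneg hv.sound he _ _)
          split_ifs with hf
          · obtain ⟨h1, h2, h3⟩ := onTheFlyEC_valid hv hf
            have h4 := ihn _ h1 rfl rfl (Nat.succ_pos _) (by
              push_cast at hwork
              exact h3.trans_lt (by linarith))
            have h5 := mul_le_mul_of_nonneg_left h2 hβ
            refine h4.trans ?_
            rw [add_zero]
            exact add_le_add le_rfl h5
          · have := mul_nonneg hβ hres
            linarith [hfail1 (Memory.onTheFlyEC I (ℓ μ.iter)
              { μ with path := l.reverse ++ [], goal := none })]
        have hgap' : 6 * ebar * I.K < θ * (μ.bound I true M.init - μ.bound I false M.init) := by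
          refine hε.trans_le (mul_le_mul_of_nonneg_left ?_ hθ0.le)
          rw [hI.init_eq] at hgap
          exact hgap
        have hset := Memory.expect_settled_le (hI := hI) hv he hgap' (n := N) (by omega)
        have hup := hupdate μ hv hend N
        have hca := hcap μ hv hiter
        have haa : a + δ / 2 / 2 ^ μ.iter = δ / 2 ^ μ.iter := by
          rw [ha, pow_succ]; field_simp; ring
        calc _ ≤ c.expect N M.init (fun l => a + (if (μ.process I m ebar l).Valid M F I m ebar then
              min 1 (β * (μ.process I m ebar l).potential M F I ebar) else 1) +
              (1 - θ) ^ k * (if ∀ r ∈ l, ∀ b, μ.Settled b r.1 then 1 else 0))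
              (fun l => a + β * μ.reserve M ebar +
                (if c.FindsClass (ℓ μ.iter) l M.init then 0 else 1)) :=
              c.expect_mono N M.init (fun l hl _ _ => hterm l hl) fun l _ _ => hcol l
          _ = a + c.expect N M.init (fun l => if (μ.process I m ebar l).Valid M F I m ebar then
              min 1 (β * (μ.process I m ebar l).potential M F I ebar) else 1)
                (fun _ => β * μ.reserve M ebar) +
              (1 - θ) ^ k * c.expect N M.init
                (fun l => if ∀ r ∈ l, ∀ b, μ.Settled b r.1 then 1 else 0) (fun _ => 0) +
              c.expect N M.init (fun _ => 0)
                (fun l => if c.FindsClass (ℓ μ.iter) l M.init then 0 else 1) := by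
              rw [← c.expect_const N M.init a, ← c.expect_mul, ← c.expect_add, ← c.expect_add,
                ← c.expect_add]
              simp only [c.expect_const]
              refine c.expect_congr N M.init (fun l _ _ _ => ?_) fun l _ _ => ?_ <;> ring
          _ ≤ a + β * μ.potential M F I ebar + (1 - θ) ^ k * (1 - θ) + δ / 2 / 2 ^ μ.iter :=
              add_le_add (add_le_add (add_le_add le_rfl hup)
                (mul_le_mul_of_nonneg_left hset hpk)) hca
          _ = _ := by rw [pow_succ, ← haa]; ring
    intro μ hv hpath hgoal hiter hwork
    have hlim : Filter.Tendsto (fun k : ℕ => δ / 2 ^ μ.iter + β * μ.potential M F I ebar +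
        (1 - θ) ^ k) Filter.atTop (nhds (δ / 2 ^ μ.iter + β * μ.potential M F I ebar + 0)) :=
      (tendsto_pow_atTop_nhds_zero_of_lt_one (by linarith) (by linarith)).const_add _
    rw [add_zero] at hlim
    exact ge_of_tendsto' hlim fun k => key k μ hv hpath hgoal hiter hwork

end Failure

/-! ### Parameters -/

section Parameters

variable {S : Type u} {A : Type v} [Fintype S] [DecidableEq S] [DecidableEq A]
variable {M : MDP S A} {F : Finset S} {I : LimitedInfo S A} {μ : Memory S A}
  {m : ℕ} {ebar : ℝ}

theorem epsBar_pos (hI : I.IsAbout M F) {ε : ℝ} (hε : 0 < ε) : 0 < epsBar I ε := by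
  have h1 := pow_pos hI.ratio_pos I.K
  have h2 : (0 : ℝ) < I.K := Nat.cast_pos.2 hI.one_le_K
  unfold epsBar
  positivity

theorem epsBar_mul (hI : I.IsAbout M F) (ε : ℝ) :
    12 * I.K * epsBar I ε = ε * (I.pmin / I.Em) ^ I.K := by
  have h2 : (I.K : ℝ) ≠ 0 := Nat.cast_ne_zero.2 (Nat.one_le_iff_ne_zero.1 hI.one_le_K)
  unfold epsBar
  field_simp

/-- With `u ≤ 5 * y / 24`, the estimates `exp u - 1 ≤ 29 * u / 24` and `exp u ≤ 4 / 3` leave ample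
room. -/
theorem tiltMax_bound {lam y : ℝ} (h0 : 0 ≤ lam) (h1 : lam ≤ y / 6) (hy : y ≤ 1) :
    2 * (tiltMax lam - 1) * tiltMax lam ≤ y := by
  set u := lam + lam ^ 2 / 8 with hu
  have hu0 : 0 ≤ u := by positivity
  have hu1 : u ≤ 5 / 24 * y := by nlinarith
  have hu2 : u ≤ 5 / 24 := by linarith
  have h2 := (abs_le.1 (Real.abs_exp_sub_one_sub_id_le (x := u) (by rw [abs_of_nonneg hu0]; linarith))).2
  have h3 : Real.exp u - 1 ≤ 29 / 24 * u := by nlinarith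
  have h4 : 1 ≤ Real.exp u := Real.one_le_exp hu0
  have h5 : Real.exp u ≤ 4 / 3 := by linarith
  change 2 * (Real.exp u - 1) * Real.exp u ≤ y
  nlinarith

/-- At most `l - 1` pairs give the prefactor `1 + (l + 1) * (l - 1) = l ^ 2`. Rounding `l / κ` down
costs a factor at most `exp 1 ≤ 3`, and `3 * l ^ 2 ≤ 2 * l ^ 3`. -/
theorem capBound_le {y l κ P : ℝ} {j : ℕ} (hy : 0 < y) (hy1 : y ≤ 1) (hl : 2 ≤ l)
    (hP : P ≤ l - 1) (hj : l / κ - 1 ≤ j) {c : ℝ} (hc : c = Real.exp (-(y / κ) * l)) {z : ℝ}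
    (hz0 : 0 ≤ 1 - z) (hz : y ≤ z) :
    (1 + (l + 1) * P) * (1 - z) ^ j ≤ 2 * c * l ^ 3 * y⁻¹ := by
  have h1 : (1 - z) ^ j ≤ Real.exp (-y * j) := by
    have h2 : 1 - z ≤ Real.exp (-y) := by
      have := Real.add_one_le_exp (-y)
      linarith
    rw [mul_comm (-y), Real.exp_nat_mul]
    exact pow_le_pow_left₀ hz0 h2 j
  have h2 : Real.exp (-y * j) ≤ c * 3 := by
    have h3 : Real.exp (-y * j) ≤ Real.exp (-(y / κ) * l) * Real.exp 1 := by
      rw [← Real.exp_add]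
      refine Real.exp_le_exp.2 ?_
      have h4 := mul_le_mul_of_nonneg_left hj hy.le
      have h5 : y * (l / κ - 1) = y / κ * l - y := by ring
      linarith
    rw [hc]
    refine h3.trans (mul_le_mul_of_nonneg_left ?_ (Real.exp_nonneg _))
    linarith [Real.exp_one_lt_d9]
  have hc0 : 0 ≤ c := by rw [hc]; exact Real.exp_nonneg _
  have h3 : 1 + (l + 1) * P ≤ l ^ 2 := by nlinarith
  have h4 : (1 : ℝ) ≤ y⁻¹ := (one_le_inv₀ hy).2 hy1
  calc (1 + (l + 1) * P) * (1 - z) ^ j ≤ l ^ 2 * (c * 3) :=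
        mul_le_mul h3 (h1.trans h2) (pow_nonneg hz0 j) (sq_nonneg l)
    _ ≤ 2 * c * l ^ 3 * 1 := by nlinarith [mul_nonneg hc0 (sq_nonneg l)]
    _ ≤ _ := mul_le_mul_of_nonneg_left h4 (by positivity)

theorem card_allPairs_le_mul (hI : I.IsAbout M F) : (allPairs M.E).card ≤ I.K * I.Em := by
  rw [card_allPairs]
  calc ∑ s, (M.E s).card ≤ ∑ _s : S, I.Em := Finset.sum_le_sum fun s _ => hI.enabled_le s
    _ = Fintype.card S * I.Em := by simp
    _ ≤ _ := Nat.mul_le_mul_right _ hI.card_le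

theorem card_le_kappa (hI : I.IsAbout M F) : Fintype.card S ≤ kappa I := by
  unfold kappa
  exact (hI.card_le.trans (Nat.le_mul_of_pos_right _ hI.one_le_Em)).trans (Nat.le_succ _)

theorem two_le_kappa (hI : I.IsAbout M F) : 2 ≤ kappa I := by
  have := Nat.mul_pos hI.one_le_K hI.one_le_Em
  unfold kappa; omega

open Classical in
theorem expect_cap_le (hI : I.IsAbout M F) (h : Coherent M F μ.cls μ.inner) {δ : ℝ} {ℓ : ℕ → ℕ}
    (hℓ : Admissible I δ ℓ) {i : ℕ} (hi : 1 ≤ i) :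
    (exploreChain M I hI μ h).expect (3 * ℓ i ^ 3 - 1) M.init (fun _ => 0)
        (fun l => if (exploreChain M I hI μ h).FindsClass (ℓ i) l M.init then 0 else 1) ≤
      δ / 2 / 2 ^ i := by
  obtain ⟨h1, h2⟩ := hℓ i hi
  have hκ := two_le_kappa hI
  have hl2 : 2 ≤ ℓ i := hκ.trans h1
  have hN : (ℓ i + 2) * ℓ i ≤ 3 * ℓ i ^ 3 - 1 := by
    refine Nat.le_sub_of_add_le ?_
    nlinarith [Nat.mul_le_mul hl2 (Nat.mul_le_mul hl2 (le_refl (ℓ i)))]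
  refine (Chain.Bounded.expect_not_findsClass_le (exploreChain_bounded (hI := hI) (h := h))
    (card_le_kappa hI) (by omega) hN M.init).trans (le_trans ?_ h2)
  have hx := hI.ratio_pos
  have hx1 := hI.ratio_le_one
  have hκ0 : (0 : ℝ) < kappa I := by positivity
  have hP : ((exploreChain M I hI μ h).acts.card : ℝ) ≤ (ℓ i : ℝ) - 1 := by
    have h3 : (allPairs M.E).card + 1 ≤ ℓ i :=
      (Nat.add_le_add_right (card_allPairs_le_mul hI) 1).trans h1
    have h4 : (((allPairs M.E).card + 1 : ℕ) : ℝ) ≤ ℓ i := Nat.cast_le.2 h3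
    push_cast at h4
    change ((allPairs M.E).card : ℝ) ≤ _
    linarith
  refine capBound_le (κ := kappa I) (pow_pos hx _) (pow_le_one₀ hx.le hx1) (by exact_mod_cast hl2) hP ?_ ?_ ?_ ?_
  · have h5 : ℓ i < kappa I * (ℓ i / kappa I) + kappa I := by
      have h6 := Nat.div_add_mod (ℓ i) (kappa I)
      have h7 := Nat.mod_lt (ℓ i) (show 0 < kappa I by omega)
      omega
    have h6 : (ℓ i : ℝ) < kappa I * ((ℓ i / kappa I : ℕ) : ℝ) + kappa I := by exact_mod_cast h5
    rw [sub_le_iff_le_add, div_le_iff₀ hκ0]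
    linarith
  · rw [cConst, ← Real.exp_nat_mul]
    congr 1
    ring
  · exact sub_nonneg.2 (pow_le_one₀ hx.le hx1)
  · exact pow_le_pow_of_le_one hx.le hx1 (card_le_kappa hI)

/-! ### The initial potential -/

theorem startMemory_valid (hI : I.IsAbout M F) (hm : 0 < m) :
    (startMemory I).Valid M F I m ebar := by
  refine ⟨coherent_start hI, fun b => ?_, fun b q _ => ⟨?_, fun h => ?_⟩⟩
  · cases b
    · exact Estimate.sound_fresh hm (fun _ => le_rfl) fun _ => zero_le_one
    · exact Estimate.sound_fresh hm (fun _ => zero_le_one) fun _ => le_rfl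
  · have h0 := valueAct_nonneg M F q
    have h1 := valueAct_le_one M F q
    cases b
    · change 0 ≤ (-1) * (0 - valueAct M F q)
      linarith
    · change 0 ≤ 1 * (1 - valueAct M F q)
      linarith
  · cases b <;> cases h

/-- Fresh windows are at most 1, nothing is pending, and each room is at most `p / ebar`. So a
budget is at most `p + 2 * p / ebar` for the upper and `p + 3 * p / ebar` for the lower bounds, the
latter also containing the room of the upper ones. There are `p` pairs and two modes. -/
theorem startMemory_potential_le (hm : 0 < m) (hI : I.IsAbout M F) (he : 0 < ebar) :
    (startMemory I).potential M F I ebar ≤ 8 * (allPairs M.E).card +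
      16 * (allPairs M.E).card ^ 2 + 40 * ((allPairs M.E).card ^ 2 / ebar) := by
  set p : ℝ := ((allPairs M.E).card : ℝ) with hp
  have hv := startMemory_valid (ebar := ebar) hI hm
  have hterm : ∀ b md, ∀ q ∈ allPairs M.E,
      2 * (startMemory I).window M F I (4 * ebar) b md q +
        4 * (startMemory I).budget (allPairs M.E) ebar b q ≤
      2 + 4 * (p + (if b then 2 else 3) * (p / ebar)) := by
    intro b md q _
    have h1 : (startMemory I).window M F I (4 * ebar) b md q ≤ 1 := by
      cases b <;> exact Memory.window_fresh rfl rfl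
    have h2 := (hv.sound b).room_le (allPairs M.E) he (sgn_eq b)
    have h3 := (hv.sound true).room_le (allPairs M.E) he (sgn_eq true)
    have h4 : ((allPairs M.E \ (startMemory I).inner).card : ℝ) ≤ p :=
      Nat.cast_le.2 (Finset.card_le_card Finset.sdiff_subset)
    have h5 : ((startMemory I).est b).pending
        (max ((startMemory I).est b).star ((startMemory I).partner b)) q = 0 := by
      cases b <;> simp [Estimate.pending, Estimate.fresh, startMemory, Memory.est]
    unfold Memory.budget
    rw [h5]
    cases b with
    | true =>
      have h6 : (startMemory I).partnerRoom (allPairs M.E) ebar true = 0 := rfl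
      rw [h6, if_pos rfl]
      linarith
    | false =>
      have h6 : (startMemory I).partnerRoom (allPairs M.E) ebar false =
        ((startMemory I).est true).room (allPairs M.E) ebar (sgn true) := rfl
      rw [h6, if_neg (by simp)]
      linarith
  unfold Memory.potential windows
  rw [Finset.sum_product]
  simp only [Finset.sum_product]
  calc _ ≤ ∑ b : Bool, ∑ _md : Bool, ∑ _q ∈ allPairs M.E,
        (2 + 4 * (p + (if b then 2 else 3) * (p / ebar))) :=
        Finset.sum_le_sum fun b _ => Finset.sum_le_sum fun md _ => Finset.sum_le_sum fun q hq =>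
          hterm b md q hq
    _ = _ := by
        simp only [Finset.sum_const, Finset.card_univ, Fintype.card_bool, Fintype.sum_bool,
          nsmul_eq_mul, ← hp]
        push_cast
        ring

/-- The choice of `m` bounds `failBound` by the inverse of `24 * K * n * (1 + K * n / e) / δ`, and
half of this, without `δ`, bounds `Φ`. Here `K ≥ 2` gives `12 * K ^ 2 ≥ 48`, enough for the
coefficient 40 and, as `2 * n ^ 2 ≤ n ^ 2 / e`, also for the 16. -/
theorem failBound_mul_le {p n K δ e Φ : ℝ} {m : ℕ} (hp : 0 ≤ p) (hpn : p ≤ n) (hn : 1 ≤ n)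
    (hK : 2 ≤ K) (he : 0 < e) (he2 : e ≤ 1 / 2) (hδ : 0 < δ)
    (hm : Real.log (6 * (K * n) * (1 + K * n / e) / (δ / 4)) / (2 * e ^ 2) ≤ m)
    (hΦ : Φ ≤ 8 * p + 16 * p ^ 2 + 40 * (p ^ 2 / e)) : failBound m e * Φ ≤ δ / 2 := by
  set X := 6 * (K * n) * (1 + K * n / e) / (δ / 4) with hX
  have hX0 : 0 < X := by positivity
  have h1 : failBound m e ≤ X⁻¹ := by
    rw [← Real.exp_log hX0, ← Real.exp_neg, failBound]
    refine Real.exp_le_exp.2 (neg_le_neg ?_)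
    rw [div_le_iff₀ (by positivity)] at hm
    linarith
  have h2 : Φ ≤ 12 * (K * n) * (1 + K * n / e) := by
    refine hΦ.trans ?_
    have h3 : p ^ 2 ≤ n ^ 2 := pow_le_pow_left₀ hp hpn 2
    have h4 : p ^ 2 / e ≤ n ^ 2 / e := div_le_div_of_nonneg_right h3 he.le
    have h5 : 2 * n ^ 2 ≤ n ^ 2 / e := by
      rw [le_div_iff₀ he]
      nlinarith [sq_nonneg n]
    have h6 : 12 * (K * n) * (1 + K * n / e) = 12 * K * n + 12 * K ^ 2 * (n ^ 2 / e) := by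
      field_simp
    have h7 : 0 ≤ n ^ 2 / e := by positivity
    have h8 : 4 ≤ K ^ 2 := by nlinarith
    rw [h6]
    nlinarith [mul_le_mul_of_nonneg_right h8 h7, mul_le_mul_of_nonneg_right hK (zero_le_one.trans hn)]
  have h3 : 0 ≤ 12 * (K * n) * (1 + K * n / e) := by positivity
  calc failBound m e * Φ ≤ failBound m e * (12 * (K * n) * (1 + K * n / e)) :=
        mul_le_mul_of_nonneg_left h2 (Real.exp_nonneg _)
    _ ≤ X⁻¹ * (12 * (K * n) * (1 + K * n / e)) := mul_le_mul_of_nonneg_right h1 h3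
    _ = δ / 2 := by
        rw [hX]
        have : 1 + K * n / e ≠ 0 := by positivity
        have : K * n ≠ 0 := by positivity
        field_simp
        norm_num

theorem dqlSamples_pos (hI : I.IsAbout M F) {nA : ℕ} (hnA : 1 ≤ nA) {ε δ : ℝ} (hε : 0 < ε)
    (hδ : 0 < δ) (hδ1 : δ < 1) : 0 < dqlSamples I nA ε (δ / 4) := by
  have he := epsBar_pos hI hε
  have hK : (1 : ℝ) ≤ I.K := Nat.one_le_cast.2 hI.one_le_K
  have hn : (1 : ℝ) ≤ nA := Nat.one_le_cast.2 hnA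
  have hKn : 1 ≤ (I.K : ℝ) * nA := one_le_mul_of_one_le_of_one_le hK hn
  refine Nat.ceil_pos.2 (div_pos (Real.log_pos ?_) (by positivity))
  rw [lt_div_iff₀ (by positivity)]
  have h1 : 0 ≤ (I.K : ℝ) * nA / epsBar I ε := by positivity
  nlinarith

theorem startMemory_failProb_le (hI : I.IsAbout M F) {nA : ℕ} (hnA : ∑ s, (M.E s).card ≤ nA)
    {ε δ : ℝ} (hε : 0 < ε) (hδ : 0 < δ) (hδ1 : δ < 1) {ℓ : ℕ → ℕ} (hℓ : Admissible I δ ℓ) :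
    (odql I nA ε δ ℓ).failProb M (CorrectOutput M F I ε) (.running (startMemory I) M.init) ≤ δ := by
  classical
  have hnA1 : 1 ≤ nA := by
    refine le_trans ?_ hnA
    exact (Finset.card_pos.2 (M.E_nonempty M.init)).trans_le
      (Finset.single_le_sum (f := fun s => (M.E s).card) (fun _ _ => Nat.zero_le _)
        (Finset.mem_univ M.init))
  set ebar := epsBar I ε with hebar
  set m := dqlSamples I nA ε (δ / 4) with hm
  have he : 0 < ebar := epsBar_pos hI hε
  have hm0 : 0 < m := dqlSamples_pos hI hnA1 hε hδ hδ1
  have hv : (startMemory I).Valid M F I m ebar := startMemory_valid hI hm0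
  have hx0 := pow_pos hI.ratio_pos I.K
  have hx1 : (I.pmin / I.Em) ^ I.K ≤ 1 := pow_le_one₀ hI.ratio_pos.le hI.ratio_le_one
  have hmul := epsBar_mul hI ε
  rw [← hebar] at hmul
  rcases lt_or_ge 1 ε with hε1 | hε1
  -- The initial gap is at most 1, so the algorithm halts at once.
  · have hgap : (startMemory I).upper I I.init - (startMemory I).lower I I.init < ε := by
      have h1 := Memory.bound_le_one (I := I) hv.sound true I.init
      have h2 := Memory.bound_nonneg (I := I) hv.sound false I.init
      change (startMemory I).bound I true I.init - (startMemory I).bound I false I.init < ε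
      linarith
    exact (failProb_halt _ ε m ebar ℓ rfl rfl hgap (hv.correctOutput hI hgap) M.init).le.trans hδ.le
  have hK1 : (1 : ℝ) ≤ I.K := Nat.one_le_cast.2 hI.one_le_K
  have hεx : 6 * ebar * I.K < (I.pmin / I.Em) ^ I.K * ε := by
    have := mul_pos hε hx0
    linarith
  have hcard : ∀ i, 1 ≤ i → Fintype.card S < 3 * ℓ i ^ 3 := by
    intro i hi
    have h1 := (card_le_kappa hI).trans (hℓ i hi).1
    have h2 := (two_le_kappa hI).trans (hℓ i hi).1
    have h3 : ℓ i ≤ ℓ i ^ 3 := Nat.le_self_pow (by norm_num) _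
    omega
  obtain ⟨n, hn⟩ := exists_nat_gt ((startMemory I).work (allPairs M.E) m ebar)
  suffices hβ : ∃ β : ℝ, 0 ≤ β ∧ β * (startMemory I).potential M F I ebar ≤ δ / 2 ∧
      ∀ (μ : Memory S A) (h : μ.Valid M F I m ebar), ¬ (μ.cls M.init).IsEnd → ∀ n,
      (exploreChain M I hI μ h.coherent).expect n M.init
        (fun l => if (μ.process I m ebar l).Valid M F I m ebar then
          min 1 (β * (μ.process I m ebar l).potential M F I ebar) else 1)
        (fun _ => β * μ.reserve M ebar) ≤ β * μ.potential M F I ebar by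
    obtain ⟨β, hβ0, hβ1, hβ2⟩ := hβ
    have h1 := failProb_le hI he hδ.le hεx hβ0 (fun μ h => by convert hβ2 μ h)
      (fun μ h hi => by convert expect_cap_le hI h.coherent hℓ hi) hcard n
      (startMemory I) hv rfl rfl le_rfl hn
    have h2 : (startMemory I).iter = 1 := rfl
    rw [h2, pow_one] at h1
    refine h1.trans ?_
    linarith
  rcases hI.one_le_K.eq_or_lt with hK | hK
  -- A single state that is not an end: no path ever ends, no update is made, and `β = 0` will do.
  -- The general argument uses `K ≥ 2`, which gives `24 * ebar ≤ (pmin / Em) ^ K`.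
  · refine ⟨0, le_rfl, by rw [zero_mul]; linarith, fun μ h hend n => ?_⟩
    have hsub : Subsingleton S := Fintype.card_le_one_iff_subsingleton.1 (hI.card_le.trans hK.ge)
    refine (Chain.expect_mono _ n M.init (gT' := fun _ => 0) (gC' := fun _ => 0)
      (fun l _ _ h1 => ?_) fun l _ _ => ?_).trans ?_
    · rw [Subsingleton.elim (Chain.lastState M.init l) M.init] at h1
      exact absurd h1 hend
    · rw [zero_mul]
    · rw [Chain.expect_const, zero_mul]
  · have hK2 : (2 : ℝ) ≤ I.K := by exact_mod_cast hK
    have hle : 24 * ebar ≤ (I.pmin / I.Em) ^ I.K := by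
      have h1 := mul_le_mul_of_nonneg_right hK2 he.le
      have h2 := mul_le_of_le_one_left hx0.le hε1
      linarith
    refine ⟨failBound m ebar, Real.exp_nonneg _, ?_, fun μ h _ n => ?_⟩
    · refine failBound_mul_le (p := (allPairs M.E).card) (n := nA) (K := I.K) (Nat.cast_nonneg _)
        (Nat.cast_le.2 ((card_allPairs M.E).le.trans hnA)) (Nat.one_le_cast.2 hnA1) hK2 he
        (by linarith) hδ (Nat.le_ceil _) (startMemory_potential_le hm0 hI he)
    · convert expect_update_le h he (tiltMax_bound (by positivity) (by linarith) hx1) n M.init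

end Parameters

end ODQL

/-! ### The theorem -/

theorem mainTheorem2 {S A : Type*} [Fintype S] [DecidableEq S] [DecidableEq A]
    (M : ODQL.MDP S A) (F : Finset S)
    (I : ODQL.LimitedInfo S A) (hI : I.IsAbout M F)
    (nA : ℕ) (hnA : ∑ s, (M.E s).card ≤ nA)
    (ε δ : ℝ) (hε : 0 < ε) (hδ : 0 < δ)
    (ℓ : ℕ → ℕ) (hℓ : ODQL.Admissible I δ ℓ) :
    ENNReal.ofReal (1 - δ) ≤
      (ODQL.odql I nA ε δ ℓ).probStopsWith M (ODQL.CorrectOutput M F I ε) := by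
  rcases lt_or_ge δ 1 with hδ1 | hδ1
  · have h := ODQL.startMemory_failProb_le hI hnA hε hδ hδ1 hℓ
    rw [ODQL.SimAlgorithm.failProb] at h
    rw [ODQL.SimAlgorithm.probStopsWith_eq]
    refine ENNReal.ofReal_le_of_le_toReal ?_
    have hstart : (ODQL.odql I nA ε δ ℓ).start = ODQL.startMemory I := rfl
    rw [hstart]
    linarith
  · rw [ENNReal.ofReal_of_nonpos (by linarith)]
    exact zero_le
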